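/- **Conventions.** A $Q$-manifold is a pair $(M,Q)$ of a smooth supermanifold $M$ (of some dimension $p|q$) and an odd vector field $Q$ on $M$ with $Q^2=\tfrac12[Q,Q]=0$. Let $\mathcal T^{(n,m)}(M)$ be the space of $n$ times contravariant and $m$ times covariant tensor fields on $M$, and let $\delta=L_Q$ be the Lie derivative along $Q$, so that $\delta^2=0$. Put $$H_Q^{(n,m)}(M)=\{T\in\mathcal T^{(n,m)}(M):\delta T=0\}\,/\,\{T:T=\delta S\text{ for some }S\in\mathcal T^{(n,m)}(M)\},\qquad H_Q(M)=\bigoplus_{n,m}H_Q^{(n,m)}(M).$$ A *universal polynomial expression* $\mathcal C$ of type $(n,m)$ is a formal expression in index notation with $n$ upper and $m$ lower free indices: a finite real linear combination of products of Kronecker symbols $\delta^i_j$ and of partial derivatives of finite order of the components $Q^i$ and of the Christoffel symbols $\Gamma^k_{ij}$, with indices permuted and with pairs of an upper and a lower index contracted (all with the sign rule for supermanifolds). Such an expression does not refer to a dimension: given an odd vector field $Q$ and a symmetric connection $\nabla$ on a supermanifold $M$ of any dimension $p|q$, it can be evaluated in every coordinate chart of $M$ and gives there an array $\mathcal C_\nabla[Q]$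 of $n$-upper, $m$-lower components. The expression $\mathcal C$ is a *universal cocycle* if for all $p,q$, every $Q$-manifold $(M,Q)$ of dimension $p|q$ and every symmetric (torsion-free) affine connection $\nabla$ on $M$, the arrays in the charts of $M$ are the components of a tensor field $\mathcal C_\nabla[Q]\in\mathcal T^{(n,m)}(M)$ and $\delta(\mathcal C_\nabla[Q])=0$. **Theorem 1.** Let $\mathcal C$ be a universal cocycle of type $(n,m)$ and let $(M,Q)$ be a $Q$-manifold. Then $$[\mathcal C_{\nabla_0}[Q]]=[\mathcal C_{\nabla_1}[Q]]\quad\text{in }H^{(n,m)}_Q(M)$$ for any two symmetric connections $\nabla_0,\nabla_1$ on $M$. Hence the class depends only on the $Q$-manifold: there is $c\in H_Q^{(n,m)}(M)$ with $[\mathcal C_\nabla[Q]]=c$ for every symmetric connection $\nabla$ on $M$. -/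

import Mathlib

open scoped ContDiff

universe u v

noncomputable section

/-! ### Grassmann algebras -/

/-- The real Grassmann algebra on `q` odd generators; `x I` is the coefficient of the monomial
`ξ^{i₁} ⋯ ξ^{iₖ}`, where `I = {i₁ < ⋯ < iₖ}`. -/
def Grassmann (q : ℕ) : Type := Finset (Fin q) → ℝ

namespace Grassmann

variable {q : ℕ}

instance : NormedAddCommGroup (Grassmann q) :=
  inferInstanceAs (NormedAddCommGroup (Finset (Fin q) → ℝ))

instance : NormedSpace ℝ (Grassmann q) :=
  inferInstanceAs (NormedSpace ℝ (Finset (Fin q) → ℝ))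

@[ext] theorem ext {x y : Grassmann q} (h : ∀ I, x I = y I) : x = y := funext h

/-- The number of transpositions that sort the concatenation of the increasing words `I`, `J`. -/
def inv (I J : Finset (Fin q)) : ℕ := ((I ×ˢ J).filter fun z => z.2 < z.1).card

instance : Mul (Grassmann q) :=
  ⟨fun x y K => ∑ I ∈ K.powerset, (-1) ^ inv I (K \ I) * (x I * y (K \ I))⟩

instance : One (Grassmann q) := ⟨fun I => if I = ∅ then 1 else 0⟩

theorem mul_apply (x y : Grassmann q) (K : Finset (Fin q)) :
    (x * y) K = ∑ I ∈ K.powerset, (-1) ^ inv I (K \ I) * (x I * y (K \ I)) := rfl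

theorem one_apply (I : Finset (Fin q)) : (1 : Grassmann q) I = if I = ∅ then 1 else 0 := rfl

theorem add_apply (x y : Grassmann q) (I : Finset (Fin q)) : (x + y) I = x I + y I := rfl

theorem zero_apply (I : Finset (Fin q)) : (0 : Grassmann q) I = 0 := rfl

theorem smul_apply (r : ℝ) (x : Grassmann q) (I : Finset (Fin q)) : (r • x) I = r * x I := rfl

theorem inv_union_left {A B : Finset (Fin q)} (C : Finset (Fin q)) (h : Disjoint A B) :
    inv (A ∪ B) C = inv A C + inv B C := by
  unfold inv
  rw [Finset.union_product, Finset.filter_union, Finset.card_union_of_disjoint]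
  refine Finset.disjoint_filter_filter ?_
  rw [Finset.disjoint_left] at h ⊢
  intro z hz hz'
  exact h (Finset.mem_product.1 hz).1 (Finset.mem_product.1 hz').1

theorem inv_union_right (A : Finset (Fin q)) {B C : Finset (Fin q)} (h : Disjoint B C) :
    inv A (B ∪ C) = inv A B + inv A C := by
  unfold inv
  rw [Finset.product_union, Finset.filter_union, Finset.card_union_of_disjoint]
  refine Finset.disjoint_filter_filter ?_
  rw [Finset.disjoint_left] at h ⊢
  intro z hz hz'
  exact h (Finset.mem_product.1 hz).2 (Finset.mem_product.1 hz').2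

protected theorem mul_assoc (x y z : Grassmann q) : x * y * z = x * (y * z) := by
  ext K
  simp only [mul_apply, Finset.mul_sum, Finset.sum_mul]
  rw [Finset.sum_sigma', Finset.sum_sigma']
  refine Finset.sum_bij' (fun s _ => ⟨s.2, s.1 \ s.2⟩) (fun s _ => ⟨s.1 ∪ s.2, s.1⟩) ?_ ?_ ?_ ?_ ?_
  · rintro ⟨I, A⟩ h
    simp only [Finset.mem_sigma, Finset.mem_powerset] at h ⊢
    exact ⟨h.2.trans h.1, Finset.sdiff_subset_sdiff h.1 le_rfl⟩
  · rintro ⟨A, B⟩ h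
    simp only [Finset.mem_sigma, Finset.mem_powerset] at h ⊢
    exact ⟨Finset.union_subset h.1 (h.2.trans Finset.sdiff_subset), Finset.subset_union_left⟩
  · rintro ⟨I, A⟩ h
    simp only [Finset.mem_sigma, Finset.mem_powerset] at h
    simp [Finset.union_sdiff_of_subset h.2]
  · rintro ⟨A, B⟩ h
    simp only [Finset.mem_sigma, Finset.mem_powerset] at h
    have : Disjoint A B := (Finset.disjoint_sdiff).mono_right h.2
    simp [Finset.union_sdiff_cancel_left this]
  · rintro ⟨I, A⟩ h
    simp only [Finset.mem_sigma, Finset.mem_powerset] at h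
    obtain ⟨hI, hA⟩ := h
    have e : (K \ A) \ (I \ A) = K \ I := by
      ext i
      simp only [Finset.mem_sdiff]
      constructor
      · rintro ⟨⟨h1, h2⟩, h3⟩
        exact ⟨h1, fun h => h3 ⟨h, h2⟩⟩
      · rintro ⟨h1, h2⟩
        exact ⟨⟨h1, fun h => h2 (hA h)⟩, fun h => h2 h.1⟩
    have d1 : Disjoint A (I \ A) := Finset.disjoint_sdiff
    have d2 : Disjoint (I \ A) (K \ I) :=
      (Finset.disjoint_sdiff).mono_left Finset.sdiff_subset
    have u1 : I = A ∪ (I \ A) := (Finset.union_sdiff_of_subset hA).symm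
    have u2 : K \ A = (I \ A) ∪ (K \ I) := by
      ext i
      simp only [Finset.mem_sdiff, Finset.mem_union]
      constructor
      · rintro ⟨h1, h2⟩
        by_cases h : i ∈ I
        · exact Or.inl ⟨h, h2⟩
        · exact Or.inr ⟨h1, h⟩
      · rintro (⟨h1, h2⟩ | ⟨h1, h2⟩)
        · exact ⟨hI h1, h2⟩
        · exact ⟨h1, fun h => h2 (hA h)⟩
    have s1 : inv I (K \ I) = inv A (K \ I) + inv (I \ A) (K \ I) := by
      conv_lhs => rw [u1]
      rw [inv_union_left _ d1]
      congr 2 <;> rw [Finset.union_sdiff_of_subset hA]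
    have s2 : inv A (K \ A) = inv A (I \ A) + inv A (K \ I) := by
      rw [u2, inv_union_right _ d2]
    simp only [e]
    rw [s1, s2]
    ring

theorem inv_empty_left (J : Finset (Fin q)) : inv ∅ J = 0 := by simp [inv]

theorem inv_empty_right (J : Finset (Fin q)) : inv J ∅ = 0 := by simp [inv]

instance : Ring (Grassmann q) :=
  { (inferInstance : AddCommGroup (Grassmann q)),
    (inferInstance : Mul (Grassmann q)),
    (inferInstance : One (Grassmann q)) with
    mul_assoc := Grassmann.mul_assoc
    one_mul := fun x => by
      ext K
      rw [mul_apply, Finset.sum_eq_single ∅]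
      · simp [one_apply, inv_empty_left]
      · intro I _ hI
        simp [one_apply, hI]
      · simp
    mul_one := fun x => by
      ext K
      rw [mul_apply, Finset.sum_eq_single K]
      · simp [one_apply, inv_empty_right]
      · intro I hI hK
        have : K \ I ≠ ∅ := by
          rw [Ne, Finset.sdiff_eq_empty_iff_subset]
          exact fun h => hK (Finset.Subset.antisymm (Finset.mem_powerset.1 hI) h)
        simp [one_apply, this]
      · simp
    left_distrib := fun x y z => by
      ext K
      simp only [mul_apply, add_apply, mul_add, Finset.sum_add_distrib]
    right_distrib := fun x y z => by
      ext K
      simp only [mul_apply, add_apply, mul_add, add_mul, Finset.sum_add_distrib]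
    zero_mul := fun x => by
      ext K
      simp [mul_apply, zero_apply]
    mul_zero := fun x => by
      ext K
      simp [mul_apply, zero_apply] }

instance : Algebra ℝ (Grassmann q) :=
  Algebra.ofModule
    (fun r x y => by
      ext K
      simp only [mul_apply, smul_apply, Finset.mul_sum]
      exact Finset.sum_congr rfl fun I _ => by ring)
    (fun r x y => by
      ext K
      simp only [mul_apply, smul_apply, Finset.mul_sum]
      exact Finset.sum_congr rfl fun I _ => by ring)

/-- The odd generator `ξ^a`. -/
def gen (a : Fin q) : Grassmann q := fun I => if I = {a} then 1 else 0

/-- The parity automorphism, `(-1)^{|x|} x` on homogeneous elements. -/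
def hat (x : Grassmann q) : Grassmann q := fun I => (-1) ^ I.card * x I

/-- The left derivative `∂/∂ξ^a`. -/
def pderiv (a : Fin q) (x : Grassmann q) : Grassmann q := fun I =>
  if a ∈ I then 0 else (-1) ^ (I.filter (· < a)).card * x (insert a I)

/-- `x` is homogeneous of parity `k mod 2`. -/
def HasParity (k : ℕ) (x : Grassmann q) : Prop := ∀ I, I.card % 2 ≠ k % 2 → x I = 0

end Grassmann

/-! ### Superfunctions and coordinate maps -/

/-- Superfunctions in `p` even and `q` odd variables. They are total functions of the even
variables; on a superdomain only the values on the underlying open set matter. -/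
abbrev SuperFun (p q : ℕ) : Type := (Fin p → ℝ) → Grassmann q

/-- Labels of the coordinates of `ℝ^{p|q}`: `p` even ones and `q` odd ones. -/
abbrev Idx (p q : ℕ) : Type := Fin p ⊕ Fin q

section Local

variable {p q : ℕ}

/-- The parity of a coordinate. -/
def Idx.par : Idx p q → ℕ
  | .inl _ => 0
  | .inr _ => 1

/-- The parity of a tuple of coordinates. -/
def parSum {n : ℕ} (I : Fin n → Idx p q) : ℕ := ∑ r, (I r).par

/-- The parity of the part of a tuple of coordinates that precedes position `s`. -/
def parBefore {n : ℕ} (I : Fin n → Idx p q) (s : Fin n) : ℕ :=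
  ∑ r ∈ Finset.univ.filter (· < s), (I r).par

namespace SuperFun

/-- The Koszul sign rule for coefficients: moving `f` to the left through an object of parity `k`
replaces it by `(-1)^{k|f|} f`. -/
def tw (k : ℕ) (f : SuperFun p q) : SuperFun p q := fun x => Grassmann.hat^[k] (f x)

/-- The coordinate superfunctions. -/
def coord : Idx p q → SuperFun p q
  | .inl i => fun x => x i • 1
  | .inr a => fun _ => Grassmann.gen a

/-- The (left) partial derivatives. -/
def pd : Idx p q → SuperFun p q → SuperFun p q
  | .inl i, f => fun x => fderiv ℝ f x (Pi.single i 1)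
  | .inr a, f => fun x => Grassmann.pderiv a (f x)

end SuperFun

/-- A map into `ℝ^{p'|q'}`, given by the pullbacks of the coordinates. -/
abbrev SuperMap (p q p' q' : ℕ) : Type := Idx p' q' → SuperFun p q

variable {p' q' : ℕ}

/-- The underlying map of even points. -/
def SuperMap.body (φ : SuperMap p q p' q') (x : Fin p → ℝ) : Fin p' → ℝ := fun i => φ (.inl i) x ∅

/-- The nilpotent part of the pullback of an even coordinate. -/
def SuperMap.nil (φ : SuperMap p q p' q') (i : Fin p') : SuperFun p q :=
  fun x => φ (.inl i) x - φ.body x i • 1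

/-- The pullback `f ∘ φ` of a superfunction, by Taylor expansion in the nilpotent parts of the even
coordinates (which is finite: products of more than `q` of them vanish). -/
def SuperFun.comp (f : SuperFun p' q') (φ : SuperMap p q p' q') : SuperFun p q := fun x =>
  ∑ k ∈ Finset.range (q + 1), ∑ j : Fin k → Fin p', ∑ I : Finset (Fin q'),
    ((k.factorial : ℝ)⁻¹ * iteratedFDeriv ℝ k f (φ.body x) (fun s => Pi.single (j s) 1) I) •
      ((List.ofFn fun s => φ.nil (j s) x).prod * ((I.sort (· ≤ ·)).map fun a => φ (.inr a) x).prod)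

/-! ### Arrays of tensor components -/

/-- Arrays of components of `n` times contravariant and `m` times covariant tensors: `T` stands for
`∑ T I J · ∂_{I₁} ⊗ ⋯ ⊗ ∂_{Iₙ} ⊗ dx^{J₁} ⊗ ⋯ ⊗ dx^{Jₘ}`, where `dx^j` has the parity of `x^j`,
`df = ∑ dx^j ∂_j f`, and the pairing is `⟨∂_i, dx^j⟩ = δ_i^j`. -/
abbrev Arr (p q n m : ℕ) : Type := (Fin n → Idx p q) → (Fin m → Idx p q) → SuperFun p q

/-- If `e_i = ∑ b i k · f_k`, with `b i k` of parity `|i| + |k|`, then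
`e_{I₁} ⊗ ⋯ ⊗ e_{Iₙ} = ∑ frameProd b I K · f_{K₁} ⊗ ⋯ ⊗ f_{Kₙ}`. -/
def frameProd {n : ℕ} (b : Idx p q → Idx p q → SuperFun p q) (I K : Fin n → Idx p q) :
    SuperFun p q :=
  (List.ofFn fun s => SuperFun.tw (parBefore K s) (b (I s) (K s))).prod

/-- The tensor law for the coordinate change `y = φ(x)` at the point `x`, for the components `T` in
the coordinates `x` and `T'` in the coordinates `y`. Both sides are the components of the tensor
with respect to `∂/∂y^{K₁} ⊗ ⋯ ⊗ ∂/∂y^{Kₙ} ⊗ dx^{J₁} ⊗ ⋯ ⊗ dx^{Jₘ}`, using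
`∂/∂x^i = ∑ (∂φ^k/∂x^i) ∂/∂y^k` and `dy^l = ∑ dx^j ∂φ^l/∂x^j`. -/
def TensorLaw {n m : ℕ} (φ : SuperMap p q p q) (T T' : Arr p q n m) (x : Fin p → ℝ) : Prop :=
  ∀ (K : Fin n → Idx p q) (J : Fin m → Idx p q),
    (∑ I, T I J * frameProd (fun i k => SuperFun.pd i (φ k)) I K) x =
      (∑ L, SuperFun.comp (T' K L) φ * SuperFun.tw (parSum K)
        (frameProd (fun l j => SuperFun.tw j.par (SuperFun.pd j (φ l))) L J)) x

/-- The Lie derivative along an odd vector field `Q`: the odd derivation of the tensor algebra with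
`L_Q f = ∑ Q^i ∂_i f`, `L_Q ∂_i = [Q, ∂_i] = - (-1)^{|i|} ∑ (∂_i Q^k) ∂_k` and
`L_Q dx^j = d(Q^j) = ∑ dx^i ∂_i Q^j`. -/
def lieDeriv {n m : ℕ} (Q : Arr p q 1 0) (T : Arr p q n m) : Arr p q n m := fun I J =>
  (∑ i, Q (fun _ => i) Fin.elim0 * SuperFun.pd i (T I J)) +
  (∑ s, ∑ i, (-1) ^ parBefore I s * (SuperFun.tw 1 (T (Function.update I s i) J) *
      SuperFun.tw (parBefore I s)
        (-(-1) ^ i.par * SuperFun.pd i (Q (fun _ => I s) Fin.elim0)))) +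
  (∑ s, ∑ j, (-1) ^ (parSum I + parBefore J s) *
      (SuperFun.tw 1 (T I (Function.update J s j)) *
        SuperFun.tw (parSum I + parBefore J s)
          (SuperFun.tw (J s).par (SuperFun.pd (J s) (Q (fun _ => j) Fin.elim0)))))

end Local

section Linearity

variable {p q p' q' : ℕ}

theorem SuperFun.tw_add (k : ℕ) (f g : SuperFun p q) : tw k (f + g) = tw k f + tw k g := by
  induction k generalizing f g with
  | zero => rfl
  | succ k ih =>
    have h : ∀ f : SuperFun p q, tw (k + 1) f = tw k (fun x => Grassmann.hat (f x)) := fun _ => rfl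
    rw [h, h, h, ← ih]
    congr 1
    funext x
    ext I
    simp [Grassmann.hat, Grassmann.add_apply, mul_add]

theorem SuperFun.tw_smul (k : ℕ) (r : ℝ) (f : SuperFun p q) : tw k (r • f) = r • tw k f := by
  induction k generalizing f with
  | zero => rfl
  | succ k ih =>
    have h : ∀ f : SuperFun p q, tw (k + 1) f = tw k (fun x => Grassmann.hat (f x)) := fun _ => rfl
    rw [h, h, ← ih]
    congr 1
    funext x
    ext I
    simp [Grassmann.hat, Grassmann.smul_apply, mul_left_comm]

theorem SuperFun.pd_add (i : Idx p q) {f g : SuperFun p q} {x : Fin p → ℝ}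
    (hf : ContDiffAt ℝ ∞ f x) (hg : ContDiffAt ℝ ∞ g x) :
    pd i (f + g) x = pd i f x + pd i g x := by
  cases i with
  | inl i =>
    simp only [pd]
    rw [fderiv_add (hf.differentiableAt (by simp)) (hg.differentiableAt (by simp))]
    rfl
  | inr a =>
    ext I
    simp only [pd, Grassmann.pderiv, Pi.add_apply, Grassmann.add_apply]
    split_ifs <;> ring

theorem SuperFun.pd_smul (i : Idx p q) (r : ℝ) {f : SuperFun p q} {x : Fin p → ℝ}
    (hf : ContDiffAt ℝ ∞ f x) : pd i (r • f) x = r • pd i f x := by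
  cases i with
  | inl i =>
    simp only [pd]
    rw [fderiv_const_smul (hf.differentiableAt (by simp))]
    rfl
  | inr a =>
    ext I
    simp only [pd, Grassmann.pderiv, Pi.smul_apply, Grassmann.smul_apply]
    split_ifs <;> ring

theorem SuperFun.comp_add {f g : SuperFun p' q'} {φ : SuperMap p q p' q'} {x : Fin p → ℝ}
    (hf : ContDiffAt ℝ ∞ f (φ.body x)) (hg : ContDiffAt ℝ ∞ g (φ.body x)) :
    SuperFun.comp (f + g) φ x = SuperFun.comp f φ x + SuperFun.comp g φ x := by
  simp only [SuperFun.comp, ← Finset.sum_add_distrib]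
  refine Finset.sum_congr rfl fun k _ => Finset.sum_congr rfl fun j _ =>
    Finset.sum_congr rfl fun I _ => ?_
  rw [← add_smul]
  congr 1
  rw [iteratedFDeriv_add_apply (hf.of_le (by exact_mod_cast le_top))
    (hg.of_le (by exact_mod_cast le_top))]
  simp [Grassmann.add_apply, mul_add]

theorem SuperFun.comp_smul (r : ℝ) {f : SuperFun p' q'} {φ : SuperMap p q p' q'} {x : Fin p → ℝ}
    (hf : ContDiffAt ℝ ∞ f (φ.body x)) :
    SuperFun.comp (r • f) φ x = r • SuperFun.comp f φ x := by
  simp only [SuperFun.comp, Finset.smul_sum]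
  refine Finset.sum_congr rfl fun k _ => Finset.sum_congr rfl fun j _ =>
    Finset.sum_congr rfl fun I _ => ?_
  rw [smul_smul]
  congr 1
  rw [iteratedFDeriv_const_smul_apply (hf.of_le (by exact_mod_cast le_top))]
  simp [Grassmann.smul_apply, mul_left_comm]

theorem TensorLaw.add {n m : ℕ} {φ : SuperMap p q p q} {S S' T T' : Arr p q n m} {x : Fin p → ℝ}
    (hS' : ∀ K L, ContDiffAt ℝ ∞ (S' K L) (φ.body x))
    (hT' : ∀ K L, ContDiffAt ℝ ∞ (T' K L) (φ.body x))
    (h : TensorLaw φ S S' x) (h' : TensorLaw φ T T' x) : TensorLaw φ (S + T) (S' + T') x := by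
  intro K J
  have e := congrArg₂ (· + ·) (h K J) (h' K J)
  simp only [Finset.sum_apply, Pi.mul_apply, ← Finset.sum_add_distrib, ← add_mul] at e
  simp only [Finset.sum_apply, Pi.mul_apply, Pi.add_apply]
  rw [e]
  refine Finset.sum_congr rfl fun L _ => ?_
  rw [← SuperFun.comp_add (hS' K L) (hT' K L)]

theorem TensorLaw.smul {n m : ℕ} (r : ℝ) {φ : SuperMap p q p q} {T T' : Arr p q n m}
    {x : Fin p → ℝ} (hT' : ∀ K L, ContDiffAt ℝ ∞ (T' K L) (φ.body x))
    (h : TensorLaw φ T T' x) : TensorLaw φ (r • T) (r • T') x := by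
  intro K J
  have e := congrArg (r • ·) (h K J)
  simp only [Finset.sum_apply, Pi.mul_apply, Finset.smul_sum, ← smul_mul_assoc] at e
  simp only [Finset.sum_apply, Pi.mul_apply, Pi.smul_apply]
  rw [e]
  refine Finset.sum_congr rfl fun L _ => ?_
  rw [← SuperFun.comp_smul r (hT' K L)]

theorem lieDeriv_add {n m : ℕ} (Q : Arr p q 1 0) {S T : Arr p q n m} {x : Fin p → ℝ}
    (hS : ∀ I J, ContDiffAt ℝ ∞ (S I J) x) (hT : ∀ I J, ContDiffAt ℝ ∞ (T I J) x)
    (I : Fin n → Idx p q) (J : Fin m → Idx p q) :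
    lieDeriv Q (S + T) I J x = lieDeriv Q S I J x + lieDeriv Q T I J x := by
  simp only [lieDeriv, Pi.add_apply, Finset.sum_apply, Pi.mul_apply, SuperFun.tw_add,
    SuperFun.pd_add _ (hS _ _) (hT _ _), mul_add, add_mul, Finset.sum_add_distrib]
  abel

theorem lieDeriv_smul {n m : ℕ} (Q : Arr p q 1 0) (r : ℝ) {T : Arr p q n m} {x : Fin p → ℝ}
    (hT : ∀ I J, ContDiffAt ℝ ∞ (T I J) x) (I : Fin n → Idx p q) (J : Fin m → Idx p q) :
    lieDeriv Q (r • T) I J x = r • lieDeriv Q T I J x := by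
  simp only [lieDeriv, Pi.add_apply, Pi.smul_apply, Finset.sum_apply, Pi.mul_apply,
    SuperFun.tw_smul, SuperFun.pd_smul _ r (hT _ _), mul_smul_comm, smul_mul_assoc, smul_add,
    Finset.smul_sum]

end Linearity

/-! ### Supermanifolds, tensor fields, connections -/

/-- A smooth supermanifold of dimension `p|q`: a Hausdorff, second countable space covered by
charts, with coordinate changes in even and odd coordinates that lift the coordinate changes of the
underlying space and satisfy the cocycle condition. -/
structure Supermanifold (p q : ℕ) : Type (max (u + 1) (v + 1)) where
  carrier : Type u
  [top : TopologicalSpace carrier]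
  [t2 : T2Space carrier]
  [secondCountable : SecondCountableTopology carrier]
  ι : Type v
  chart : ι → OpenPartialHomeomorph carrier (Fin p → ℝ)
  cover : ∀ z, ∃ a, z ∈ (chart a).source
  trans : ι → ι → SuperMap p q p q
  trans_body : ∀ a b, ∀ x ∈ (chart a).target ∩ (chart a).symm ⁻¹' (chart b).source,
    (trans a b).body x = chart b ((chart a).symm x)
  trans_parity : ∀ a b k, ∀ x ∈ (chart a).target ∩ (chart a).symm ⁻¹' (chart b).source,
    (trans a b k x).HasParity k.par
  trans_smooth : ∀ a b k,
    ContDiffOn ℝ ∞ (trans a b k) ((chart a).target ∩ (chart a).symm ⁻¹' (chart b).source)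
  trans_self : ∀ a k, ∀ x ∈ (chart a).target, trans a a k x = SuperFun.coord k x
  trans_comp : ∀ a b c k, ∀ x ∈ (chart a).target ∩
      (chart a).symm ⁻¹' ((chart b).source ∩ (chart c).source),
    trans a c k x = SuperFun.comp (trans b c k) (trans a b) x

attribute [instance] Supermanifold.top Supermanifold.t2 Supermanifold.secondCountable

namespace Supermanifold

variable {p q : ℕ}

/-- The overlap of two charts in the coordinates of the first one. -/
def overlap (M : Supermanifold.{u, v} p q) (a b : M.ι) : Set (Fin p → ℝ) :=
  (M.chart a).target ∩ (M.chart a).symm ⁻¹' (M.chart b).source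

theorem body_mem_target (M : Supermanifold.{u, v} p q) {a b : M.ι} {x : Fin p → ℝ}
    (hx : x ∈ M.overlap a b) : (M.trans a b).body x ∈ (M.chart b).target := by
  rw [M.trans_body a b x hx]
  exact (M.chart b).map_source hx.2

/-- The components of a tensor field are smooth in every chart. -/
def IsSmooth (M : Supermanifold.{u, v} p q) {n m : ℕ} (T : M.ι → Arr p q n m) : Prop :=
  ∀ a I J, ContDiffOn ℝ ∞ (T a I J) (M.chart a).target

theorem IsSmooth.contDiffAt {M : Supermanifold.{u, v} p q} {n m : ℕ} {T : M.ι → Arr p q n m}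
    (h : M.IsSmooth T) {a : M.ι} {x : Fin p → ℝ} (hx : x ∈ (M.chart a).target)
    (I : Fin n → Idx p q) (J : Fin m → Idx p q) : ContDiffAt ℝ ∞ (T a I J) x :=
  (h a I J).contDiffAt ((M.chart a).open_target.mem_nhds hx)

/-- The space `𝒯^{(n,m)}(M)` of `n` times contravariant and `m` times covariant tensor fields, given
by their components in the charts. (Values off the charts are irrelevant; a family that vanishes on
the charts represents the zero tensor field, and its class in cohomology is zero.) -/
def tensorField (M : Supermanifold.{u, v} p q) (n m : ℕ) : Submodule ℝ (M.ι → Arr p q n m) where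
  carrier := {T | M.IsSmooth T ∧ ∀ a b, ∀ x ∈ M.overlap a b, TensorLaw (M.trans a b) (T a) (T b) x}
  add_mem' := by
    rintro S T ⟨hS, hS'⟩ ⟨hT, hT'⟩
    exact ⟨fun a I J => (hS a I J).add (hT a I J), fun a b x hx =>
      (hS' a b x hx).add (hS.contDiffAt (M.body_mem_target hx))
        (hT.contDiffAt (M.body_mem_target hx)) (hT' a b x hx)⟩
  zero_mem' := by
    have h0 : M.IsSmooth (0 : M.ι → Arr p q n m) := fun a I J => contDiffOn_const
    refine ⟨h0, fun a b x hx K J => ?_⟩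
    have hc : SuperFun.comp (0 : SuperFun p q) (M.trans a b) x = 0 := by
      have := SuperFun.comp_smul (φ := M.trans a b) (x := x) 0 (f := (0 : SuperFun p q))
        contDiffAt_const
      simpa using this
    simp only [Finset.sum_apply, Pi.mul_apply, Pi.zero_apply, zero_mul, hc, Finset.sum_const_zero]
  smul_mem' := by
    rintro r T ⟨hT, hT'⟩
    exact ⟨fun a I J => (hT a I J).const_smul r, fun a b x hx =>
      (hT' a b x hx).smul r (hT.contDiffAt (M.body_mem_target hx))⟩

/-- A homological vector field: an odd vector field `Q` with `Q² = 0`. -/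
structure HomologicalField (M : Supermanifold.{u, v} p q) where
  comp : M.ι → Arr p q 1 0
  mem : comp ∈ M.tensorField 1 0
  odd : ∀ a i, ∀ x ∈ (M.chart a).target,
    (comp a (fun _ => i) Fin.elim0 x).HasParity (i.par + 1)
  sq : ∀ a k, ∀ x ∈ (M.chart a).target,
    (∑ i, comp a (fun _ => i) Fin.elim0 * SuperFun.pd i (comp a (fun _ => k) Fin.elim0)) x = 0

/-- A symmetric (torsion-free) affine connection, `∇_{∂_i} ∂_j = ∑ Γ i j k · ∂_k` in each chart. The
transformation law is `∇_X (f Y) = X(f) Y + (-1)^{|X||f|} f ∇_X Y` applied to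
`∂/∂x^i = ∑ (∂φ^k/∂x^i) ∂/∂y^k` for a coordinate change `y = φ(x)`. -/
structure SymmetricConnection (M : Supermanifold.{u, v} p q) where
  Γ : M.ι → Idx p q → Idx p q → Idx p q → SuperFun p q
  smooth : ∀ a i j k, ContDiffOn ℝ ∞ (Γ a i j k) (M.chart a).target
  even : ∀ a i j k, ∀ x ∈ (M.chart a).target, (Γ a i j k x).HasParity (i.par + j.par + k.par)
  symm : ∀ a i j k, ∀ x ∈ (M.chart a).target,
    Γ a i j k x = (-1) ^ (i.par * j.par) * Γ a j i k x
  law : ∀ a b, ∀ x ∈ M.overlap a b, ∀ i j r,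
    (∑ k, Γ a i j k * SuperFun.pd k (M.trans a b r)) x =
      (SuperFun.pd i (SuperFun.pd j (M.trans a b r)) +
        ∑ k, ∑ l, SuperFun.tw i.par (SuperFun.pd j (M.trans a b l)) *
          SuperFun.pd i (M.trans a b k) * SuperFun.comp (Γ b k l r) (M.trans a b)) x

/-! ### The cohomology of `δ = L_Q` -/

/-- The `δ`-closed tensor fields. -/
def cocycle (M : Supermanifold.{u, v} p q) (Q : M.HomologicalField) (n m : ℕ) :
    Submodule ℝ (M.ι → Arr p q n m) where
  carrier := {T | T ∈ M.tensorField n m ∧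
    ∀ a I J, ∀ x ∈ (M.chart a).target, lieDeriv (Q.comp a) (T a) I J x = 0}
  add_mem' := by
    rintro S T ⟨hS, hS'⟩ ⟨hT, hT'⟩
    refine ⟨add_mem hS hT, fun a I J x hx => ?_⟩
    have := lieDeriv_add (Q.comp a) (hS.1.contDiffAt hx) (hT.1.contDiffAt hx) I J
    rw [hS' a I J x hx, hT' a I J x hx, add_zero] at this
    exact this
  zero_mem' := by
    refine ⟨zero_mem _, fun a I J x hx => ?_⟩
    have := lieDeriv_smul (Q.comp a) 0 (T := (0 : Arr p q n m)) (x := x)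
      (fun _ _ => contDiffAt_const) I J
    rw [zero_smul, zero_smul] at this
    exact this
  smul_mem' := by
    rintro r T ⟨hT, hT'⟩
    refine ⟨Submodule.smul_mem _ r hT, fun a I J x hx => ?_⟩
    have := lieDeriv_smul (Q.comp a) r (hT.1.contDiffAt hx) I J
    rw [hT' a I J x hx, smul_zero] at this
    exact this

/-- The `δ`-exact tensor fields. -/
def coboundary (M : Supermanifold.{u, v} p q) (Q : M.HomologicalField) (n m : ℕ) :
    Submodule ℝ (M.ι → Arr p q n m) where
  carrier := {T | T ∈ M.tensorField n m ∧ ∃ S ∈ M.tensorField n m,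
    ∀ a I J, ∀ x ∈ (M.chart a).target, T a I J x = lieDeriv (Q.comp a) (S a) I J x}
  add_mem' := by
    rintro T T' ⟨hT, S, hS, h⟩ ⟨hT', S', hS', h'⟩
    refine ⟨add_mem hT hT', S + S', add_mem hS hS', fun a I J x hx => ?_⟩
    refine Eq.trans ?_
      (lieDeriv_add (Q.comp a) (hS.1.contDiffAt hx) (hS'.1.contDiffAt hx) I J).symm
    rw [← h a I J x hx, ← h' a I J x hx]
    rfl
  zero_mem' := by
    refine ⟨zero_mem _, 0, zero_mem _, fun a I J x hx => ?_⟩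
    have := lieDeriv_smul (Q.comp a) 0 (T := (0 : Arr p q n m)) (x := x)
      (fun _ _ => contDiffAt_const) I J
    rw [zero_smul, zero_smul] at this
    exact this.symm
  smul_mem' := by
    rintro r T ⟨hT, S, hS, h⟩
    refine ⟨Submodule.smul_mem _ r hT, r • S, Submodule.smul_mem _ r hS, fun a I J x hx => ?_⟩
    refine Eq.trans ?_ (lieDeriv_smul (Q.comp a) r (hS.1.contDiffAt hx) I J).symm
    rw [← h a I J x hx]
    rfl

/-- The cohomology `H_Q^{(n,m)}(M)`: closed tensor fields modulo exact ones. -/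
abbrev Cohomology (M : Supermanifold.{u, v} p q) (Q : M.HomologicalField) (n m : ℕ) : Type _ :=
  M.cocycle Q n m ⧸ (M.coboundary Q n m).submoduleOf (M.cocycle Q n m)

end Supermanifold

/-! ### Universal cocycles -/

/-- The partial derivatives of all orders of the components of `Q` and of the Christoffel symbols,
as symbols with one upper and `m` lower indices. -/
inductive Jet : ℕ → Type
  | Q : Jet 0
  | Γ : Jet 2
  | d {m : ℕ} : Jet m → Jet (m + 1)

/-- Universal polynomial expressions in index notation, with `n` upper and `m` lower free indices:
real linear combinations of products of Kronecker symbols and partial derivatives of the components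
of `Q` and of the Christoffel symbols, with permuted and contracted indices. The index notation does
not refer to a dimension, so that an expression makes sense in each coordinate system in each
dimension `p|q`. -/
inductive UnivExpr : ℕ → ℕ → Type
  | jet {m : ℕ} : Jet m → UnivExpr 1 m
  | one : UnivExpr 0 0
  | delta : UnivExpr 1 1
  | add {n m : ℕ} : UnivExpr n m → UnivExpr n m → UnivExpr n m
  | smul {n m : ℕ} : ℝ → UnivExpr n m → UnivExpr n m
  | mul {n m n' m' : ℕ} : UnivExpr n m → UnivExpr n' m' → UnivExpr (n + n') (m + m')
  | perm {n m : ℕ} : Equiv.Perm (Fin n) → Equiv.Perm (Fin m) → UnivExpr n m → UnivExpr n m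
  | contr {n m : ℕ} : UnivExpr (n + 1) (m + 1) → UnivExpr n m

section Eval

variable {p q : ℕ}

/-- The Koszul sign of a permutation of the factors of `∂_{I₁} ⊗ ⋯ ⊗ ∂_{Iₙ}`, from the order
`σ 0, σ 1, …` to the standard order. -/
def koszulSign {n : ℕ} (σ : Equiv.Perm (Fin n)) (I : Fin n → Idx p q) : ℤ :=
  ∏ z ∈ (Finset.univ : Finset (Fin n × Fin n)).filter (fun z => z.1 < z.2 ∧ σ z.2 < σ z.1),
    (-1) ^ ((I (σ z.1)).par * (I (σ z.2)).par)

/-- The evaluation of a jet symbol in coordinates. The Christoffel symbols enter as the array of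
`∑ dx^j ⊗ dx^i ⊗ (∇_{∂_i} ∂_j)`, and `d` is `T ↦ ∑ dx^j ⊗ ∂_j T`, with the new slot moved to the first
covariant place. -/
def Jet.eval (Q : Arr p q 1 0) (Γ : Idx p q → Idx p q → Idx p q → SuperFun p q) :
    {m : ℕ} → Jet m → Arr p q 1 m
  | _, .Q => Q
  | _, .Γ => fun I J => (-1) ^ ((I 0).par * ((J 0).par + (J 1).par)) *
      SuperFun.tw ((J 0).par + (J 1).par) (Γ (J 1) (J 0) (I 0))
  | _, .d S => fun I J => (-1) ^ ((J 0).par * (I 0).par) *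
      SuperFun.tw (J 0).par (SuperFun.pd (J 0) (S.eval Q Γ I (Fin.tail J)))

/-- The evaluation of a universal expression in coordinates. The Kronecker symbol is
`∑ dx^i ⊗ ∂_i`, products are tensor products with the contravariant slots of the second factor moved
in front of the covariant slots of the first one, and `contr` pairs the last contravariant slot with
the first covariant slot. -/
def UnivExpr.eval (Q : Arr p q 1 0) (Γ : Idx p q → Idx p q → Idx p q → SuperFun p q) :
    {n m : ℕ} → UnivExpr n m → Arr p q n m
  | _, _, .jet S => S.eval Q Γ
  | _, _, .one => fun _ _ => 1
  | _, _, .delta => fun I J => if I 0 = J 0 then (-1) ^ (I 0).par else 0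
  | _, _, .add S T => S.eval Q Γ + T.eval Q Γ
  | _, _, .smul r T => r • T.eval Q Γ
  | _, _, @UnivExpr.mul n m n' m' S T => fun I J =>
      (-1) ^ (parSum (fun s => J (Fin.castAdd m' s)) * parSum (fun s => I (Fin.natAdd n s))) *
        (S.eval Q Γ (fun s => I (Fin.castAdd n' s)) (fun s => J (Fin.castAdd m' s)) *
          SuperFun.tw
            (parSum (fun s => I (Fin.castAdd n' s)) + parSum (fun s => J (Fin.castAdd m' s)))
            (T.eval Q Γ (fun s => I (Fin.natAdd n s)) (fun s => J (Fin.natAdd m s))))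
  | _, _, .perm σ τ T => fun I J =>
      (koszulSign σ I * koszulSign τ J) • T.eval Q Γ (I ∘ σ) (J ∘ τ)
  | _, _, .contr T => fun I J => ∑ a, T.eval Q Γ (Fin.snoc I a) (Fin.cons a J)

end Eval

namespace UnivExpr

variable {p q n m : ℕ}

/-- The family `𝒞_∇[Q]` of the values of a universal expression in the charts of `M`. -/
def onCharts (C : UnivExpr n m) (M : Supermanifold.{u, v} p q) (Q : M.HomologicalField)
    (D : M.SymmetricConnection) : M.ι → Arr p q n m :=
  fun a => C.eval (Q.comp a) (D.Γ a)

/-- A universal cocycle: on every `Q`-manifold, of every dimension, and for every symmetric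
connection, the values of the expression in the charts are the components of a tensor field, and
this tensor field is `δ`-closed. -/
def IsUniversalCocycle (C : UnivExpr n m) : Prop :=
  ∀ (p q : ℕ) (M : Supermanifold.{u, v} p q) (Q : M.HomologicalField) (D : M.SymmetricConnection),
    C.onCharts M Q D ∈ M.cocycle Q n m

/-- The class of `𝒞_∇[Q]` in `H_Q(M)`. -/
def IsUniversalCocycle.charClass {C : UnivExpr n m} (hC : IsUniversalCocycle.{u, v} C)
    (M : Supermanifold.{u, v} p q) (Q : M.HomologicalField) (D : M.SymmetricConnection) :
    M.Cohomology Q n m :=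
  Submodule.Quotient.mk ⟨C.onCharts M Q D, hC p q M Q D⟩

end UnivExpr

end

/-!
Let `∇₀`, `∇₁` be symmetric connections on the `Q`-manifold `(M, Q)`.  A universal cocycle may be
evaluated on a supermanifold of any dimension, and it is evaluated here on the product
`M × ℝ^{1|1}` with coordinates `t` (even) and `θ` (odd) on the second factor.  The product carries
the homological vector field `Q' = Q + θ ∂_t` and the symmetric connection
`∇' = (1 - t) ∇₀ + t ∇₁`, whose Christoffel symbols vanish as soon as one index is `t` or `θ`
(`Supermanifold.stab`, `HomologicalField.stab`, `SymmetricConnection.stab`).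
Along `M` the components of the value of the cocycle on the product have the form
`C_{∇_t}[Q] + θ Ψ_t`, where `∇_t = (1 - t) ∇₀ + t ∇₁`.  The transition maps of the product do not
involve `t` and `θ`, so the `θ`-component of its tensor law says that `Ψ_t` is a tensor field on
`M` (`slice_mem_tensorField`), and the `θ`-component of the closedness equation reads
`d/dt C_{∇_t}[Q] = δ Ψ_t` (`hasDerivAt_eval_interp`).

That the `θ`-free part of the value on the product is `C_{∇_t}[Q]` is the main point
(`UnivExpr.r0_eval_stab_emb`), because a contraction in the product also runs over the indices `t`
and `θ`.  The two extra terms cancel like the two summands of a supertrace on `ℝ^{1|1}`.  For this,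
consider the arrays of components modulo `θ`, and the odd operator `PtArr.rot` on them: it replaces
one index `t` by `θ` upstairs, or one index `θ` by `t` downstairs, with the sign of the position;
up to sign it is the Lie derivative along `θ ∂_t`.  An array is `PtArr.Balanced` if it vanishes
where it has more extra indices upstairs than downstairs, and its `rot` vanishes where it has at
least as many extra indices upstairs as downstairs.  The jets of `Q'` and `∇'` are balanced, and
balance is preserved by products, permutations and contractions of indices; for a balanced array
the two extra terms of a contraction cancel (`PtArr.Balanced.contr_emb`).

Finally `C_{∇_t}[Q]` is polynomial in `t`, of a degree bounded independently of the chart and the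
point (`UnivExpr.exists_isPoly`).  So the integral over `0 ≤ t ≤ 1` is a fixed finite combination
`∑ wᵢ f'(τᵢ) = f 1 - f 0` (`exists_quadrature`), and `C_{∇₁}[Q] - C_{∇₀}[Q] = δ (∑ wᵢ Ψ_{τᵢ})`
is exact without any integration of tensor fields.
-/

noncomputable section

/-! ### The Grassmann algebra with one more generator -/

namespace Grassmann

variable {q : ℕ}

instance : FiniteDimensional ℝ (Grassmann q) :=
  inferInstanceAs (FiniteDimensional ℝ (Finset (Fin q) → ℝ))

theorem sub_apply (x y : Grassmann q) (I : Finset (Fin q)) : (x - y) I = x I - y I := rfl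

theorem neg_apply (x : Grassmann q) (I : Finset (Fin q)) : (-x) I = -x I := rfl

/-- The monomial `I` of `q` generators, in the last `q` of `q + 1` generators. -/
def up (I : Finset (Fin q)) : Finset (Fin (q + 1)) := I.map (Fin.succEmb q)

/-- The part of a monomial that involves the last `q` of `q + 1` generators. -/
def down (K : Finset (Fin (q + 1))) : Finset (Fin q) := Finset.univ.filter fun a => a.succ ∈ K

@[simp] theorem succ_mem_up {I : Finset (Fin q)} {a : Fin q} : a.succ ∈ up I ↔ a ∈ I := by
  simp [up]

@[simp] theorem zero_notMem_up (I : Finset (Fin q)) : (0 : Fin (q + 1)) ∉ up I := by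
  simp [up]

@[simp] theorem down_up (I : Finset (Fin q)) : down (up I) = I := by
  ext a; simp [down]

@[simp] theorem down_insert (I : Finset (Fin q)) : down (insert 0 (up I)) = I := by
  ext a; simp [down]

@[simp] theorem card_up (I : Finset (Fin q)) : (up I).card = I.card := by simp [up]

@[simp] theorem card_insert_up (I : Finset (Fin q)) : (insert 0 (up I)).card = I.card + 1 := by
  rw [Finset.card_insert_of_notMem (zero_notMem_up I), card_up]

theorem up_injective : Function.Injective (up : Finset (Fin q) → _) :=
  Finset.map_injective _

@[simp] theorem up_inj {I J : Finset (Fin q)} : up I = up J ↔ I = J := up_injective.eq_iff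

@[simp] theorem up_empty : up (∅ : Finset (Fin q)) = ∅ := by simp [up]

theorem up_down {K : Finset (Fin (q + 1))} (h : 0 ∉ K) : up (down K) = K := by
  ext a
  refine Fin.cases ?_ (fun a => ?_) a
  · simp [h]
  · simp [down]

theorem insert_up_down {K : Finset (Fin (q + 1))} (h : 0 ∈ K) : insert 0 (up (down K)) = K := by
  ext a
  refine Fin.cases ?_ (fun a => ?_) a
  · simp [h]
  · simp [down]

theorem up_insert (a : Fin q) (I : Finset (Fin q)) : up (insert a I) = insert a.succ (up I) := by
  simp [up]

theorem up_sdiff (I J : Finset (Fin q)) : up (I \ J) = up I \ up J := Finset.map_sdiff _ _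

theorem sum_powerset_up {β : Type*} [AddCommMonoid β] (K : Finset (Fin q))
    (f : Finset (Fin (q + 1)) → β) :
    ∑ I ∈ (up K).powerset, f I = ∑ I ∈ K.powerset, f (up I) := by
  classical
  have : (up K).powerset = K.powerset.map ⟨up, up_injective⟩ := by
    ext I
    simp only [Finset.mem_powerset, Finset.mem_map, Function.Embedding.coeFn_mk]
    constructor
    · intro h
      have h0 : 0 ∉ I := fun h' => zero_notMem_up K (h h')
      refine ⟨down I, fun a ha => ?_, up_down h0⟩
      simp only [down, Finset.mem_filter, Finset.mem_univ, true_and] at ha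
      simpa using h ha
    · rintro ⟨J, hJ, rfl⟩
      exact Finset.map_subset_map.2 hJ
  rw [this, Finset.sum_map]
  rfl

theorem sum_finset_succ {β : Type*} [AddCommMonoid β] (f : Finset (Fin (q + 1)) → β) :
    ∑ I, f I = ∑ I, f (up I) + ∑ I, f (insert 0 (up I)) := by
  have h : (Finset.univ : Finset (Finset (Fin (q + 1)))) =
      (insert 0 (up (Finset.univ : Finset (Fin q)))).powerset := by
    ext I
    simp only [Finset.mem_univ, Finset.mem_powerset, true_iff]
    intro a _
    refine Fin.cases ?_ (fun a => ?_) a <;> simp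
  rw [h, Finset.sum_powerset_insert (zero_notMem_up _), sum_powerset_up, sum_powerset_up]
  simp

theorem inv_up_up (I J : Finset (Fin q)) : inv (up I) (up J) = inv I J := by
  unfold inv up
  rw [← Finset.card_map ((Fin.succEmb q).prodMap (Fin.succEmb q))]
  congr 1
  ext ⟨a, b⟩
  simp only [Finset.mem_filter, Finset.mem_product, Finset.mem_map, Prod.exists,
    Function.Embedding.coe_prodMap, Prod.map_apply, Prod.mk.injEq, Fin.coe_succEmb]
  constructor
  · rintro ⟨⟨⟨a, ha, rfl⟩, b, hb, rfl⟩, h⟩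
    exact ⟨a, b, ⟨⟨ha, hb⟩, Fin.succ_lt_succ_iff.1 h⟩, rfl, rfl⟩
  · rintro ⟨a, b, ⟨⟨ha, hb⟩, h⟩, rfl, rfl⟩
    exact ⟨⟨⟨a, ha, rfl⟩, b, hb, rfl⟩, Fin.succ_lt_succ_iff.2 h⟩

theorem inv_singleton_zero_left (J : Finset (Fin (q + 1))) : inv {0} J = 0 := by
  simp [inv]

theorem inv_singleton_zero_right (J : Finset (Fin q)) : inv (up J) {0} = J.card := by
  unfold inv
  rw [Finset.filter_true_of_mem]
  · simp
  · rintro ⟨a, b⟩ h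
    simp only [Finset.mem_product, Finset.mem_singleton] at h
    obtain ⟨h1, rfl⟩ := h
    exact Fin.pos_iff_ne_zero.2 fun h => zero_notMem_up J (h ▸ h1)

theorem inv_insert_left (I : Finset (Fin q)) (J : Finset (Fin (q + 1))) :
    inv (insert 0 (up I)) J = inv (up I) J := by
  rw [Finset.insert_eq, inv_union_left _ (by simp), inv_singleton_zero_left, zero_add]

theorem inv_insert_right (I J : Finset (Fin q)) :
    inv (up I) (insert 0 (up J)) = I.card + inv I J := by
  rw [Finset.insert_eq, inv_union_right _ (by simp), inv_singleton_zero_right, inv_up_up]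

/-- With the first of `q + 1` generators called `θ`, every element is uniquely
`lift x₀ + θ * lift x₁`; this is `x₀`. -/
def r0 : Grassmann (q + 1) →L[ℝ] Grassmann q :=
  LinearMap.toContinuousLinearMap
    { toFun := fun x I => x (up I), map_add' := fun _ _ => rfl, map_smul' := fun _ _ => rfl }

/-- The component `x₁` of `lift x₀ + θ * lift x₁`. -/
def r1 : Grassmann (q + 1) →L[ℝ] Grassmann q :=
  LinearMap.toContinuousLinearMap
    { toFun := fun x I => x (insert 0 (up I)), map_add' := fun _ _ => rfl,
      map_smul' := fun _ _ => rfl }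

/-- The inclusion of the Grassmann algebra on the last `q` of `q + 1` generators. -/
def lift : Grassmann q →L[ℝ] Grassmann (q + 1) :=
  LinearMap.toContinuousLinearMap
    { toFun := fun x K => if 0 ∈ K then 0 else x (down K)
      map_add' := fun x y => by
        ext K
        change (if 0 ∈ K then (0 : ℝ) else _) = (if 0 ∈ K then 0 else _) + (if 0 ∈ K then 0 else _)
        split_ifs <;> simp [add_apply]
      map_smul' := fun r x => by
        ext K
        change (if 0 ∈ K then (0 : ℝ) else _) = r * (if 0 ∈ K then 0 else _)
        split_ifs <;> simp [smul_apply] }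

/-- The parity automorphism as a continuous linear map. -/
def hatL : Grassmann q →L[ℝ] Grassmann q :=
  LinearMap.toContinuousLinearMap
    { toFun := hat
      map_add' := fun x y => by ext K; simp [hat, add_apply, mul_add]
      map_smul' := fun r x => by ext K; simp [hat, smul_apply, mul_left_comm] }

/-- The left derivative as a continuous linear map. -/
def pderivL (a : Fin q) : Grassmann q →L[ℝ] Grassmann q :=
  LinearMap.toContinuousLinearMap
    { toFun := pderiv a
      map_add' := fun x y => by
        ext K; by_cases h : a ∈ K <;> simp [pderiv, h, add_apply, mul_add]
      map_smul' := fun r x => by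
        ext K; by_cases h : a ∈ K <;> simp [pderiv, h, smul_apply, mul_left_comm] }

theorem r0_apply (x : Grassmann (q + 1)) (I : Finset (Fin q)) : r0 x I = x (up I) := rfl

theorem r1_apply (x : Grassmann (q + 1)) (I : Finset (Fin q)) : r1 x I = x (insert 0 (up I)) := rfl

theorem lift_apply (x : Grassmann q) (K : Finset (Fin (q + 1))) :
    lift x K = if 0 ∈ K then 0 else x (down K) := rfl

theorem ext_r {x y : Grassmann (q + 1)} (h0 : r0 x = r0 y) (h1 : r1 x = r1 y) : x = y := by
  ext K
  by_cases h : 0 ∈ K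
  · have := congrFun h1 (down K)
    rwa [r1_apply, r1_apply, insert_up_down h] at this
  · have := congrFun h0 (down K)
    rwa [r0_apply, r0_apply, up_down h] at this

@[simp] theorem r0_lift (x : Grassmann q) : r0 (lift x) = x := by
  ext I; simp [r0_apply, lift_apply]

@[simp] theorem r1_lift (x : Grassmann q) : r1 (lift x) = 0 := by
  ext I; simp [r1_apply, lift_apply, zero_apply]

@[simp] theorem r0_mul (x y : Grassmann (q + 1)) : r0 (x * y) = r0 x * r0 y := by
  ext K
  simp only [r0_apply, mul_apply, sum_powerset_up]
  refine Finset.sum_congr rfl fun I _ => ?_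
  rw [← up_sdiff, inv_up_up]

@[simp] theorem r0_one : r0 (1 : Grassmann (q + 1)) = 1 := by
  ext K
  simp only [r0_apply, one_apply]
  simp only [show (∅ : Finset (Fin (q + 1))) = up ∅ by simp, up_inj]

@[simp] theorem r1_one : r1 (1 : Grassmann (q + 1)) = 0 := by
  ext K
  simp [r1_apply, one_apply, zero_apply]

@[simp] theorem r1_mul (x y : Grassmann (q + 1)) :
    r1 (x * y) = r1 x * r0 y + hat (r0 x) * r1 y := by
  ext K
  simp only [add_apply, r1_apply, r0_apply, mul_apply,
    Finset.sum_powerset_insert (zero_notMem_up _), sum_powerset_up]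
  rw [add_comm]
  congr 1
  · refine Finset.sum_congr rfl fun I _ => ?_
    have : insert 0 (up K) \ insert 0 (up I) = up (K \ I) := by
      rw [up_sdiff, Finset.insert_sdiff_insert, Finset.sdiff_insert_of_notMem]
      simp
    rw [this, inv_insert_left, inv_up_up]
  · refine Finset.sum_congr rfl fun I _ => ?_
    have : insert 0 (up K) \ up I = insert 0 (up (K \ I)) := by
      rw [up_sdiff, Finset.insert_sdiff_of_notMem _ (zero_notMem_up I)]
    rw [this, inv_insert_right, hat, r0_apply, pow_add]
    ring

theorem hat_mul (x y : Grassmann q) : hat (x * y) = hat x * hat y := by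
  ext K
  simp only [hat, mul_apply, Finset.mul_sum]
  refine Finset.sum_congr rfl fun I hI => ?_
  rw [← Finset.card_sdiff_add_card_eq_card (Finset.mem_powerset.1 hI), pow_add]
  ring

theorem hat_add (x y : Grassmann q) : hat (x + y) = hat x + hat y := hatL.map_add x y

@[simp] theorem hat_zero : hat (0 : Grassmann q) = 0 := hatL.map_zero

theorem hat_smul (r : ℝ) (x : Grassmann q) : hat (r • x) = r • hat x := hatL.map_smul r x

@[simp] theorem hat_one : hat (1 : Grassmann q) = 1 := by
  ext K
  by_cases h : K = ∅ <;> simp [hat, one_apply, h]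

@[simp] theorem hat_hat (x : Grassmann q) : hat (hat x) = x := by
  ext K
  simp only [hat, ← mul_assoc, ← mul_pow]
  simp

@[simp] theorem r0_hat (x : Grassmann (q + 1)) : r0 (hat x) = hat (r0 x) := by
  ext K; simp [r0_apply, hat]

@[simp] theorem r1_hat (x : Grassmann (q + 1)) : r1 (hat x) = -hat (r1 x) := by
  ext K; simp [r1_apply, hat, neg_apply, pow_succ]

theorem lift_mul (x y : Grassmann q) : lift (x * y) = lift x * lift y :=
  ext_r (by simp) (by simp)

@[simp] theorem lift_one : lift (1 : Grassmann q) = 1 := ext_r (by simp) (by simp)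

theorem hat_lift (x : Grassmann q) : hat (lift x) = lift (hat x) := ext_r (by simp) (by simp)

/-- `lift` as a ring homomorphism. -/
def liftHom : Grassmann q →+* Grassmann (q + 1) where
  toFun := lift
  map_one' := lift_one
  map_mul' := lift_mul
  map_zero' := map_zero lift
  map_add' := map_add lift

@[simp] theorem r0_gen_zero : r0 (gen (0 : Fin (q + 1))) = 0 := by
  ext K
  have : up K ≠ {0} := fun h => zero_notMem_up K (h ▸ Finset.mem_singleton_self 0)
  simp [r0_apply, gen, this, zero_apply]

@[simp] theorem r1_gen_zero : r1 (gen (0 : Fin (q + 1))) = 1 := by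
  ext K
  simp only [r1_apply, gen, one_apply]
  rw [show ({0} : Finset (Fin (q + 1))) = insert 0 (up ∅) by rw [up_empty]; rfl]
  congr 1
  rw [eq_iff_iff]
  constructor
  · intro h
    have := congrArg down h
    rwa [down_insert, down_insert] at this
  · rintro rfl; rfl

@[simp] theorem r0_pderiv_succ (a : Fin q) (x : Grassmann (q + 1)) :
    r0 (pderiv a.succ x) = pderiv a (r0 x) := by
  ext K
  simp only [r0_apply, pderiv, succ_mem_up, up_insert]
  congr 3
  rw [← card_up (K.filter _)]
  congr 1
  ext b
  refine Fin.cases ?_ (fun b => ?_) b <;> simp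

@[simp] theorem r1_pderiv_succ (a : Fin q) (x : Grassmann (q + 1)) :
    r1 (pderiv a.succ x) = -pderiv a (r1 x) := by
  ext K
  have h1 : a.succ ∈ insert 0 (up K) ↔ a ∈ K := by simp
  have h2 : ((insert 0 (up K)).filter (· < a.succ)).card = (K.filter (· < a)).card + 1 := by
    rw [← card_insert_up (K.filter _)]
    congr 1
    ext b
    refine Fin.cases ?_ (fun b => ?_) b <;> simp
  have h3 : insert a.succ (insert 0 (up K)) = insert 0 (up (insert a K)) := by
    rw [up_insert, Finset.insert_comm]
  simp only [r1_apply, neg_apply, pderiv, h1, h2, h3]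
  split_ifs
  · simp
  · rw [pow_succ]; ring

@[simp] theorem r0_pderiv_zero (x : Grassmann (q + 1)) : r0 (pderiv 0 x) = r1 x := by
  ext K
  simp [r0_apply, r1_apply, pderiv]

@[simp] theorem r1_pderiv_zero (x : Grassmann (q + 1)) : r1 (pderiv 0 x) = 0 := by
  ext K
  simp [r1_apply, pderiv, zero_apply]

theorem lift_gen (a : Fin q) : lift (gen a) = gen a.succ := by
  refine ext_r ?_ ?_
  · rw [r0_lift]
    ext K
    simp only [r0_apply, gen, show ({a.succ} : Finset (Fin (q + 1))) = up {a} by simp [up], up_inj]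
  · rw [r1_lift]
    ext K
    have : insert 0 (up K) ≠ {a.succ} := fun h => by
      have := h ▸ Finset.mem_insert_self 0 (up K)
      simp at this
      exact absurd this.symm (Fin.succ_ne_zero a)
    simp [r1_apply, gen, this, zero_apply]

/-! ### Homogeneous elements -/

theorem hasParity_zero (k : ℕ) : (0 : Grassmann q).HasParity k := fun _ _ => rfl

theorem HasParity.add {x y : Grassmann q} {k : ℕ} (h : x.HasParity k) (h' : y.HasParity k) :
    (x + y).HasParity k := fun I hI => by rw [add_apply, h I hI, h' I hI, add_zero]

theorem HasParity.smul {x : Grassmann q} {k : ℕ} (r : ℝ) (h : x.HasParity k) :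
    (r • x).HasParity k := fun I hI => by rw [smul_apply, h I hI, mul_zero]

theorem HasParity.hat_eq {x : Grassmann q} {k : ℕ} (h : x.HasParity k) :
    hat x = (-1 : ℝ) ^ k • x := by
  ext I
  rw [hat, smul_apply]
  by_cases hI : I.card % 2 = k % 2
  · rw [neg_one_pow_eq_pow_mod_two, hI, ← neg_one_pow_eq_pow_mod_two]
  · rw [h I hI, mul_zero, mul_zero]

theorem HasParity.lift {x : Grassmann q} {k : ℕ} (h : x.HasParity k) :
    (lift x).HasParity k := by
  intro K hK
  rw [lift_apply]
  split_ifs with h0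
  · rfl
  · refine h _ ?_
    rwa [← card_up, up_down h0]

theorem hasParity_one : (1 : Grassmann q).HasParity 0 := by
  intro I hI
  have : I ≠ ∅ := by rintro rfl; simp at hI
  simp [one_apply, this]

theorem hasParity_gen (a : Fin q) : (gen a).HasParity 1 := by
  intro I hI
  have : I ≠ {a} := by rintro rfl; simp at hI
  simp [gen, this]

/-! ### Nilpotency -/

/-- A product of `k` elements without constant term has no terms of degree less than `k`. -/
theorem prod_apply_eq_zero (l : List (Grassmann q)) (hl : ∀ x ∈ l, x ∅ = 0) (I : Finset (Fin q))
    (hI : I.card < l.length) : l.prod I = 0 := by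
  induction l generalizing I with
  | nil => simp at hI
  | cons x l ih =>
    rw [List.prod_cons, mul_apply]
    refine Finset.sum_eq_zero fun A hA => ?_
    by_cases h : A = ∅
    · rw [h, hl x (by simp)]; simp
    · have hc : (I \ A).card < l.length := by
        have h1 := Finset.card_sdiff_add_card_eq_card (Finset.mem_powerset.1 hA)
        have h2 := Finset.card_pos.2 (Finset.nonempty_iff_ne_empty.2 h)
        rw [List.length_cons] at hI
        omega
      rw [ih (fun y hy => hl y (by simp [hy])) _ hc]
      simp

theorem prod_eq_zero_of_length (l : List (Grassmann q)) (hl : ∀ x ∈ l, x ∅ = 0)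
    (h : q < l.length) : l.prod = 0 := by
  ext I
  refine prod_apply_eq_zero l hl I (lt_of_le_of_lt ?_ h)
  simpa using Finset.card_le_univ I

end Grassmann

/-! ### Superfunctions on `ℝ^{p|q} × ℝ^{1|1}` -/

namespace Grassmann

variable {q : ℕ}

theorem iterate_hat_add (k : ℕ) (x y : Grassmann q) :
    hat^[k] (x + y) = hat^[k] x + hat^[k] y := by
  induction k generalizing x y with
  | zero => rfl
  | succ k ih => simp only [Function.iterate_succ, Function.comp_apply, hat_add, ih]

theorem iterate_hat_smul (k : ℕ) (r : ℝ) (x : Grassmann q) :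
    hat^[k] (r • x) = r • hat^[k] x := by
  induction k generalizing x with
  | zero => rfl
  | succ k ih => simp only [Function.iterate_succ, Function.comp_apply, hat_smul, ih]

@[simp] theorem iterate_hat_zero (k : ℕ) : hat^[k] (0 : Grassmann q) = 0 := by
  simpa using iterate_hat_smul k 0 (0 : Grassmann q)

@[simp] theorem iterate_hat_one (k : ℕ) : hat^[k] (1 : Grassmann q) = 1 :=
  Function.iterate_fixed hat_one k

theorem iterate_hat_sum {ι : Type*} (k : ℕ) (s : Finset ι) (f : ι → Grassmann q) :
    hat^[k] (∑ i ∈ s, f i) = ∑ i ∈ s, hat^[k] (f i) :=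
  map_sum (AddMonoidHom.mk' (hat^[k]) (iterate_hat_add k) : Grassmann q →+ Grassmann q) f s

theorem r0_iterate_hat (k : ℕ) (x : Grassmann (q + 1)) : r0 (hat^[k] x) = hat^[k] (r0 x) := by
  induction k generalizing x with
  | zero => rfl
  | succ k ih => simp only [Function.iterate_succ, Function.comp_apply, ih, r0_hat]

theorem iterate_hat_lift (k : ℕ) (x : Grassmann q) : hat^[k] (lift x) = lift (hat^[k] x) := by
  induction k generalizing x with
  | zero => rfl
  | succ k ih => simp only [Function.iterate_succ, Function.comp_apply, hat_lift, ih]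

theorem prod_map_lift (l : List (Grassmann q)) : (l.map lift).prod = lift l.prod :=
  (map_list_prod liftHom l).symm

theorem HasParity.list_prod_zero {l : List (Grassmann q)} (h : ∀ x ∈ l, x.HasParity 0) :
    hat l.prod = l.prod := by
  induction l with
  | nil => simp
  | cons x l ih =>
    rw [List.prod_cons, hat_mul, ih fun y hy => h y (by simp [hy]), (h x (by simp)).hat_eq]
    simp

end Grassmann

section Stabilization

variable {p q : ℕ}

/-- The coordinates of `ℝ^{p|q}` among those of `ℝ^{p|q} × ℝ^{1|1}`, where the new even coordinate
`t = inl 0` and the new odd coordinate `θ = inr 0` come first. -/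
def Idx.emb : Idx p q → Idx (p + 1) (q + 1) := Sum.map Fin.succ Fin.succ

namespace Idx

/-- The family that takes the value `a` at `t`, the value `b` at `θ`, and is `f` on the old
coordinates. -/
def extend {α : Type*} (a b : α) (f : Idx p q → α) : Idx (p + 1) (q + 1) → α
  | .inl i => Fin.cases a (fun i => f (.inl i)) i
  | .inr i => Fin.cases b (fun i => f (.inr i)) i

@[simp] theorem extend_t {α : Type*} (a b : α) (f : Idx p q → α) : extend a b f (.inl 0) = a := rfl

@[simp] theorem extend_theta {α : Type*} (a b : α) (f : Idx p q → α) :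
    extend a b f (.inr 0) = b := rfl

@[simp] theorem extend_emb {α : Type*} (a b : α) (f : Idx p q → α) (i : Idx p q) :
    extend a b f i.emb = f i := by
  cases i <;> rfl

@[simp] theorem par_emb (i : Idx p q) : i.emb.par = i.par := by cases i <;> rfl

theorem emb_injective : Function.Injective (emb : Idx p q → _) :=
  (Fin.succ_injective p).sumMap (Fin.succ_injective q)

@[simp] theorem emb_inj {i j : Idx p q} : i.emb = j.emb ↔ i = j := emb_injective.eq_iff

@[simp] theorem emb_ne_t (i : Idx p q) : i.emb ≠ .inl 0 := by
  cases i <;> simp [emb, Fin.succ_ne_zero]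

@[simp] theorem emb_ne_theta (i : Idx p q) : i.emb ≠ .inr 0 := by
  cases i <;> simp [emb, Fin.succ_ne_zero]

@[simp] theorem t_ne_emb (i : Idx p q) : .inl 0 ≠ i.emb := (emb_ne_t i).symm

@[simp] theorem theta_ne_emb (i : Idx p q) : .inr 0 ≠ i.emb := (emb_ne_theta i).symm

theorem cases_emb {P : Idx (p + 1) (q + 1) → Prop} (ht : P (.inl 0)) (hθ : P (.inr 0))
    (h : ∀ i : Idx p q, P i.emb) (i : Idx (p + 1) (q + 1)) : P i := by
  rcases i with i | a
  · exact Fin.cases ht (fun i => h (.inl i)) i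
  · exact Fin.cases hθ (fun a => h (.inr a)) a

theorem sum_emb {β : Type*} [AddCommMonoid β] (f : Idx (p + 1) (q + 1) → β) :
    ∑ i, f i = f (.inl 0) + f (.inr 0) + ∑ i : Idx p q, f i.emb := by
  rw [Fintype.sum_sum_type, Fin.sum_univ_succ, Fin.sum_univ_succ, Fintype.sum_sum_type]
  exact add_add_add_comm _ _ _ _

theorem notMem_range_emb {i : Idx (p + 1) (q + 1)} (h : i ∉ Set.range (emb : Idx p q → _)) :
    i = .inl 0 ∨ i = .inr 0 := by
  induction i using cases_emb with
  | ht => exact .inl rfl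
  | hθ => exact .inr rfl
  | h i => exact absurd ⟨i, rfl⟩ h

theorem emb_comp_injective (n : ℕ) :
    Function.Injective fun I : Fin n → Idx p q => emb ∘ I :=
  emb_injective.comp_left

theorem exists_notMem_range {n : ℕ} {I : Fin n → Idx (p + 1) (q + 1)}
    (h : I ∉ Set.range fun I : Fin n → Idx p q => emb ∘ I) :
    ∃ s, I s ∉ Set.range (emb : Idx p q → _) := by
  by_contra! h'
  choose J hJ using h'
  exact h ⟨J, funext hJ⟩

end Idx

@[simp] theorem parSum_emb {n : ℕ} (I : Fin n → Idx p q) : parSum (Idx.emb ∘ I) = parSum I := by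
  simp [parSum]

@[simp] theorem parBefore_emb {n : ℕ} (I : Fin n → Idx p q) (s : Fin n) :
    parBefore (Idx.emb ∘ I) s = parBefore I s := by
  simp [parBefore]

/-- The point of `ℝ^{p+1}` with new coordinate `c`. -/
def pt (c : ℝ) (x : Fin p → ℝ) : Fin (p + 1) → ℝ := Fin.cons c x

@[simp] theorem pt_zero (c : ℝ) (x : Fin p → ℝ) : pt c x 0 = c := rfl

@[simp] theorem pt_succ (c : ℝ) (x : Fin p → ℝ) (i : Fin p) : pt c x i.succ = x i := rfl

@[simp] theorem tail_pt (c : ℝ) (x : Fin p → ℝ) : Fin.tail (pt c x) = x := rfl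

theorem pt_tail (y : Fin (p + 1) → ℝ) : pt (y 0) (Fin.tail y) = y := Fin.cons_self_tail y

/-- The inclusion `x ↦ (0, x)`. -/
def ptL : (Fin p → ℝ) →L[ℝ] (Fin (p + 1) → ℝ) :=
  LinearMap.toContinuousLinearMap
    { toFun := pt 0
      map_add' := fun x y => by funext i; refine Fin.cases ?_ (fun i => ?_) i <;> simp
      map_smul' := fun r x => by funext i; refine Fin.cases ?_ (fun i => ?_) i <;> simp }

/-- The projection `(t, x) ↦ x`. -/
def tailL : (Fin (p + 1) → ℝ) →L[ℝ] (Fin p → ℝ) :=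
  LinearMap.toContinuousLinearMap
    { toFun := Fin.tail, map_add' := fun _ _ => rfl, map_smul' := fun _ _ => rfl }

@[simp] theorem tailL_apply (y : Fin (p + 1) → ℝ) : tailL y = Fin.tail y := rfl

theorem pt_eq (c : ℝ) (x : Fin p → ℝ) : pt c x = pt c 0 + ptL x := by
  funext i
  refine Fin.cases ?_ (fun i => ?_) i
  · change c = c + 0
    simp
  · change x i = 0 + x i
    simp

@[simp] theorem ptL_single (i : Fin p) : ptL (Pi.single i (1 : ℝ)) = Pi.single i.succ 1 := by
  funext j
  refine Fin.cases ?_ (fun j => ?_) j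
  · change (0 : ℝ) = _
    rw [Pi.single_eq_of_ne (Fin.succ_ne_zero i).symm]
  · change (Pi.single i 1 : Fin p → ℝ) j = _
    by_cases h : j = i
    · subst h; simp
    · rw [Pi.single_eq_of_ne h, Pi.single_eq_of_ne (fun h' => h (Fin.succ_injective _ h'))]

theorem hasFDerivAt_pt (c : ℝ) (x : Fin p → ℝ) : HasFDerivAt (pt c) (ptL (p := p)) x := by
  have : (pt c : (Fin p → ℝ) → _) = fun x => pt c 0 + ptL x := funext (pt_eq c)
  rw [this]
  exact ptL.hasFDerivAt.const_add _

theorem contDiff_pt (c : ℝ) : ContDiff ℝ ∞ (pt c : (Fin p → ℝ) → _) := by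
  have : (pt c : (Fin p → ℝ) → _) = fun x => pt c 0 + ptL x := funext (pt_eq c)
  rw [this]
  exact contDiff_const.add ptL.contDiff

theorem hasDerivAt_pt (c : ℝ) (x : Fin p → ℝ) :
    HasDerivAt (fun t => pt t x) (Pi.single 0 1 : Fin (p + 1) → ℝ) c := by
  rw [hasDerivAt_pi]
  intro i
  refine Fin.cases ?_ (fun i => ?_) i
  · simpa using hasDerivAt_id' c
  · simpa [Pi.single_eq_of_ne (Fin.succ_ne_zero i)] using hasDerivAt_const c (x i)

/-- Iterated derivatives along a slice `t = c`. -/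
theorem iteratedFDeriv_slice {E : Type*} [NormedAddCommGroup E] [NormedSpace ℝ E]
    {f : (Fin (p + 1) → ℝ) → E} {c : ℝ} {x : Fin p → ℝ} (hf : ContDiffAt ℝ ∞ f (pt c x)) (k : ℕ)
    (v : Fin k → Fin p → ℝ) :
    iteratedFDeriv ℝ k (fun x => f (pt c x)) x v =
      iteratedFDeriv ℝ k f (pt c x) fun s => ptL (v s) := by
  set g : (Fin (p + 1) → ℝ) → E := fun z => f (pt c 0 + z) with hg
  have e : (fun x => f (pt c x)) = g ∘ ptL := by
    funext x
    simp only [hg, Function.comp_apply, ← pt_eq]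
  have hgs : ContDiffAt ℝ k g (ptL x) := by
    have h1 : ContDiffAt ℝ k f (pt c 0 + ptL x) := by
      rw [← pt_eq]
      exact hf.of_le (by exact_mod_cast le_top)
    exact h1.comp (ptL x) (contDiffAt_const.add contDiffAt_id)
  obtain ⟨u, hu, hgu⟩ := hgs.contDiffOn le_rfl (by simp)
  obtain ⟨w, hwu, hw, hxw⟩ := mem_nhds_iff.1 (by simpa using hu)
  have hw' : IsOpen (ptL ⁻¹' w : Set (Fin p → ℝ)) := hw.preimage ptL.continuous
  have := ptL.iteratedFDerivWithin_comp_right (hgu.mono hwu) hw.uniqueDiffOn hw'.uniqueDiffOn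
    hxw (i := k) le_rfl
  rw [iteratedFDerivWithin_of_isOpen k hw' hxw, iteratedFDerivWithin_of_isOpen k hw hxw] at this
  rw [e, this, ContinuousMultilinearMap.compContinuousLinearMap_apply, hg,
    iteratedFDeriv_comp_add_left, ← pt_eq]

namespace SuperFun

theorem tw_apply (k : ℕ) (f : SuperFun p q) (x : Fin p → ℝ) : tw k f x = Grassmann.hat^[k] (f x) :=
  rfl

/-- The pullback of a superfunction along the projection `ℝ^{p|q} × ℝ^{1|1} → ℝ^{p|q}`. -/
def lift (f : SuperFun p q) : SuperFun (p + 1) (q + 1) := fun y => Grassmann.lift (f (Fin.tail y))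

/-- With `f = f₀ + θ f₁`, the restriction of `f₀` to the slice `t = c`. -/
def s0 (c : ℝ) (f : SuperFun (p + 1) (q + 1)) : SuperFun p q := fun x => Grassmann.r0 (f (pt c x))

/-- With `f = f₀ + θ f₁`, the restriction of `f₁` to the slice `t = c`. -/
def s1 (c : ℝ) (f : SuperFun (p + 1) (q + 1)) : SuperFun p q := fun x => Grassmann.r1 (f (pt c x))

@[simp] theorem lift_pt (f : SuperFun p q) (c : ℝ) (x : Fin p → ℝ) :
    lift f (pt c x) = Grassmann.lift (f x) := rfl

@[simp] theorem s0_lift (c : ℝ) (f : SuperFun p q) : s0 c (lift f) = f := by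
  funext x; simp [s0]

@[simp] theorem s1_lift (c : ℝ) (f : SuperFun p q) : s1 c (lift f) = 0 := by
  funext x; simp [s1]

theorem contDiffOn_lift {f : SuperFun p q} {U : Set (Fin p → ℝ)} (hf : ContDiffOn ℝ ∞ f U) :
    ContDiffOn ℝ ∞ (lift f) (Fin.tail ⁻¹' U) :=
  Grassmann.lift.contDiff.comp_contDiffOn (hf.comp tailL.contDiff.contDiffOn fun _ h => h)

theorem contDiffAt_lift {f : SuperFun p q} {c : ℝ} {x : Fin p → ℝ} (hf : ContDiffAt ℝ ∞ f x) :
    ContDiffAt ℝ ∞ (lift f) (pt c x) :=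
  Grassmann.lift.contDiff.contDiffAt.comp _
    (ContDiffAt.comp (g := f) (pt c x) hf tailL.contDiff.contDiffAt)

theorem contDiffOn_s1 {f : SuperFun (p + 1) (q + 1)} {U : Set (Fin p → ℝ)} (c : ℝ)
    (hf : ContDiffOn ℝ ∞ f (Fin.tail ⁻¹' U)) : ContDiffOn ℝ ∞ (s1 c f) U :=
  Grassmann.r1.contDiff.comp_contDiffOn (hf.comp (contDiff_pt c).contDiffOn fun _ h => h)

theorem fderiv_clm_slice {f : SuperFun (p + 1) (q + 1)} {c : ℝ} {x : Fin p → ℝ}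
    (hf : DifferentiableAt ℝ f (pt c x)) (L : Grassmann (q + 1) →L[ℝ] Grassmann q) (i : Fin p) :
    fderiv ℝ (fun x => L (f (pt c x))) x (Pi.single i 1) =
      L (fderiv ℝ f (pt c x) (Pi.single i.succ 1)) := by
  have h := L.hasFDerivAt.comp x (hf.hasFDerivAt.comp x (hasFDerivAt_pt c x))
  have h' := h.fderiv
  change fderiv ℝ (fun x => L (f (pt c x))) x = _ at h'
  rw [h']
  simp

theorem r0_pd_emb {f : SuperFun (p + 1) (q + 1)} {c : ℝ} {x : Fin p → ℝ}
    (hf : DifferentiableAt ℝ f (pt c x)) (i : Idx p q) :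
    Grassmann.r0 (pd i.emb f (pt c x)) = pd i (s0 c f) x := by
  cases i with
  | inl i => exact (fderiv_clm_slice hf Grassmann.r0 i).symm
  | inr a => exact Grassmann.r0_pderiv_succ a _

theorem r1_pd_emb {f : SuperFun (p + 1) (q + 1)} {c : ℝ} {x : Fin p → ℝ}
    (hf : DifferentiableAt ℝ f (pt c x)) (i : Idx p q) :
    Grassmann.r1 (pd i.emb f (pt c x)) = (-1 : ℝ) ^ i.par • pd i (s1 c f) x := by
  cases i with
  | inl i =>
    simp only [Idx.par, pow_zero, one_smul]
    exact (fderiv_clm_slice hf Grassmann.r1 i).symm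
  | inr a =>
    simp only [Idx.par, pow_one, neg_smul, one_smul]
    exact Grassmann.r1_pderiv_succ a _

@[simp] theorem pd_zero (i : Idx p q) : pd i (0 : SuperFun p q) = 0 := by
  funext x
  simpa using pd_smul i 0 (f := (0 : SuperFun p q)) (x := x) contDiffAt_const

theorem pd_emb_lift {f : SuperFun p q} {c : ℝ} {x : Fin p → ℝ} (hf : ContDiffAt ℝ ∞ f x)
    (i : Idx p q) : pd i.emb (lift f) (pt c x) = Grassmann.lift (pd i f x) := by
  have hd := (contDiffAt_lift (c := c) hf).differentiableAt (by simp)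
  refine Grassmann.ext_r ?_ ?_
  · rw [r0_pd_emb hd, s0_lift, Grassmann.r0_lift]
  · rw [r1_pd_emb hd, s1_lift, Grassmann.r1_lift, pd_zero]
    simp

theorem pd_t_lift {f : SuperFun p q} {c : ℝ} {x : Fin p → ℝ} (hf : ContDiffAt ℝ ∞ f x) :
    pd (.inl 0) (lift f) (pt c x) = 0 := by
  have h1 : HasFDerivAt f (fderiv ℝ f x) (tailL (pt c x)) :=
    (hf.differentiableAt (by simp)).hasFDerivAt
  have h := Grassmann.lift.hasFDerivAt.comp (pt c x) (h1.comp (pt c x) tailL.hasFDerivAt)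
  have h' := h.fderiv
  change fderiv ℝ (lift f) (pt c x) = _ at h'
  have : Fin.tail (Pi.single 0 (1 : ℝ) : Fin (p + 1) → ℝ) = 0 := by
    funext i
    simp [Fin.tail, Fin.succ_ne_zero]
  simp only [pd]
  rw [h']
  simp [this]

theorem pd_theta_lift (f : SuperFun p q) (y : Fin (p + 1) → ℝ) :
    pd (.inr 0) (lift f) y = 0 := by
  refine Grassmann.ext_r ?_ ?_ <;> simp [pd, lift]

theorem pd_coord_t (i : Idx (p + 1) (q + 1)) :
    pd i (coord (.inl 0)) = fun _ => if i = .inl 0 then 1 else 0 := by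
  funext y
  rcases i with i | a
  · simp only [pd, coord]
    have h : HasFDerivAt (fun x : Fin (p + 1) → ℝ => x 0 • (1 : Grassmann (q + 1))) _ y :=
      ((ContinuousLinearMap.proj (R := ℝ) (φ := fun _ : Fin (p + 1) => ℝ) 0).hasFDerivAt
        (x := y)).smul_const (1 : Grassmann (q + 1))
    rw [h.fderiv]
    simp [Pi.single_apply, eq_comm]
  · simp only [pd, coord]
    ext K
    simp [Grassmann.pderiv, Grassmann.smul_apply, Grassmann.one_apply, Grassmann.zero_apply]

theorem pd_coord_theta (i : Idx (p + 1) (q + 1)) :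
    pd i (coord (.inr 0)) = fun _ => if i = .inr 0 then 1 else 0 := by
  funext y
  rcases i with i | a
  · simp [pd, coord]
  · simp only [pd, coord]
    refine Fin.cases ?_ (fun a => ?_) a
    · refine Grassmann.ext_r ?_ ?_ <;> simp
    · refine Grassmann.ext_r ?_ ?_
      · simp [Fin.succ_ne_zero]
        exact (Grassmann.pderivL a).map_zero
      · simp [Fin.succ_ne_zero]
        ext K
        simp [Grassmann.pderiv, Grassmann.one_apply, Grassmann.zero_apply]

theorem pd_const_one (i : Idx p q) (r : ℝ) : pd i (fun _ => r • (1 : Grassmann q)) = 0 := by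
  funext x
  cases i with
  | inl i => simp [pd]
  | inr a =>
    ext K
    simp [pd, Grassmann.pderiv, Grassmann.one_apply, Grassmann.smul_apply, Grassmann.zero_apply]

theorem contDiff_coord (i : Idx p q) : ContDiff ℝ ∞ (coord i : SuperFun p q) := by
  cases i with
  | inl i => exact (contDiff_apply ℝ ℝ i).smul contDiff_const
  | inr a => exact contDiff_const

end SuperFun

end Stabilization

section Comp

open SuperFun

variable {p q p' q' : ℕ}

theorem SuperFun.comp_zero (φ : SuperMap p q p' q') (x : Fin p → ℝ) :
    SuperFun.comp (0 : SuperFun p' q') φ x = 0 := by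
  simpa using SuperFun.comp_smul (φ := φ) (x := x) 0 (f := (0 : SuperFun p' q')) contDiffAt_const

theorem SuperFun.comp_one (φ : SuperMap p q p' q') (x : Fin p → ℝ) :
    SuperFun.comp (1 : SuperFun p' q') φ x = 1 := by
  rw [SuperFun.comp, Finset.sum_eq_single 0]
  · rw [Fintype.sum_unique, Finset.sum_eq_single ∅]
    · simp [Grassmann.one_apply]
    · intro I _ hI
      simp [Grassmann.one_apply, hI]
    · simp
  · intro k _ hk
    refine Finset.sum_eq_zero fun j _ => Finset.sum_eq_zero fun I _ => ?_
    change (_ * iteratedFDeriv ℝ k (fun _ => (1 : Grassmann q')) _ _ I) • _ = _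
    rw [iteratedFDeriv_const_of_ne hk]
    simp [Grassmann.zero_apply]
  · simp

/-- The product of a map with the identity of `ℝ^{1|1}`. -/
def SuperMap.stab (φ : SuperMap p q p' q') : SuperMap (p + 1) (q + 1) (p' + 1) (q' + 1) :=
  Idx.extend (coord (.inl 0)) (coord (.inr 0)) fun i => SuperFun.lift (φ i)

namespace SuperMap

@[simp] theorem stab_t (φ : SuperMap p q p' q') : φ.stab (.inl 0) = coord (.inl 0) := rfl

@[simp] theorem stab_theta (φ : SuperMap p q p' q') : φ.stab (.inr 0) = coord (.inr 0) := rfl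

@[simp] theorem stab_emb (φ : SuperMap p q p' q') (i : Idx p' q') :
    φ.stab i.emb = SuperFun.lift (φ i) := by
  cases i <;> rfl

theorem stab_body (φ : SuperMap p q p' q') (c : ℝ) (x : Fin p → ℝ) :
    φ.stab.body (pt c x) = pt c (φ.body x) := by
  funext i
  refine Fin.cases ?_ (fun i => ?_) i
  · change (c • (1 : Grassmann (q + 1))) ∅ = c
    simp [Grassmann.smul_apply, Grassmann.one_apply]
  · change Grassmann.lift (φ (.inl i) x) ∅ = φ (.inl i) x ∅
    simp [Grassmann.lift_apply, Grassmann.down]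

theorem nil_apply_empty (φ : SuperMap p q p' q') (i : Fin p') (x : Fin p → ℝ) :
    φ.nil i x ∅ = 0 := by
  simp [nil, body, Grassmann.sub_apply, Grassmann.smul_apply, Grassmann.one_apply]

theorem stab_nil_zero (φ : SuperMap p q p' q') (c : ℝ) (x : Fin p → ℝ) :
    φ.stab.nil 0 (pt c x) = 0 := by
  rw [nil, stab_body]
  simp [coord]

theorem stab_nil_succ (φ : SuperMap p q p' q') (i : Fin p') (c : ℝ) (x : Fin p → ℝ) :
    φ.stab.nil i.succ (pt c x) = Grassmann.lift (φ.nil i x) := by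
  rw [nil, stab_body]
  simp only [nil, pt_succ, map_sub, map_smul, Grassmann.lift_one]
  rfl

theorem nil_hasParity (φ : SuperMap p q p' q') {x : Fin p → ℝ}
    (h : ∀ i, (φ (.inl i) x).HasParity 0) (i : Fin p') : (φ.nil i x).HasParity 0 := by
  intro I hI
  rw [nil, Grassmann.sub_apply, h i I hI, Grassmann.smul_apply,
    Grassmann.hasParity_one I hI]
  simp

end SuperMap

/-- The term of order `k` of the Taylor expansion that defines `SuperFun.comp`. -/
def SuperFun.taylorTerm (f : SuperFun p' q') (φ : SuperMap p q p' q') (x : Fin p → ℝ) (k : ℕ) :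
    Grassmann q :=
  ∑ j : Fin k → Fin p', ∑ I : Finset (Fin q'),
    ((k.factorial : ℝ)⁻¹ * iteratedFDeriv ℝ k f (φ.body x) (fun s => Pi.single (j s) 1) I) •
      ((List.ofFn fun s => φ.nil (j s) x).prod * ((I.sort (· ≤ ·)).map fun a => φ (.inr a) x).prod)

theorem SuperFun.comp_eq_sum_taylorTerm (f : SuperFun p' q') (φ : SuperMap p q p' q')
    (x : Fin p → ℝ) :
    SuperFun.comp f φ x = ∑ k ∈ Finset.range (q + 1), SuperFun.taylorTerm f φ x k := rfl

/-- The term vanishes because a product of more than `q` nilpotent elements does. So it does not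
matter that the expansion for `φ.stab` has one term more than that for `φ`. -/
theorem SuperFun.taylorTerm_eq_zero (f : SuperFun p' q') (φ : SuperMap p q p' q')
    (x : Fin p → ℝ) {k : ℕ} (hk : q < k) : SuperFun.taylorTerm f φ x k = 0 := by
  refine Finset.sum_eq_zero fun j _ => Finset.sum_eq_zero fun I _ => ?_
  rw [Grassmann.prod_eq_zero_of_length, zero_mul, smul_zero]
  · simp only [List.mem_ofFn]
    rintro _ ⟨s, rfl⟩
    exact φ.nil_apply_empty _ _
  · simpa using hk

theorem List.prod_ofFn_eq_zero {R : Type*} [MonoidWithZero R] {k : ℕ} (f : Fin k → R) (s : Fin k)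
    (h : f s = 0) : (List.ofFn f).prod = 0 :=
  List.prod_eq_zero (by rw [List.mem_ofFn]; exact ⟨s, h⟩)

theorem SuperFun.iteratedFDeriv_clm_slice {f : SuperFun (p + 1) (q + 1)} {c : ℝ} {x : Fin p → ℝ}
    (hf : ContDiffAt ℝ ∞ f (pt c x)) (L : Grassmann (q + 1) →L[ℝ] Grassmann q) (k : ℕ)
    (j : Fin k → Fin p) :
    iteratedFDeriv ℝ k (fun x => L (f (pt c x))) x (fun s => Pi.single (j s) 1) =
      L (iteratedFDeriv ℝ k f (pt c x) fun s => Pi.single (j s).succ 1) := by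
  have hLf : ContDiffAt ℝ ∞ (L ∘ f) (pt c x) := L.contDiff.contDiffAt.comp _ hf
  have h1 := iteratedFDeriv_slice hLf k fun s => Pi.single (j s) 1
  simp only [ptL_single] at h1
  refine h1.trans ?_
  rw [L.iteratedFDeriv_comp_left hf (i := k) (by exact_mod_cast le_top)]
  rfl

/-- The map `φ.stab` preserves `t` and `θ`, so that in the Taylor expansion only the directions of
the old even coordinates matter, and a factor `θ` of `f` stays behind the nilpotent parts of the
even components of `φ`. -/
theorem SuperFun.taylorTerm_stab {f : SuperFun (p' + 1) (q' + 1)} {φ : SuperMap p q p' q'} {c : ℝ}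
    {x : Fin p → ℝ} (hf : ContDiffAt ℝ ∞ f (pt c (φ.body x))) (k : ℕ) :
    SuperFun.taylorTerm f φ.stab (pt c x) k =
      Grassmann.lift (SuperFun.taylorTerm (s0 c f) φ x k) +
      ∑ j : Fin k → Fin p', ∑ I : Finset (Fin q'),
    ((k.factorial : ℝ)⁻¹ * iteratedFDeriv ℝ k (s1 c f) (φ.body x) (fun s => Pi.single (j s) 1) I) •
      (Grassmann.lift (List.ofFn fun s => φ.nil (j s) x).prod * (Grassmann.gen 0 *
        Grassmann.lift ((I.sort (· ≤ ·)).map fun a => φ (.inr a) x).prod)) := by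
  have hj (j : Fin k → Fin p') : (List.ofFn fun s => φ.stab.nil (j s).succ (pt c x)).prod =
      Grassmann.lift (List.ofFn fun s => φ.nil (j s) x).prod := by
    rw [← Grassmann.prod_map_lift, List.map_ofFn]
    simp only [SuperMap.stab_nil_succ]
    rfl
  have hI (I : Finset (Fin q')) :
      (((Grassmann.up I).sort (· ≤ ·)).map fun a => φ.stab (.inr a) (pt c x)).prod =
        Grassmann.lift ((I.sort (· ≤ ·)).map fun a => φ (.inr a) x).prod := by
    rw [← Grassmann.prod_map_lift, Grassmann.up,
      ← Finset.map_sort (Fin.succEmb q') I (· ≤ ·) (· ≤ ·) (by simp), List.map_map, List.map_map]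
    rfl
  have hI' (I : Finset (Fin q')) :
      (((insert 0 (Grassmann.up I)).sort (· ≤ ·)).map fun a => φ.stab (.inr a) (pt c x)).prod =
        Grassmann.gen 0 * Grassmann.lift ((I.sort (· ≤ ·)).map fun a => φ (.inr a) x).prod := by
    rw [Finset.sort_insert _ (fun b _ => Fin.zero_le b) (Grassmann.zero_notMem_up I),
      List.map_cons, List.prod_cons, hI]
    rfl
  have hs : Function.Injective fun j : Fin k → Fin p' => Fin.succ ∘ j :=
    (Fin.succ_injective p').comp_left
  rw [SuperFun.taylorTerm, ← Fintype.sum_of_injective _ hs _ _ ?_ fun j => rfl]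
  · rw [SuperFun.taylorTerm, map_sum, ← Finset.sum_add_distrib]
    refine Finset.sum_congr rfl fun j _ => ?_
    rw [Grassmann.sum_finset_succ, map_sum]
    simp only [Function.comp_apply, hj, hI, hI', SuperMap.stab_body, map_smul, Grassmann.lift_mul]
    congr 1 <;> refine Finset.sum_congr rfl fun I _ => ?_
    · congr 2
      exact (congrFun (SuperFun.iteratedFDeriv_clm_slice hf Grassmann.r0 k j) I).symm
    · congr 2
      exact (congrFun (SuperFun.iteratedFDeriv_clm_slice hf Grassmann.r1 k j) I).symm
  · intro j hj
    have : ∃ s, j s = 0 := by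
      by_contra! h
      exact hj ⟨fun s => (j s).pred (h s), funext fun s => by simp⟩
    obtain ⟨s, hs⟩ := this
    refine Finset.sum_eq_zero fun I _ => ?_
    rw [List.prod_ofFn_eq_zero _ s (by rw [hs, SuperMap.stab_nil_zero]), zero_mul, smul_zero]

theorem SuperFun.r0_comp_stab {f : SuperFun (p' + 1) (q' + 1)} {φ : SuperMap p q p' q'} {c : ℝ}
    {x : Fin p → ℝ} (hf : ContDiffAt ℝ ∞ f (pt c (φ.body x))) :
    Grassmann.r0 (SuperFun.comp f φ.stab (pt c x)) = SuperFun.comp (s0 c f) φ x := by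
  rw [SuperFun.comp_eq_sum_taylorTerm, SuperFun.comp_eq_sum_taylorTerm, map_sum,
    Finset.sum_range_succ _ (q + 1)]
  have h (k : ℕ) : Grassmann.r0 (SuperFun.taylorTerm f φ.stab (pt c x) k) =
      SuperFun.taylorTerm (s0 c f) φ x k := by
    rw [SuperFun.taylorTerm_stab hf]
    simp
  simp only [h]
  rw [SuperFun.taylorTerm_eq_zero _ _ _ (Nat.lt_succ_self q), add_zero]

/-- Pullback by `φ.stab` commutes with taking the coefficient of `θ`: the components `φ^i` that `θ`
moves past are even. -/
theorem SuperFun.r1_comp_stab {f : SuperFun (p' + 1) (q' + 1)} {φ : SuperMap p q p' q'} {c : ℝ}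
    {x : Fin p → ℝ} (hφ : ∀ i, (φ (.inl i) x).HasParity 0)
    (hf : ContDiffAt ℝ ∞ f (pt c (φ.body x))) :
    Grassmann.r1 (SuperFun.comp f φ.stab (pt c x)) = SuperFun.comp (s1 c f) φ x := by
  rw [SuperFun.comp_eq_sum_taylorTerm, SuperFun.comp_eq_sum_taylorTerm, map_sum,
    Finset.sum_range_succ _ (q + 1)]
  have h (k : ℕ) : Grassmann.r1 (SuperFun.taylorTerm f φ.stab (pt c x) k) =
      SuperFun.taylorTerm (s1 c f) φ x k := by
    rw [SuperFun.taylorTerm_stab hf, SuperFun.taylorTerm]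
    have hp (j : Fin k → Fin p') : Grassmann.hat (List.ofFn fun s => φ.nil (j s) x).prod =
        (List.ofFn fun s => φ.nil (j s) x).prod := by
      refine Grassmann.HasParity.list_prod_zero ?_
      simp only [List.mem_ofFn]
      rintro _ ⟨s, rfl⟩
      exact φ.nil_hasParity hφ _
    simp [hp]
    rfl
  simp only [h]
  rw [SuperFun.taylorTerm_eq_zero _ _ _ (Nat.lt_succ_self q), add_zero]

/-- The pullback of `lift f` by `φ.stab` is `lift (f ∘ φ)`. -/
theorem SuperFun.comp_lift_stab {f : SuperFun p' q'} {φ : SuperMap p q p' q'} {c : ℝ}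
    {x : Fin p → ℝ} (hφ : ∀ i, (φ (.inl i) x).HasParity 0) (hf : ContDiffAt ℝ ∞ f (φ.body x)) :
    SuperFun.comp (SuperFun.lift f) φ.stab (pt c x) = Grassmann.lift (SuperFun.comp f φ x) := by
  have h := SuperFun.contDiffAt_lift (c := c) hf
  refine Grassmann.ext_r ?_ ?_
  · rw [SuperFun.r0_comp_stab h, s0_lift, Grassmann.r0_lift]
  · rw [SuperFun.r1_comp_stab hφ h, s1_lift, Grassmann.r1_lift, SuperFun.comp_zero]

theorem SuperFun.comp_coord_t_stab {φ : SuperMap p q p' q'} {c : ℝ} {x : Fin p → ℝ}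
    (hφ : ∀ i, (φ (.inl i) x).HasParity 0) :
    SuperFun.comp (coord (.inl 0)) φ.stab (pt c x) = coord (.inl 0) (pt c x) := by
  have h := (contDiff_coord (.inl 0 : Idx (p' + 1) (q' + 1))).contDiffAt (x := pt c (φ.body x))
  have e0 : s0 c (coord (.inl 0)) = c • (1 : SuperFun p' q') := by
    funext x; simp [s0, coord]
  have e1 : s1 c (coord (.inl 0)) = (0 : SuperFun p' q') := by
    funext x; simp [s1, coord]
  refine Grassmann.ext_r ?_ ?_
  · rw [SuperFun.r0_comp_stab h, e0,
      SuperFun.comp_smul c (f := (1 : SuperFun p' q')) contDiffAt_const, SuperFun.comp_one]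
    simp [coord]
  · rw [SuperFun.r1_comp_stab hφ h, e1, SuperFun.comp_zero]
    simp [coord]

theorem SuperFun.comp_coord_theta_stab {φ : SuperMap p q p' q'} {c : ℝ} {x : Fin p → ℝ}
    (hφ : ∀ i, (φ (.inl i) x).HasParity 0) :
    SuperFun.comp (coord (.inr 0)) φ.stab (pt c x) = coord (.inr 0) (pt c x) := by
  have h := (contDiff_coord (.inr 0 : Idx (p' + 1) (q' + 1))).contDiffAt (x := pt c (φ.body x))
  have e0 : s0 c (coord (.inr 0)) = (0 : SuperFun p' q') := by
    funext x; simp [s0, coord]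
  have e1 : s1 c (coord (.inr 0)) = (1 : SuperFun p' q') := by
    funext x; simp [s1, coord]
  refine Grassmann.ext_r ?_ ?_
  · rw [SuperFun.r0_comp_stab h, e0, SuperFun.comp_zero]
    simp [coord]
  · rw [SuperFun.r1_comp_stab hφ h, e1, SuperFun.comp_one]
    simp [coord]

end Comp

/-! ### Contractions over the extra coordinates -/

namespace Grassmann

variable {q : ℕ}

theorem iterate_hat_congr {k l : ℕ} (h : k % 2 = l % 2) (x : Grassmann q) :
    hat^[k] x = hat^[l] x := by
  have key (k : ℕ) : hat^[k] x = hat^[k % 2] x := by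
    conv_lhs => rw [← Nat.mod_add_div k 2, Function.iterate_add_apply, Function.iterate_mul]
    rw [Function.iterate_fixed (show hat^[2] x = x from hat_hat x)]
  rw [key k, key l, h]

theorem iterate_hat_zsmul (k : ℕ) (r : ℤ) (x : Grassmann q) :
    hat^[k] (r • x) = r • hat^[k] x :=
  map_zsmul (AddMonoidHom.mk' (hat^[k]) (iterate_hat_add k) : Grassmann q →+ Grassmann q) r x

end Grassmann

theorem neg_one_pow_congr_mod {k l : ℕ} (h : k % 2 = l % 2) : (-1 : ℤ) ^ k = (-1) ^ l := by
  rw [neg_one_pow_eq_pow_mod_two, h, ← neg_one_pow_eq_pow_mod_two]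

theorem neg_one_pow_mul_eq_zsmul {R : Type*} [Ring R] (k : ℕ) (x : R) :
    (-1) ^ k * x = (-1 : ℤ) ^ k • x := by
  rcases neg_one_pow_eq_or ℤ k with h | h
  · have : Even k := (neg_one_pow_eq_one_iff_even (by norm_num)).1 h
    simp [this.neg_one_pow]
  · have : Odd k := (neg_one_pow_eq_neg_one_iff_odd (by norm_num)).1 h
    simp [this.neg_one_pow]

section Tuples

variable {p q n m : ℕ}

theorem parSum_update (I : Fin n → Idx p q) (s : Fin n) (i : Idx p q) :
    parSum (Function.update I s i) + (I s).par = parSum I + i.par := by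
  unfold parSum
  rw [← Finset.add_sum_erase _ _ (Finset.mem_univ s),
    ← Finset.add_sum_erase Finset.univ (fun r => (I r).par) (Finset.mem_univ s)]
  rw [Finset.sum_congr rfl fun r hr => by
    rw [Function.update_of_ne (Finset.ne_of_mem_erase hr)], Function.update_self]
  ring

theorem parSum_castAdd_natAdd (I : Fin (n + m) → Idx p q) :
    parSum I = parSum (fun s => I (Fin.castAdd m s)) + parSum (fun s => I (Fin.natAdd n s)) :=
  Fin.sum_univ_add _

theorem parBefore_castAdd (I : Fin (n + m) → Idx p q) (s : Fin n) :
    parBefore I (Fin.castAdd m s) = parBefore (fun s => I (Fin.castAdd m s)) s := by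
  unfold parBefore
  rw [Finset.sum_filter, Finset.sum_filter, Fin.sum_univ_add, add_eq_left.2]
  · rfl
  · refine Finset.sum_eq_zero fun r _ => if_neg ?_
    simp only [Fin.lt_def, Fin.val_castAdd, Fin.val_natAdd]
    omega

theorem parBefore_natAdd (I : Fin (n + m) → Idx p q) (s : Fin m) :
    parBefore I (Fin.natAdd n s) =
      parSum (fun s => I (Fin.castAdd m s)) + parBefore (fun s => I (Fin.natAdd n s)) s := by
  unfold parBefore parSum
  rw [Finset.sum_filter, Finset.sum_filter, Fin.sum_univ_add]
  congr 1
  · refine Finset.sum_congr rfl fun r _ => if_pos ?_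
    simp only [Fin.lt_def, Fin.val_castAdd, Fin.val_natAdd]
    omega
  · refine Finset.sum_congr rfl fun r _ => if_congr ?_ rfl rfl
    simp only [Fin.lt_def, Fin.val_natAdd]
    omega

theorem update_castAdd_castAdd {α : Type*} (I : Fin (n + m) → α) (s : Fin n) (i : α) :
    (fun r => Function.update I (Fin.castAdd m s) i (Fin.castAdd m r)) =
      Function.update (fun r => I (Fin.castAdd m r)) s i := by
  funext r
  by_cases h : r = s
  · subst h; simp
  · rw [Function.update_of_ne h, Function.update_of_ne (by simpa using h)]

theorem update_castAdd_natAdd {α : Type*} (I : Fin (n + m) → α) (s : Fin n) (i : α) :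
    (fun r => Function.update I (Fin.castAdd m s) i (Fin.natAdd n r)) =
      fun r => I (Fin.natAdd n r) := by
  funext r
  rw [Function.update_of_ne]
  simp only [ne_eq, Fin.ext_iff, Fin.val_castAdd, Fin.val_natAdd]
  omega

theorem update_natAdd_natAdd {α : Type*} (I : Fin (n + m) → α) (s : Fin m) (i : α) :
    (fun r => Function.update I (Fin.natAdd n s) i (Fin.natAdd n r)) =
      Function.update (fun r => I (Fin.natAdd n r)) s i := by
  funext r
  by_cases h : r = s
  · subst h; simp
  · rw [Function.update_of_ne h, Function.update_of_ne (by simpa using h)]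

theorem update_natAdd_castAdd {α : Type*} (I : Fin (n + m) → α) (s : Fin m) (i : α) :
    (fun r => Function.update I (Fin.natAdd n s) i (Fin.castAdd m r)) =
      fun r => I (Fin.castAdd m r) := by
  funext r
  rw [Function.update_of_ne]
  simp only [ne_eq, Fin.ext_iff, Fin.val_castAdd, Fin.val_natAdd]
  omega

theorem update_comp_perm {α : Type*} (σ : Equiv.Perm (Fin n)) (I : Fin n → α) (s : Fin n) (i : α) :
    Function.update I (σ s) i ∘ σ = Function.update (I ∘ σ) s i := by
  funext r
  by_cases h : r = s
  · subst h; simp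
  · rw [Function.update_of_ne h, Function.comp_apply,
      Function.update_of_ne (fun h' => h (σ.injective h'))]
    rfl

theorem parSum_comp_perm (σ : Equiv.Perm (Fin n)) (I : Fin n → Idx p q) :
    parSum (I ∘ σ) = parSum I :=
  Equiv.sum_comp σ fun r => (I r).par

theorem neg_one_pow_parBefore (I : Fin n → Idx p q) (s : Fin n) :
    (-1 : ℤ) ^ parBefore I s = ∏ r, if r < s then (-1) ^ (I r).par else 1 := by
  rw [parBefore, ← Finset.prod_pow_eq_pow_sum, Finset.prod_filter]

/-- A change of the parity of one factor changes the Koszul sign of a permutation by the sign of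
moving an odd element from the front to that factor, before and after the permutation. -/
theorem koszulSign_update (σ : Equiv.Perm (Fin n)) (I : Fin n → Idx p q) (s : Fin n) {i : Idx p q}
    (h : i.par + (I (σ s)).par = 1) :
    koszulSign σ (Function.update I (σ s) i) =
      koszulSign σ I * ((-1) ^ parBefore I (σ s) * (-1) ^ parBefore (I ∘ σ) s) := by
  have e1 : (-1 : ℤ) ^ parBefore I (σ s) =
      ∏ b, if σ b < σ s then (-1) ^ (I (σ b)).par else 1 := by
    rw [neg_one_pow_parBefore]
    exact (Equiv.prod_comp σ fun r => if r < σ s then (-1 : ℤ) ^ (I r).par else 1).symm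
  have e2 := neg_one_pow_parBefore (I ∘ σ) s
  have hsign (k : ℕ) : (-1 : ℤ) ^ (i.par * k) = (-1) ^ ((I (σ s)).par * k) * (-1) ^ k := by
    rw [← pow_add]
    apply neg_one_pow_congr_mod
    have : i.par = 0 ∧ (I (σ s)).par = 1 ∨ i.par = 1 ∧ (I (σ s)).par = 0 := by omega
    rcases this with ⟨h1, h2⟩ | ⟨h1, h2⟩ <;> rw [h1, h2] <;> omega
  have hu (b : Fin n) (hb : b ≠ s) : Function.update I (σ s) i (σ b) = I (σ b) :=
    Function.update_of_ne (fun h' => hb (σ.injective h')) _ _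
  have hstep : koszulSign σ (Function.update I (σ s) i) = koszulSign σ I *
      ∏ z : Fin n × Fin n, if z.1 < z.2 ∧ σ z.2 < σ z.1 then
        (if z.1 = s then (-1) ^ (I (σ z.2)).par else 1) *
        (if z.2 = s then (-1) ^ (I (σ z.1)).par else 1) else 1 := by
    unfold koszulSign
    rw [Finset.prod_filter, Finset.prod_filter, ← Finset.prod_mul_distrib]
    refine Finset.prod_congr rfl ?_
    rintro ⟨a, b⟩ -
    by_cases hz : a < b ∧ σ b < σ a
    · simp only [if_pos hz]
      by_cases ha : a = s
      · subst ha
        have hb : b ≠ a := hz.1.ne'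
        rw [hu b hb, Function.update_self, if_pos rfl, if_neg hb, mul_one, hsign]
      · by_cases hb : b = s
        · subst hb
          rw [hu a ha, Function.update_self, if_pos rfl, if_neg ha, one_mul, mul_comm, hsign,
            mul_comm (I (σ a)).par]
        · rw [hu a ha, hu b hb, if_neg ha, if_neg hb, mul_one, mul_one]
    · simp only [if_neg hz, mul_one]
  rw [hstep, e1, e2]
  congr 1
  have split (a b : Fin n) : (if a < b ∧ σ b < σ a then
        (if a = s then (-1 : ℤ) ^ (I (σ b)).par else 1) *
        (if b = s then (-1) ^ (I (σ a)).par else 1) else 1) =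
      (if a = s then (if s < b ∧ σ b < σ s then (-1 : ℤ) ^ (I (σ b)).par else 1) else 1) *
      (if b = s then (if a < s ∧ σ s < σ a then (-1) ^ (I (σ a)).par else 1) else 1) := by
    by_cases ha : a = s
    · subst ha
      by_cases hb : b = a
      · subst hb; simp
      · simp [hb]
    · by_cases hb : b = s
      · subst hb; simp [ha]
      · simp [ha, hb]
  rw [Fintype.prod_prod_type]
  simp only [split, Finset.prod_mul_distrib]
  rw [Finset.prod_comm]
  simp only [Finset.prod_ite_eq', Finset.mem_univ, if_true, ← Finset.prod_mul_distrib]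
  refine Finset.prod_congr rfl fun b _ => ?_
  have hsq : (-1 : ℤ) ^ (I (σ b)).par * (-1) ^ (I (σ b)).par = 1 := by
    rw [← mul_pow]; simp
  by_cases hb : b = s
  · subst hb; simp
  have hσ : σ b ≠ σ s := fun h' => hb (σ.injective h')
  rcases lt_or_gt_of_ne hb with h1 | h1 <;> rcases lt_or_gt_of_ne hσ with h2 | h2 <;>
    simp [h1, h2, h1.not_gt, h2.not_gt, hsq]

end Tuples

/-- Arrays of tensor components at one point, with values in a Grassmann algebra. -/
abbrev PtArr (p q n m r : ℕ) : Type := (Fin n → Idx p q) → (Fin m → Idx p q) → Grassmann r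

namespace PtArr

variable {p q n m n' m' r : ℕ}

/-- The tensor product, with the sign conventions of `UnivExpr.eval`. -/
def mul (S : PtArr p q n m r) (T : PtArr p q n' m' r) : PtArr p q (n + n') (m + m') r := fun I J =>
  (-1 : ℤ) ^ (parSum (fun s => J (Fin.castAdd m' s)) * parSum (fun s => I (Fin.natAdd n s))) •
    (S (fun s => I (Fin.castAdd n' s)) (fun s => J (Fin.castAdd m' s)) *
      Grassmann.hat^[parSum (fun s => I (Fin.castAdd n' s)) + parSum (fun s => J (Fin.castAdd m' s))]
        (T (fun s => I (Fin.natAdd n s)) (fun s => J (Fin.natAdd m s))))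

/-- The permutation of slots, with the sign conventions of `UnivExpr.eval`. -/
def perm (σ : Equiv.Perm (Fin n)) (τ : Equiv.Perm (Fin m)) (T : PtArr p q n m r) :
    PtArr p q n m r := fun I J =>
  (koszulSign σ I * koszulSign τ J) • T (I ∘ σ) (J ∘ τ)

/-- The contraction of the last contravariant with the first covariant slot. -/
def contr (T : PtArr p q (n + 1) (m + 1) r) : PtArr p q n m r := fun I J =>
  ∑ a, T (Fin.snoc I a) (Fin.cons a J)

/-- The Kronecker symbol. -/
def delta : PtArr p q 1 1 r := fun I J => if I 0 = J 0 then (-1) ^ (I 0).par else 0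

end PtArr

/-- The number of occurrences of the extra coordinates `t` and `θ` in a tuple. -/
def extraCount {p q n : ℕ} (I : Fin n → Idx (p + 1) (q + 1)) : ℕ :=
  ∑ s, Idx.extend 1 1 (fun _ : Idx p q => 0) (I s)

section ExtraCount

variable {p q n m : ℕ}

@[simp] theorem extraCount_emb (I : Fin n → Idx p q) : extraCount (Idx.emb ∘ I) = 0 := by
  simp [extraCount]

theorem extraCount_castAdd_natAdd (I : Fin (n + m) → Idx (p + 1) (q + 1)) :
    extraCount I = extraCount (fun s => I (Fin.castAdd m s)) +
      extraCount (fun s => I (Fin.natAdd n s)) :=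
  Fin.sum_univ_add _

theorem extraCount_comp_perm (σ : Equiv.Perm (Fin n)) (I : Fin n → Idx (p + 1) (q + 1)) :
    extraCount (I ∘ σ) = extraCount I :=
  Equiv.sum_comp σ fun r => Idx.extend 1 1 (fun _ : Idx p q => 0) (I r)

theorem extraCount_snoc (I : Fin n → Idx (p + 1) (q + 1)) (a : Idx (p + 1) (q + 1)) :
    extraCount (Fin.snoc I a : Fin (n + 1) → Idx (p + 1) (q + 1)) =
      extraCount I + Idx.extend 1 1 (fun _ : Idx p q => 0) a := by
  simp [extraCount, Fin.sum_univ_castSucc]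

theorem extraCount_cons (I : Fin n → Idx (p + 1) (q + 1)) (a : Idx (p + 1) (q + 1)) :
    extraCount (Fin.cons a I : Fin (n + 1) → Idx (p + 1) (q + 1)) =
      Idx.extend 1 1 (fun _ : Idx p q => 0) a + extraCount I := by
  simp [extraCount, Fin.sum_univ_succ]

theorem exists_emb_of_extraCount_eq_zero {I : Fin n → Idx (p + 1) (q + 1)}
    (h : extraCount I = 0) : ∃ I' : Fin n → Idx p q, I = Idx.emb ∘ I' := by
  have h' := (Finset.sum_eq_zero_iff.1 h)
  have (s : Fin n) : ∃ i : Idx p q, I s = i.emb := by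
    have := h' s (Finset.mem_univ s)
    revert this
    induction I s using Idx.cases_emb with
    | ht => simp
    | hθ => simp
    | h i => exact fun _ => ⟨i, rfl⟩
  choose I' hI' using this
  exact ⟨I', funext hI'⟩

end ExtraCount

namespace PtArr

variable {p q n m n' m' r : ℕ}

/-- The action on tensor components of the odd linear vector field `θ ∂_t`, which maps `∂_θ` to a
multiple of `∂_t` and `dt` to a multiple of `dθ`. -/
def rot (T : PtArr (p + 1) (q + 1) n m r) : PtArr (p + 1) (q + 1) n m r := fun I J =>
  (∑ s, if I s = .inl 0 then (-1 : ℤ) ^ parBefore I s • T (Function.update I s (.inr 0)) J else 0) +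
  ∑ s, if J s = .inr 0 then
    (-1 : ℤ) ^ (parSum I + parBefore J s) • T I (Function.update J s (.inl 0)) else 0

/-- The components with more extra indices above than below vanish, and those with at least as many
extra indices above as below are invariant under `θ ∂_t`. -/
structure Balanced (T : PtArr (p + 1) (q + 1) n m r) : Prop where
  vanish : ∀ I J, extraCount J < extraCount I → T I J = 0
  rot_eq_zero : ∀ I J, extraCount J ≤ extraCount I → T.rot I J = 0

theorem rot_add (S T : PtArr (p + 1) (q + 1) n m r) : (S + T).rot = S.rot + T.rot := by
  funext I J
  simp only [rot, Pi.add_apply, smul_add]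
  rw [add_add_add_comm, ← Finset.sum_add_distrib, ← Finset.sum_add_distrib]
  congr 1 <;> refine Finset.sum_congr rfl fun s _ => ?_ <;> split_ifs <;> simp

theorem rot_smul (c : ℝ) (T : PtArr (p + 1) (q + 1) n m r) : (c • T).rot = c • T.rot := by
  funext I J
  simp only [rot, Pi.smul_apply, smul_add, Finset.smul_sum]
  congr 1 <;> refine Finset.sum_congr rfl fun s _ => ?_ <;> split_ifs <;> simp [smul_comm]

theorem Balanced.add {S T : PtArr (p + 1) (q + 1) n m r} (hS : S.Balanced) (hT : T.Balanced) :
    (S + T).Balanced where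
  vanish I J h := by rw [Pi.add_apply, Pi.add_apply, hS.vanish I J h, hT.vanish I J h, add_zero]
  rot_eq_zero I J h := by
    rw [rot_add, Pi.add_apply, Pi.add_apply, hS.rot_eq_zero I J h, hT.rot_eq_zero I J h, add_zero]

theorem Balanced.smul (c : ℝ) {T : PtArr (p + 1) (q + 1) n m r} (hT : T.Balanced) :
    (c • T).Balanced where
  vanish I J h := by rw [Pi.smul_apply, Pi.smul_apply, hT.vanish I J h, smul_zero]
  rot_eq_zero I J h := by
    rw [rot_smul, Pi.smul_apply, Pi.smul_apply, hT.rot_eq_zero I J h, smul_zero]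

theorem balanced_one : Balanced (fun _ _ => 1 : PtArr (p + 1) (q + 1) 0 0 r) where
  vanish I J h := by simp [extraCount] at h
  rot_eq_zero I J _ := by simp [rot]

theorem balanced_delta : (delta : PtArr (p + 1) (q + 1) 1 1 r).Balanced where
  vanish I J h := by
    have : I 0 ≠ J 0 := by
      intro e
      have : I = J := by funext s; rw [Fin.fin_one_eq_zero s, e]
      rw [this] at h
      exact lt_irrefl _ h
    simp [delta, this]
  rot_eq_zero I J _ := by
    by_cases hI : I 0 = .inl 0 <;> by_cases hJ : J 0 = .inr 0
    · simp [rot, delta, hI, hJ, parBefore, parSum, Idx.par]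
    · simp [rot, delta, hI, hJ, parBefore, parSum, Idx.par, Ne.symm hJ]
    · simp [rot, delta, hI, hJ, parBefore, parSum, Idx.par]
    · simp [rot, hI, hJ]

/-- `rot` is an odd derivation of the tensor product. -/
theorem rot_mul (S : PtArr (p + 1) (q + 1) n m r) (T : PtArr (p + 1) (q + 1) n' m' r)
    (I₁ : Fin n → Idx (p + 1) (q + 1)) (I₂ : Fin n' → Idx (p + 1) (q + 1))
    (J₁ : Fin m → Idx (p + 1) (q + 1)) (J₂ : Fin m' → Idx (p + 1) (q + 1)) :
    (S.mul T).rot (Fin.append I₁ I₂) (Fin.append J₁ J₂) =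
      (-1 : ℤ) ^ (parSum J₁ * parSum I₂) •
        (S.rot I₁ J₁ * Grassmann.hat^[parSum I₁ + parSum J₁ + 1] (T I₂ J₂)) +
      (-1 : ℤ) ^ (parSum J₁ * parSum I₂ + (parSum I₁ + parSum J₁)) •
        (S I₁ J₁ * Grassmann.hat^[parSum I₁ + parSum J₁] (T.rot I₂ J₂)) := by
  have par_t {k : ℕ} (I : Fin k → Idx (p + 1) (q + 1)) (s : Fin k) (h : I s = .inl 0) :
      parSum (Function.update I s (.inr 0)) = parSum I + 1 := by
    have := parSum_update I s (.inr 0)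
    rw [h] at this
    exact this
  have par_theta {k : ℕ} (I : Fin k → Idx (p + 1) (q + 1)) (s : Fin k) (h : I s = .inr 0) :
      parSum I = parSum (Function.update I s (.inl 0)) + 1 := by
    have := parSum_update I s (.inl 0)
    rw [h] at this
    exact this.symm
  simp only [rot, mul, Fin.sum_univ_add, update_castAdd_castAdd, update_castAdd_natAdd,
    update_natAdd_natAdd, update_natAdd_castAdd, parBefore_castAdd, parBefore_natAdd,
    parSum_castAdd_natAdd (Fin.append I₁ I₂), Fin.append_left, Fin.append_right]
  rw [Grassmann.iterate_hat_add, add_mul, mul_add, smul_add, smul_add, add_add_add_comm]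
  simp only [Grassmann.iterate_hat_sum, Finset.sum_mul, Finset.mul_sum, Finset.smul_sum]
  congr 1 <;> congr 1 <;> refine Finset.sum_congr rfl fun s _ => ?_ <;> split_ifs with h
  · rw [par_t _ _ h, smul_mul_assoc, smul_comm, add_right_comm]
  · simp
  · rw [smul_mul_assoc, smul_smul, smul_smul, ← pow_add, ← pow_add, par_theta _ _ h,
      Grassmann.iterate_hat_congr (k := _ + (_ + 1) + 1) (l := parSum I₁ +
        parSum (Function.update J₁ s (.inl 0))) (by omega)]
    congr 2
    ring
  · simp
  · rw [Grassmann.iterate_hat_zsmul, mul_smul_comm, smul_smul, smul_smul, ← pow_add, ← pow_add,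
      par_t _ _ h]
    congr 2
    ring
  · simp
  · rw [Grassmann.iterate_hat_zsmul, mul_smul_comm, smul_smul, smul_smul, ← pow_add, ← pow_add]
    congr 2
    ring
  · simp

theorem Balanced.mul {S : PtArr (p + 1) (q + 1) n m r} {T : PtArr (p + 1) (q + 1) n' m' r}
    (hS : S.Balanced) (hT : T.Balanced) : (S.mul T).Balanced where
  vanish I J h := by
    rw [extraCount_castAdd_natAdd I, extraCount_castAdd_natAdd J] at h
    rw [PtArr.mul]
    rcases lt_or_ge (extraCount fun s => J (Fin.castAdd m' s))
      (extraCount fun s => I (Fin.castAdd n' s)) with h1 | h1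
    · rw [hS.vanish _ _ h1, zero_mul, smul_zero]
    · rw [hT.vanish _ _ (by omega), Grassmann.iterate_hat_zero, mul_zero, smul_zero]
  rot_eq_zero I J h := by
    rw [extraCount_castAdd_natAdd I, extraCount_castAdd_natAdd J] at h
    rw [← Fin.append_castAdd_natAdd (f := I), ← Fin.append_castAdd_natAdd (f := J), rot_mul]
    have h1 : S.rot (fun s => I (Fin.castAdd n' s)) (fun s => J (Fin.castAdd m' s)) = 0 ∨
        T (fun s => I (Fin.natAdd n s)) (fun s => J (Fin.natAdd m s)) = 0 := by
      rcases le_or_gt (extraCount fun s => J (Fin.castAdd m' s))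
        (extraCount fun s => I (Fin.castAdd n' s)) with h1 | h1
      · exact .inl (hS.rot_eq_zero _ _ h1)
      · exact .inr (hT.vanish _ _ (by omega))
    have h2 : S (fun s => I (Fin.castAdd n' s)) (fun s => J (Fin.castAdd m' s)) = 0 ∨
        T.rot (fun s => I (Fin.natAdd n s)) (fun s => J (Fin.natAdd m s)) = 0 := by
      rcases lt_or_ge (extraCount fun s => J (Fin.castAdd m' s))
        (extraCount fun s => I (Fin.castAdd n' s)) with h1 | h1
      · exact .inl (hS.vanish _ _ h1)
      · exact .inr (hT.rot_eq_zero _ _ (by omega))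
    rcases h1 with h1 | h1 <;> rcases h2 with h2 | h2 <;> simp [h1, h2]

theorem rot_perm (σ : Equiv.Perm (Fin n)) (τ : Equiv.Perm (Fin m))
    (T : PtArr (p + 1) (q + 1) n m r) (I : Fin n → Idx (p + 1) (q + 1))
    (J : Fin m → Idx (p + 1) (q + 1)) :
    (T.perm σ τ).rot I J = (koszulSign σ I * koszulSign τ J) • T.rot (I ∘ σ) (J ∘ τ) := by
  have hsq (k : ℕ) : (-1 : ℤ) ^ k * (-1) ^ k = 1 := by rw [← mul_pow]; simp
  simp only [rot, perm, smul_add, Finset.smul_sum]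
  rw [← Equiv.sum_comp σ, ← Equiv.sum_comp τ]
  congr 1 <;> refine Finset.sum_congr rfl fun s _ => ?_ <;>
    simp only [Function.comp_apply] <;> split_ifs with h
  · rw [update_comp_perm, koszulSign_update σ I s (by rw [h]; rfl), smul_smul, smul_smul]
    congr 1
    linear_combination (koszulSign σ I * koszulSign τ J * (-1) ^ parBefore (I ∘ σ) s) *
      hsq (parBefore I (σ s))
  · simp
  · rw [update_comp_perm, koszulSign_update τ J s (by rw [h]; rfl), smul_smul, smul_smul,
      parSum_comp_perm, pow_add, pow_add]
    congr 1
    linear_combination (koszulSign σ I * koszulSign τ J * (-1) ^ parSum I *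
      (-1) ^ parBefore (J ∘ τ) s) * hsq (parBefore J (τ s))
  · simp

theorem Balanced.perm {T : PtArr (p + 1) (q + 1) n m r} (hT : T.Balanced)
    (σ : Equiv.Perm (Fin n)) (τ : Equiv.Perm (Fin m)) : (T.perm σ τ).Balanced where
  vanish I J h := by
    rw [PtArr.perm, hT.vanish _ _ (by rwa [extraCount_comp_perm, extraCount_comp_perm]), smul_zero]
  rot_eq_zero I J h := by
    rw [rot_perm, hT.rot_eq_zero _ _ (by rwa [extraCount_comp_perm, extraCount_comp_perm]),
      smul_zero]

theorem parBefore_snoc_castSucc (I : Fin n → Idx p q) (a : Idx p q) (s : Fin n) :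
    parBefore (Fin.snoc I a : Fin (n + 1) → Idx p q) s.castSucc = parBefore I s := by
  unfold parBefore
  rw [Finset.sum_filter, Finset.sum_filter, Fin.sum_univ_castSucc]
  simp [(Fin.castSucc_lt_last s).le]

theorem parBefore_snoc_last (I : Fin n → Idx p q) (a : Idx p q) :
    parBefore (Fin.snoc I a : Fin (n + 1) → Idx p q) (Fin.last n) = parSum I := by
  unfold parBefore parSum
  rw [Finset.sum_filter, Fin.sum_univ_castSucc]
  simp [Fin.castSucc_lt_last]

theorem parSum_snoc (I : Fin n → Idx p q) (a : Idx p q) :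
    parSum (Fin.snoc I a : Fin (n + 1) → Idx p q) = parSum I + a.par := by
  simp [parSum, Fin.sum_univ_castSucc]

theorem parBefore_cons_succ (J : Fin n → Idx p q) (a : Idx p q) (s : Fin n) :
    parBefore (Fin.cons a J : Fin (n + 1) → Idx p q) s.succ = a.par + parBefore J s := by
  unfold parBefore
  rw [Finset.sum_filter, Finset.sum_filter, Fin.sum_univ_succ]
  simp

theorem parBefore_zero (J : Fin (n + 1) → Idx p q) : parBefore J 0 = 0 := by
  simp [parBefore]

/-- The terms of the new slots cancel: `t` turned into `θ` above against `θ` turned into `t` below. -/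
theorem rot_contr (T : PtArr (p + 1) (q + 1) (n + 1) (m + 1) r) (I : Fin n → Idx (p + 1) (q + 1))
    (J : Fin m → Idx (p + 1) (q + 1)) :
    T.contr.rot I J = ∑ a, T.rot (Fin.snoc I a) (Fin.cons a J) := by
  have h (a : Idx (p + 1) (q + 1)) : T.rot (Fin.snoc I a) (Fin.cons a J) =
      ((∑ s, if I s = .inl 0 then (-1 : ℤ) ^ parBefore I s •
          T (Fin.snoc (Function.update I s (.inr 0)) a) (Fin.cons a J) else 0) +
        ∑ s, if J s = .inr 0 then (-1 : ℤ) ^ (parSum I + parBefore J s) •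
          T (Fin.snoc I a) (Fin.cons a (Function.update J s (.inl 0))) else 0) +
      ((if a = .inl 0 then (-1 : ℤ) ^ parSum I • T (Fin.snoc I (.inr 0)) (Fin.cons (.inl 0) J)
        else 0) + if a = .inr 0 then
          (-1 : ℤ) ^ (parSum I + 1) • T (Fin.snoc I (.inr 0)) (Fin.cons (.inl 0) J) else 0) := by
    rw [rot, Fin.sum_univ_castSucc, Fin.sum_univ_succ]
    simp only [Fin.snoc_castSucc, Fin.snoc_last, Fin.cons_zero, Fin.cons_succ,
      parBefore_snoc_castSucc, parBefore_snoc_last, parSum_snoc, parBefore_cons_succ,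
      parBefore_zero, Fin.update_snoc_last, Fin.update_cons_zero, ← Fin.snoc_update,
      ← Fin.cons_update]
    have e1 : (if a = .inl 0 then (-1 : ℤ) ^ parSum I •
          T (Fin.snoc I (.inr 0)) (Fin.cons a J) else 0) =
        if a = .inl 0 then (-1 : ℤ) ^ parSum I • T (Fin.snoc I (.inr 0)) (Fin.cons (.inl 0) J)
        else 0 := by
      split_ifs with h
      · rw [h]
      · rfl
    have e2 : (if a = .inr 0 then (-1 : ℤ) ^ (parSum I + a.par + 0) •
          T (Fin.snoc I a) (Fin.cons (.inl 0) J) else 0) = if a = .inr 0 then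
          (-1 : ℤ) ^ (parSum I + 1) • T (Fin.snoc I (.inr 0)) (Fin.cons (.inl 0) J) else 0 := by
      split_ifs with h
      · rw [h]; rfl
      · rfl
    have e3 (s : Fin m) : (-1 : ℤ) ^ (parSum I + a.par + (a.par + parBefore J s)) =
        (-1) ^ (parSum I + parBefore J s) := neg_one_pow_congr_mod (by omega)
    rw [e1, e2]
    simp only [e3]
    abel
  simp only [h, Finset.sum_add_distrib, Finset.sum_ite_eq', Finset.mem_univ, if_true]
  rw [pow_succ, mul_neg_one, neg_smul, add_neg_cancel, add_zero]
  simp only [rot, contr]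
  rw [Finset.sum_comm, Finset.sum_comm (s := Finset.univ (α := Idx (p + 1) (q + 1)))]
  congr 1 <;> refine Finset.sum_congr rfl fun s _ => ?_ <;> split_ifs <;> simp [Finset.smul_sum]

theorem Balanced.contr {T : PtArr (p + 1) (q + 1) (n + 1) (m + 1) r} (hT : T.Balanced) :
    T.contr.Balanced where
  vanish I J h := Finset.sum_eq_zero fun a _ =>
    hT.vanish _ _ (by rw [extraCount_snoc, extraCount_cons]; omega)
  rot_eq_zero I J h := by
    rw [rot_contr]
    exact Finset.sum_eq_zero fun a _ =>
      hT.rot_eq_zero _ _ (by rw [extraCount_snoc, extraCount_cons]; omega)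

/-- In a contraction of a balanced array at old indices, the terms of `t` and of `θ` cancel: this is
the vanishing of the superdimension of `ℝ^{1|1}`. -/
theorem Balanced.contr_emb {T : PtArr (p + 1) (q + 1) (n + 1) (m + 1) r} (hT : T.Balanced)
    (I : Fin n → Idx p q) (J : Fin m → Idx p q) :
    T.contr (Idx.emb ∘ I) (Idx.emb ∘ J) =
      ∑ a : Idx p q, T (Idx.emb ∘ Fin.snoc I a) (Idx.emb ∘ Fin.cons a J) := by
  -- The only replacements in this component are those of the two new indices, which give the two
  -- extra terms of the contraction.
  have h := hT.rot_eq_zero (Fin.snoc (Idx.emb ∘ I) (.inl 0)) (Fin.cons (.inr 0) (Idx.emb ∘ J))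
    (by rw [extraCount_snoc, extraCount_cons]; simp)
  rw [rot, Fin.sum_univ_castSucc, Fin.sum_univ_succ] at h
  simp only [Fin.snoc_castSucc, Fin.snoc_last, Fin.cons_zero, Fin.cons_succ, Function.comp_apply,
    Idx.emb_ne_t, Idx.emb_ne_theta, if_false, Finset.sum_const_zero, zero_add, add_zero, if_true,
    Fin.update_snoc_last, Fin.update_cons_zero, parBefore_snoc_last, parBefore_zero,
    parSum_snoc, Idx.par] at h
  rw [← smul_add] at h
  have h0 : T (Fin.snoc (Idx.emb ∘ I) (.inr 0)) (Fin.cons (.inr 0) (Idx.emb ∘ J)) +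
      T (Fin.snoc (Idx.emb ∘ I) (.inl 0)) (Fin.cons (.inl 0) (Idx.emb ∘ J)) = 0 := by
    have := congrArg (fun y => (-1 : ℤ) ^ parSum (Idx.emb ∘ I) • y) h
    simp only [smul_smul, ← mul_pow, smul_zero] at this
    simpa using this
  rw [PtArr.contr, Idx.sum_emb, add_comm (T _ _), h0, zero_add]
  refine Finset.sum_congr rfl fun a _ => ?_
  rw [Fin.comp_snoc, Fin.comp_cons]

end PtArr

/-! ### Universal expressions on `M × ℝ^{1|1}` -/

section Pointwise

variable {p q n m : ℕ}

theorem SuperFun.sign_mul_apply (k : ℕ) (f : SuperFun p q) (x : Fin p → ℝ) :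
    ((-1) ^ k * f) x = (-1 : ℤ) ^ k • f x := by
  rw [neg_one_pow_mul_eq_zsmul]; rfl

namespace UnivExpr

variable (Q : Arr p q 1 0) (Γ : Idx p q → Idx p q → Idx p q → SuperFun p q) (x : Fin p → ℝ)

/-- The value of a universal expression at a point. -/
def evalAt (C : UnivExpr n m) : PtArr p q n m q := fun I J => C.eval Q Γ I J x

theorem evalAt_add (S T : UnivExpr n m) :
    (S.add T).evalAt Q Γ x = S.evalAt Q Γ x + T.evalAt Q Γ x := rfl

theorem evalAt_smul (r : ℝ) (T : UnivExpr n m) :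
    (T.smul r).evalAt Q Γ x = r • T.evalAt Q Γ x := rfl

theorem evalAt_one : one.evalAt Q Γ x = fun _ _ => 1 := rfl

theorem evalAt_delta : delta.evalAt Q Γ x = PtArr.delta := by
  funext I J
  simp only [evalAt, eval, PtArr.delta]
  split_ifs <;> rfl

theorem evalAt_mul {n' m' : ℕ} (S : UnivExpr n m) (T : UnivExpr n' m') :
    (S.mul T).evalAt Q Γ x = (S.evalAt Q Γ x).mul (T.evalAt Q Γ x) := by
  funext I J
  simp only [evalAt, eval, SuperFun.sign_mul_apply]
  rfl

theorem evalAt_perm (σ : Equiv.Perm (Fin n)) (τ : Equiv.Perm (Fin m)) (T : UnivExpr n m) :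
    (T.perm σ τ).evalAt Q Γ x = (T.evalAt Q Γ x).perm σ τ := rfl

theorem evalAt_contr (T : UnivExpr (n + 1) (m + 1)) :
    T.contr.evalAt Q Γ x = (T.evalAt Q Γ x).contr := by
  funext I J
  simp only [evalAt, eval, PtArr.contr, Finset.sum_apply]

end UnivExpr

end Pointwise

namespace PtArr

variable {p q n m n' m' r : ℕ}

/-- The part of an array without the first generator. -/
def body (T : PtArr p q n m (r + 1)) : PtArr p q n m r := fun I J => Grassmann.r0 (T I J)

theorem body_mul (S : PtArr p q n m (r + 1)) (T : PtArr p q n' m' (r + 1)) :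
    (S.mul T).body = S.body.mul T.body := by
  funext I J
  simp only [body, mul, map_zsmul, Grassmann.r0_mul, Grassmann.r0_iterate_hat]

theorem body_perm (σ : Equiv.Perm (Fin n)) (τ : Equiv.Perm (Fin m)) (T : PtArr p q n m (r + 1)) :
    (T.perm σ τ).body = T.body.perm σ τ := by
  funext I J
  simp only [body, perm, map_zsmul]

theorem body_contr (T : PtArr p q (n + 1) (m + 1) (r + 1)) :
    T.contr.body = T.body.contr := by
  funext I J
  simp only [body, contr, map_sum]

theorem body_delta : (delta : PtArr p q 1 1 (r + 1)).body = delta := by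
  funext I J
  simp only [body, delta]
  split_ifs
  · rw [← mul_one ((-1) ^ _), neg_one_pow_mul_eq_zsmul, map_zsmul, Grassmann.r0_one,
      ← neg_one_pow_mul_eq_zsmul, mul_one]
  · simp

theorem body_add (S T : PtArr p q n m (r + 1)) : (S + T).body = S.body + T.body := by
  funext I J
  simp [body]

theorem body_smul (c : ℝ) (T : PtArr p q n m (r + 1)) : (c • T).body = c • T.body := by
  funext I J
  simp [body]

end PtArr

section Jets

variable {p q m : ℕ}

namespace SuperFun

theorem contDiffOn_tw {f : SuperFun p q} {U : Set (Fin p → ℝ)} (k : ℕ)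
    (hf : ContDiffOn ℝ ∞ f U) : ContDiffOn ℝ ∞ (tw k f) U := by
  induction k generalizing f with
  | zero => exact hf
  | succ k ih => exact ih (Grassmann.hatL.contDiff.comp_contDiffOn hf)

theorem contDiffOn_sign_mul {f : SuperFun p q} {U : Set (Fin p → ℝ)} (k : ℕ)
    (hf : ContDiffOn ℝ ∞ f U) : ContDiffOn ℝ ∞ ((-1) ^ k * f) U := by
  rcases neg_one_pow_eq_or (SuperFun p q) k with h | h
  · rwa [h, one_mul]
  · rw [h, neg_one_mul]
    exact hf.neg

theorem contDiffOn_pd {f : SuperFun p q} {U : Set (Fin p → ℝ)} (hU : IsOpen U) (i : Idx p q)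
    (hf : ContDiffOn ℝ ∞ f U) : ContDiffOn ℝ ∞ (pd i f) U := by
  cases i with
  | inl i => exact (hf.fderiv_of_isOpen hU (by simp)).clm_apply contDiffOn_const
  | inr a => exact (Grassmann.pderivL a).contDiff.comp_contDiffOn hf

theorem pd_congr {f g : SuperFun p q} {U : Set (Fin p → ℝ)} (hU : IsOpen U) {x : Fin p → ℝ}
    (hx : x ∈ U) (h : Set.EqOn f g U) (i : Idx p q) : pd i f x = pd i g x := by
  cases i with
  | inl i =>
    simp only [pd]
    rw [(h.eventuallyEq_of_mem (hU.mem_nhds hx)).fderiv_eq]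
  | inr a =>
    simp only [pd]
    rw [h hx]

@[simp] theorem tw_zero (k : ℕ) : tw k (0 : SuperFun p q) = 0 := by
  funext x
  exact Grassmann.iterate_hat_zero k

end SuperFun

open SuperFun

theorem Jet.contDiffOn_eval {Q : Arr p q 1 0} {Γ : Idx p q → Idx p q → Idx p q → SuperFun p q}
    {U : Set (Fin p → ℝ)} (hU : IsOpen U) (hQ : ∀ I J, ContDiffOn ℝ ∞ (Q I J) U)
    (hΓ : ∀ i j k, ContDiffOn ℝ ∞ (Γ i j k) U) (S : Jet m) (I : Fin 1 → Idx p q)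
    (J : Fin m → Idx p q) : ContDiffOn ℝ ∞ (S.eval Q Γ I J) U := by
  induction S with
  | Q => exact hQ I J
  | Γ => exact contDiffOn_sign_mul _ (contDiffOn_tw _ (hΓ _ _ _))
  | d S ih => exact contDiffOn_sign_mul _ (contDiffOn_tw _ (contDiffOn_pd hU _ (ih _)))

/-- The Christoffel symbols of the connection `(1 - c) ∇₀ + c ∇₁`. -/
def interp (c : ℝ) (Γ₀ Γ₁ : Idx p q → Idx p q → Idx p q → SuperFun p q) :
    Idx p q → Idx p q → Idx p q → SuperFun p q :=
  (1 - c) • Γ₀ + c • Γ₁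

/-- The vector field `Q + θ ∂_t`. -/
def stabVector (Q : Arr p q 1 0) : Arr (p + 1) (q + 1) 1 0 := fun I _ =>
  Idx.extend (coord (.inr 0)) 0 (fun i => SuperFun.lift (Q (fun _ => i) Fin.elim0)) (I 0)

/-- The Christoffel symbols of the connection on the product with `ℝ^{1|1}` that is
`(1 - t) ∇₀ + t ∇₁` on the old vector fields, and flat in the directions of `t` and `θ`. -/
def stabChristoffel (Γ₀ Γ₁ : Idx p q → Idx p q → Idx p q → SuperFun p q) :
    Idx (p + 1) (q + 1) → Idx (p + 1) (q + 1) → Idx (p + 1) (q + 1) → SuperFun (p + 1) (q + 1) :=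
  fun i j k => Idx.extend 0 0 (fun i => Idx.extend 0 0 (fun j => Idx.extend 0 0
    (fun k y => Grassmann.lift (interp (y 0) Γ₀ Γ₁ i j k (Fin.tail y))) k) j) i

variable {Q : Arr p q 1 0} {Γ₀ Γ₁ : Idx p q → Idx p q → Idx p q → SuperFun p q}

@[simp] theorem stabVector_t (J) :
    stabVector Q (fun _ => .inl 0) J = coord (.inr 0) := rfl

@[simp] theorem stabVector_theta (J) : stabVector Q (fun _ => .inr 0) J = 0 := rfl

@[simp] theorem stabVector_emb (i : Idx p q) (J) :
    stabVector Q (fun _ => i.emb) J = SuperFun.lift (Q (fun _ => i) Fin.elim0) := by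
  simp [stabVector]

@[simp] theorem stabChristoffel_emb (i j k : Idx p q) (c : ℝ) (x : Fin p → ℝ) :
    stabChristoffel Γ₀ Γ₁ i.emb j.emb k.emb (pt c x) =
      Grassmann.lift (interp c Γ₀ Γ₁ i j k x) := by
  simp [stabChristoffel]

theorem stabChristoffel_eq_zero {i j k : Idx (p + 1) (q + 1)}
    (h : i ∉ Set.range (Idx.emb : Idx p q → _) ∨ j ∉ Set.range (Idx.emb : Idx p q → _) ∨
      k ∉ Set.range (Idx.emb : Idx p q → _)) : stabChristoffel Γ₀ Γ₁ i j k = 0 := by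
  unfold stabChristoffel
  induction i using Idx.cases_emb with
  | ht => rfl
  | hθ => rfl
  | h i =>
    induction j using Idx.cases_emb with
    | ht => simp
    | hθ => simp
    | h j =>
      induction k using Idx.cases_emb with
      | ht => simp
      | hθ => simp
      | h k => simp at h

theorem contDiffOn_interp {U : Set (Fin p → ℝ)} (hΓ₀ : ∀ i j k, ContDiffOn ℝ ∞ (Γ₀ i j k) U)
    (hΓ₁ : ∀ i j k, ContDiffOn ℝ ∞ (Γ₁ i j k) U) (c : ℝ) (i j k : Idx p q) :
    ContDiffOn ℝ ∞ (interp c Γ₀ Γ₁ i j k) U :=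
  ((hΓ₀ i j k).const_smul (1 - c)).add ((hΓ₁ i j k).const_smul c)

theorem contDiffOn_stabVector {U : Set (Fin p → ℝ)} (hQ : ∀ I J, ContDiffOn ℝ ∞ (Q I J) U)
    (I J) : ContDiffOn ℝ ∞ (stabVector Q I J) (Fin.tail ⁻¹' U) := by
  unfold stabVector
  induction I 0 using Idx.cases_emb with
  | ht => exact (contDiff_coord (.inr 0)).contDiffOn
  | hθ => exact contDiffOn_const
  | h i => simpa using contDiffOn_lift (hQ _ _)

theorem contDiffOn_stabChristoffel {U : Set (Fin p → ℝ)}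
    (hΓ₀ : ∀ i j k, ContDiffOn ℝ ∞ (Γ₀ i j k) U) (hΓ₁ : ∀ i j k, ContDiffOn ℝ ∞ (Γ₁ i j k) U)
    (i j k : Idx (p + 1) (q + 1)) :
    ContDiffOn ℝ ∞ (stabChristoffel Γ₀ Γ₁ i j k) (Fin.tail ⁻¹' U) := by
  by_cases h : i ∉ Set.range (Idx.emb : Idx p q → _) ∨ j ∉ Set.range (Idx.emb : Idx p q → _) ∨
      k ∉ Set.range (Idx.emb : Idx p q → _)
  · rw [stabChristoffel_eq_zero h]
    exact contDiffOn_const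
  · push Not at h
    obtain ⟨⟨i, rfl⟩, ⟨j, rfl⟩, k, rfl⟩ := h
    have hy : ContDiff ℝ ∞ fun y : Fin (p + 1) → ℝ => y 0 := contDiff_apply ℝ ℝ 0
    have h0 := (hΓ₀ i j k).comp (tailL.contDiff (n := ∞)).contDiffOn fun _ h => h
    have h1 := (hΓ₁ i j k).comp (tailL.contDiff (n := ∞)).contDiffOn fun _ h => h
    have := Grassmann.lift.contDiff.comp_contDiffOn
      (((contDiff_const (c := (1 : ℝ))).sub hy).contDiffOn.smul h0 |>.add (hy.contDiffOn.smul h1))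
    refine this.congr fun y _ => ?_
    simp only [stabChristoffel, Idx.extend_emb]
    rfl

theorem Jet.eval_stab_emb {U : Set (Fin p → ℝ)} (hU : IsOpen U)
    (hQ : ∀ I J, ContDiffOn ℝ ∞ (Q I J) U) (hΓ₀ : ∀ i j k, ContDiffOn ℝ ∞ (Γ₀ i j k) U)
    (hΓ₁ : ∀ i j k, ContDiffOn ℝ ∞ (Γ₁ i j k) U) (S : Jet m) (I : Fin 1 → Idx p q)
    (J : Fin m → Idx p q) (c : ℝ) {x : Fin p → ℝ} (hx : x ∈ U) :
    S.eval (stabVector Q) (stabChristoffel Γ₀ Γ₁) (Idx.emb ∘ I) (Idx.emb ∘ J) (pt c x) =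
      Grassmann.lift (S.eval Q (interp c Γ₀ Γ₁) I J x) := by
  induction S generalizing x with
  | Q =>
    have hI : I = fun _ => I 0 := by funext s; rw [Fin.fin_one_eq_zero s]
    have hJ : J = Fin.elim0 := by funext s; exact s.elim0
    simp only [Jet.eval]
    rw [hI, hJ]
    exact congrFun (stabVector_emb (I 0) _) _
  | Γ =>
    simp only [Jet.eval, sign_mul_apply, map_zsmul, tw_apply, ← Grassmann.iterate_hat_lift,
      Function.comp_apply, Idx.par_emb, stabChristoffel_emb]
  | d S ih =>
    have ht : Fin.tail (Idx.emb ∘ J) = Idx.emb ∘ Fin.tail J := rfl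
    have hd : DifferentiableAt ℝ (S.eval (stabVector Q) (stabChristoffel Γ₀ Γ₁) (Idx.emb ∘ I)
        (Idx.emb ∘ Fin.tail J)) (pt c x) :=
      ((Jet.contDiffOn_eval (hU.preimage tailL.continuous) (contDiffOn_stabVector hQ)
        (contDiffOn_stabChristoffel hΓ₀ hΓ₁) S _ _).contDiffAt
        ((hU.preimage tailL.continuous).mem_nhds hx)).differentiableAt (by simp)
    simp only [Jet.eval, sign_mul_apply, map_zsmul, tw_apply, ← Grassmann.iterate_hat_lift,
      Function.comp_apply, Idx.par_emb, ht]
    congr 2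
    refine Grassmann.ext_r ?_ ?_
    · rw [r0_pd_emb hd, Grassmann.r0_lift]
      refine pd_congr hU hx (fun z hz => ?_) _
      rw [s0, ih (Fin.tail J) hz, Grassmann.r0_lift]
    · rw [r1_pd_emb hd, Grassmann.r1_lift, pd_congr (g := 0) hU hx (fun z hz => ?_), pd_zero]
      · simp
      · rw [s1, ih (Fin.tail J) hz, Grassmann.r1_lift]
        rfl

/-- The jets are affine in the connection. -/
theorem Jet.eval_interp {U : Set (Fin p → ℝ)} (hU : IsOpen U)
    (hQ : ∀ I J, ContDiffOn ℝ ∞ (Q I J) U) (hΓ₀ : ∀ i j k, ContDiffOn ℝ ∞ (Γ₀ i j k) U)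
    (hΓ₁ : ∀ i j k, ContDiffOn ℝ ∞ (Γ₁ i j k) U) (S : Jet m) (I : Fin 1 → Idx p q)
    (J : Fin m → Idx p q) (c : ℝ) {x : Fin p → ℝ} (hx : x ∈ U) :
    S.eval Q (interp c Γ₀ Γ₁) I J x = (1 - c) • S.eval Q Γ₀ I J x + c • S.eval Q Γ₁ I J x := by
  have hsign (k : ℕ) (a b : Grassmann q) : (-1 : ℤ) ^ k • ((1 - c) • a + c • b) =
      (1 - c) • (-1 : ℤ) ^ k • a + c • (-1 : ℤ) ^ k • b := by
    rw [smul_add, smul_comm _ (1 - c), smul_comm _ c]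
  induction S generalizing x with
  | Q => simp only [Jet.eval]; rw [← add_smul]; simp
  | Γ =>
    simp only [Jet.eval, sign_mul_apply, tw_apply]
    rw [← hsign, ← Grassmann.iterate_hat_smul, ← Grassmann.iterate_hat_smul,
      ← Grassmann.iterate_hat_add]
    rfl
  | d S ih =>
    have h0 := ((Jet.contDiffOn_eval hU hQ hΓ₀ S I (Fin.tail J)).contDiffAt (hU.mem_nhds hx))
    have h1 := ((Jet.contDiffOn_eval hU hQ hΓ₁ S I (Fin.tail J)).contDiffAt (hU.mem_nhds hx))
    simp only [Jet.eval, sign_mul_apply, tw_apply]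
    rw [← hsign, ← Grassmann.iterate_hat_smul, ← Grassmann.iterate_hat_smul,
      ← Grassmann.iterate_hat_add, ← pd_smul _ _ h0, ← pd_smul _ _ h1,
      ← pd_add _ (f := (1 - c) • S.eval Q Γ₀ I (Fin.tail J)) (g := c • S.eval Q Γ₁ I (Fin.tail J))
        (h0.const_smul (1 - c)) (h1.const_smul c)]
    congr 2
    exact pd_congr hU hx (fun z hz => ih (Fin.tail J) hz) _

/-! ### The components of the jets in the extra directions -/

theorem Jet.eval_d (Q : Arr p q 1 0) (Γ : Idx p q → Idx p q → Idx p q → SuperFun p q) (S : Jet m)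
    (I : Fin 1 → Idx p q) (J : Fin (m + 1) → Idx p q) :
    S.d.eval Q Γ I J = (-1) ^ ((J 0).par * (I 0).par) *
      tw (J 0).par (pd (J 0) (S.eval Q Γ I (Fin.tail J))) := rfl

theorem Jet.eval_Γ_stab {i : Idx (p + 1) (q + 1)} (hi : i ∉ Set.range (Idx.emb : Idx p q → _))
    (J : Fin 2 → Idx (p + 1) (q + 1)) :
    Jet.Γ.eval (stabVector Q) (stabChristoffel Γ₀ Γ₁) (fun _ => i) J = 0 := by
  simp only [Jet.eval]
  rw [stabChristoffel_eq_zero (.inr (.inr hi)), tw_zero, mul_zero]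

theorem Jet.eval_stab_theta (S : Jet m) (J : Fin m → Idx (p + 1) (q + 1)) :
    S.eval (stabVector Q) (stabChristoffel Γ₀ Γ₁) (fun _ => .inr 0) J = 0 := by
  induction S with
  | Q => rfl
  | Γ => exact Jet.eval_Γ_stab (by simp) J
  | d S ih => rw [Jet.eval_d, ih, pd_zero, tw_zero, mul_zero]

theorem SuperFun.tw_const (k : ℕ) (r : ℝ) :
    tw k (fun _ : Fin p → ℝ => r • (1 : Grassmann q)) = fun _ => r • (1 : Grassmann q) := by
  funext x
  rw [tw_apply, Grassmann.iterate_hat_smul, Grassmann.iterate_hat_one]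

/-- The component `Q^t = θ` is linear, so that its derivatives are constant. -/
theorem Jet.eval_d_stab_t (S : Jet m) (J : Fin (m + 1) → Idx (p + 1) (q + 1)) :
    ∃ r : ℝ, S.d.eval (stabVector Q) (stabChristoffel Γ₀ Γ₁) (fun _ => .inl 0) J =
      fun _ => r • 1 := by
  have h0 : ∃ r : ℝ, (0 : SuperFun (p + 1) (q + 1)) = fun _ => r • 1 :=
    ⟨0, by funext; simp⟩
  induction S with
  | Q =>
    have : pd (J 0) (coord (.inr 0)) = fun _ : Fin (p + 1) → ℝ =>
        (if J 0 = .inr 0 then 1 else 0 : ℝ) • (1 : Grassmann (q + 1)) := by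
      rw [pd_coord_theta]
      split_ifs <;> simp
    refine ⟨if J 0 = .inr 0 then 1 else 0, ?_⟩
    simp only [Jet.eval, stabVector_t, this, tw_const]
    simp [Idx.par]
  | Γ =>
    rw [Jet.eval_d, Jet.eval_Γ_stab (by simp), pd_zero, tw_zero, mul_zero]
    exact h0
  | d S ih =>
    obtain ⟨r, hr⟩ := ih (Fin.tail J)
    rw [Jet.eval_d, hr, pd_const_one, tw_zero, mul_zero]
    exact h0

theorem Jet.pd_eval_stab_t (S : Jet m) (J : Fin m → Idx (p + 1) (q + 1))
    {j : Idx (p + 1) (q + 1)} (hj : j ≠ .inr 0) :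
    pd j (S.eval (stabVector Q) (stabChristoffel Γ₀ Γ₁) (fun _ => .inl 0) J) = 0 := by
  cases S with
  | Q =>
    simp only [Jet.eval, stabVector_t]
    rw [pd_coord_theta, if_neg hj]
    rfl
  | Γ => rw [Jet.eval_Γ_stab (by simp), pd_zero]
  | d S =>
    obtain ⟨r, hr⟩ := Jet.eval_d_stab_t (Q := Q) (Γ₀ := Γ₀) (Γ₁ := Γ₁) S J
    rw [hr, pd_const_one]

theorem Jet.eval_stab_t_of_mem (S : Jet m) (J : Fin m → Idx (p + 1) (q + 1)) (s : Fin m)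
    (hs : J s = .inl 0) :
    S.eval (stabVector Q) (stabChristoffel Γ₀ Γ₁) (fun _ => .inl 0) J = 0 := by
  induction S with
  | Q => exact s.elim0
  | Γ => exact Jet.eval_Γ_stab (by simp) J
  | d S ih =>
    rw [Jet.eval_d]
    revert hs
    refine Fin.cases (fun hs => ?_) (fun s hs => ?_) s
    · rw [hs, Jet.pd_eval_stab_t S _ (by simp), tw_zero, mul_zero]
    · rw [ih (Fin.tail J) s hs, pd_zero, tw_zero, mul_zero]

theorem Jet.r0_eval_stab_t_emb (S : Jet m) (J : Fin m → Idx p q) (y : Fin (p + 1) → ℝ) :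
    Grassmann.r0 (S.eval (stabVector Q) (stabChristoffel Γ₀ Γ₁) (fun _ => .inl 0)
      (Idx.emb ∘ J) y) = 0 := by
  cases S with
  | Q => exact Grassmann.r0_gen_zero
  | Γ =>
    rw [Jet.eval_Γ_stab (by simp)]
    exact map_zero _
  | d S =>
    rw [Jet.eval_d, Jet.pd_eval_stab_t S _ (by simp), tw_zero, mul_zero]
    exact map_zero _

/-- An extra upper index of a jet of `Q + θ ∂_t` or of the connection on the product occurs only in
`Q^t = θ`, which vanishes at `θ = 0`, and in its derivative along `θ`. -/
theorem Jet.balanced_eval_stab (S : Jet m) (y : Fin (p + 1) → ℝ) :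
    PtArr.Balanced fun I J =>
      Grassmann.r0 (S.eval (stabVector Q) (stabChristoffel Γ₀ Γ₁) I J y) := by
  have hI (I : Fin 1 → Idx (p + 1) (q + 1)) : ∃ i, I = fun _ => i :=
    ⟨I 0, by funext s; rw [Fin.fin_one_eq_zero s]⟩
  have hcount (i : Idx (p + 1) (q + 1)) : extraCount (fun _ : Fin 1 => i) =
      Idx.extend 1 1 (fun _ : Idx p q => 0) i := by simp [extraCount]
  have hu (i j : Idx (p + 1) (q + 1)) (s : Fin 1) :
      Function.update (fun _ => i) s j = fun _ => j := by
    funext s'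
    rw [Subsingleton.elim s' s, Function.update_self]
  have hcount_t (i : Idx (p + 1) (q + 1)) : Idx.extend 1 1 (fun _ : Idx p q => 0) i ≤ 1 := by
    induction i using Idx.cases_emb <;> simp
  constructor
  · intro I J h
    obtain ⟨i, rfl⟩ := hI I
    rw [hcount] at h
    have h0 : extraCount J = 0 := by have := hcount_t i; omega
    obtain ⟨J, rfl⟩ := exists_emb_of_extraCount_eq_zero h0
    revert h
    induction i using Idx.cases_emb with
    | ht => exact fun _ => Jet.r0_eval_stab_t_emb S J y
    | hθ => exact fun _ => by rw [Jet.eval_stab_theta]; exact map_zero _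
    | h i => simp
  · intro I J h
    obtain ⟨i, rfl⟩ := hI I
    rw [hcount] at h
    rw [PtArr.rot]
    simp only [hu, Jet.eval_stab_theta, Pi.zero_apply, map_zero, smul_zero, ite_self,
      Finset.sum_const_zero, zero_add]
    refine Finset.sum_eq_zero fun s _ => ?_
    split_ifs with hs
    · revert h
      induction i using Idx.cases_emb with
      | ht =>
        intro _
        rw [Jet.eval_stab_t_of_mem S _ s (Function.update_self ..)]
        simp
      | hθ =>
        intro _
        rw [Jet.eval_stab_theta]
        simp
      | h i =>
        intro h
        rw [Idx.extend_emb, Nat.le_zero] at h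
        obtain ⟨J, rfl⟩ := exists_emb_of_extraCount_eq_zero h
        simp at hs
    · rfl

end Jets

section Restriction

variable {p q n m : ℕ} {Q : Arr p q 1 0} {Γ₀ Γ₁ : Idx p q → Idx p q → Idx p q → SuperFun p q}

theorem UnivExpr.balanced_eval_stab (C : UnivExpr n m) (y : Fin (p + 1) → ℝ) :
    (C.evalAt (stabVector Q) (stabChristoffel Γ₀ Γ₁) y).body.Balanced := by
  induction C with
  | jet S => exact S.balanced_eval_stab y
  | one =>
    rw [UnivExpr.evalAt_one]
    have h : PtArr.body (fun _ _ => 1 : PtArr (p + 1) (q + 1) 0 0 (q + 1)) = fun _ _ => 1 := by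
      funext I J
      exact Grassmann.r0_one
    rw [h]
    exact PtArr.balanced_one
  | delta =>
    rw [UnivExpr.evalAt_delta, PtArr.body_delta]
    exact PtArr.balanced_delta
  | add S T hS hT =>
    rw [UnivExpr.evalAt_add, PtArr.body_add]
    exact hS.add hT
  | smul r T hT =>
    rw [UnivExpr.evalAt_smul, PtArr.body_smul]
    exact hT.smul r
  | mul S T hS hT =>
    rw [UnivExpr.evalAt_mul, PtArr.body_mul]
    exact hS.mul hT
  | perm σ τ T hT =>
    rw [UnivExpr.evalAt_perm, PtArr.body_perm]
    exact hT.perm σ τ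
  | contr T hT =>
    rw [UnivExpr.evalAt_contr, PtArr.body_contr]
    exact hT.contr

theorem koszulSign_emb (σ : Equiv.Perm (Fin n)) (I : Fin n → Idx p q) :
    koszulSign σ (Idx.emb ∘ I) = koszulSign σ I := by
  simp [koszulSign]

/-- On the slice `t = c`, `θ = 0`, the value of a universal expression on `M × ℝ^{1|1}` restricts to
its value on `M` for the connection `(1 - c) ∇₀ + c ∇₁`. -/
theorem UnivExpr.r0_eval_stab_emb {U : Set (Fin p → ℝ)} (hU : IsOpen U)
    (hQ : ∀ I J, ContDiffOn ℝ ∞ (Q I J) U) (hΓ₀ : ∀ i j k, ContDiffOn ℝ ∞ (Γ₀ i j k) U)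
    (hΓ₁ : ∀ i j k, ContDiffOn ℝ ∞ (Γ₁ i j k) U) (C : UnivExpr n m) (I : Fin n → Idx p q)
    (J : Fin m → Idx p q) (c : ℝ) {x : Fin p → ℝ} (hx : x ∈ U) :
    (C.evalAt (stabVector Q) (stabChristoffel Γ₀ Γ₁) (pt c x)).body (Idx.emb ∘ I) (Idx.emb ∘ J) =
      C.evalAt Q (interp c Γ₀ Γ₁) x I J := by
  induction C with
  | jet S =>
    exact (congrArg Grassmann.r0 (S.eval_stab_emb hU hQ hΓ₀ hΓ₁ I J c hx)).trans
      (Grassmann.r0_lift _)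
  | one =>
    rw [UnivExpr.evalAt_one, UnivExpr.evalAt_one]
    exact Grassmann.r0_one
  | delta =>
    rw [UnivExpr.evalAt_delta, PtArr.body_delta, UnivExpr.evalAt_delta]
    simp [PtArr.delta]
  | add S T hS hT =>
    rw [UnivExpr.evalAt_add, PtArr.body_add, UnivExpr.evalAt_add]
    simp only [Pi.add_apply, hS, hT]
  | smul r T hT =>
    rw [UnivExpr.evalAt_smul, PtArr.body_smul, UnivExpr.evalAt_smul]
    simp only [Pi.smul_apply, hT]
  | mul S T hS hT =>
    rw [UnivExpr.evalAt_mul, PtArr.body_mul, UnivExpr.evalAt_mul]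
    have h (k l : ℕ) (I : Fin (k + l) → Idx p q) :
        (fun s => (Idx.emb ∘ I) (Fin.castAdd l s)) = Idx.emb ∘ fun s => I (Fin.castAdd l s) := rfl
    have h' (k l : ℕ) (I : Fin (k + l) → Idx p q) :
        (fun s => (Idx.emb ∘ I) (Fin.natAdd k s)) = Idx.emb ∘ fun s => I (Fin.natAdd k s) := rfl
    simp only [PtArr.mul, h, h', parSum_emb, hS, hT]
  | perm σ τ T hT =>
    rw [UnivExpr.evalAt_perm, PtArr.body_perm, UnivExpr.evalAt_perm]
    simp only [PtArr.perm, koszulSign_emb, Function.comp_assoc, hT]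
  | contr T hT =>
    rw [UnivExpr.evalAt_contr, PtArr.body_contr, UnivExpr.evalAt_contr,
      (T.balanced_eval_stab (pt c x)).contr_emb]
    simp only [hT]
    rfl

end Restriction

/-! ### The product of a supermanifold with `ℝ^{1|1}` -/

open SuperFun

section Local

variable {p q : ℕ}

theorem exists_eq_pt (y : Fin (p + 1) → ℝ) : ∃ c x, y = pt c x := ⟨y 0, Fin.tail y, (pt_tail y).symm⟩

theorem SuperFun.lift_coord (i : Idx p q) :
    SuperFun.lift (coord i : SuperFun p q) = coord i.emb := by
  funext y
  cases i with
  | inl i =>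
    change Grassmann.lift (Fin.tail y i • (1 : Grassmann q)) = y i.succ • 1
    rw [map_smul, Grassmann.lift_one]
    rfl
  | inr a => exact Grassmann.lift_gen a

theorem SuperFun.pd_lift {U : Set (Fin p → ℝ)} (hU : IsOpen U) {f : SuperFun p q}
    (hf : ContDiffOn ℝ ∞ f U) {y : Fin (p + 1) → ℝ} (hy : y ∈ Fin.tail ⁻¹' U)
    (j : Idx (p + 1) (q + 1)) :
    pd j (SuperFun.lift f) y = Idx.extend 0 0 (fun j => SuperFun.lift (pd j f)) j y := by
  obtain ⟨c, x, rfl⟩ := exists_eq_pt y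
  have h : ContDiffAt ℝ ∞ f x := hf.contDiffAt (hU.mem_nhds hy)
  induction j using Idx.cases_emb with
  | ht => exact pd_t_lift h
  | hθ => exact pd_theta_lift _ _
  | h j => rw [pd_emb_lift h, Idx.extend_emb]; rfl

theorem frameProd_fin_one (b : Idx p q → Idx p q → SuperFun p q) (i k : Idx p q) :
    frameProd (n := 1) b (fun _ => i) (fun _ => k) = b i k := by
  simp [frameProd, parBefore]
  rfl

/-- For a vector field the tensor law says that the field applied to the new coordinates gives its new
components. -/
theorem tensorLaw_vector_iff {φ : SuperMap p q p q} {T T' : Arr p q 1 0} {x : Fin p → ℝ} :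
    TensorLaw φ T T' x ↔ ∀ k, (∑ i, T (fun _ => i) Fin.elim0 * pd i (φ k)) x =
      SuperFun.comp (T' (fun _ => k) Fin.elim0) φ x := by
  have key (k : Idx p q) (J : Fin 0 → Idx p q) :
      (∑ I, T I J * frameProd (fun i k => pd i (φ k)) I (fun _ => k)) x =
        (∑ L, SuperFun.comp (T' (fun _ => k) L) φ * tw (parSum fun _ : Fin 1 => k)
        (frameProd (fun l j => tw j.par (pd j (φ l))) L J)) x ↔
      (∑ i, T (fun _ => i) Fin.elim0 * pd i (φ k)) x =
        SuperFun.comp (T' (fun _ => k) Fin.elim0) φ x := by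
    have e1 : ∑ I, T I J * frameProd (fun i k => pd i (φ k)) I (fun _ => k) =
        ∑ i, T (fun _ => i) Fin.elim0 * pd i (φ k) := by
      refine Fintype.sum_equiv (Equiv.funUnique (Fin 1) (Idx p q)) _ _ fun I => ?_
      have hI : I = fun _ => I 0 := by funext s; rw [Fin.fin_one_eq_zero s]
      rw [hI, frameProd_fin_one, Subsingleton.elim J Fin.elim0]
      rfl
    have e2 : (∑ L, SuperFun.comp (T' (fun _ => k) L) φ * tw (parSum fun _ : Fin 1 => k)
        (frameProd (fun l j => tw j.par (pd j (φ l))) L J)) x =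
        SuperFun.comp (T' (fun _ => k) Fin.elim0) φ x := by
      rw [Fintype.sum_unique, Subsingleton.elim default (Fin.elim0 : Fin 0 → Idx p q)]
      have : frameProd (fun l j => tw j.par (pd j (φ l))) Fin.elim0 J = 1 := by
        simp [frameProd]
      rw [this, Pi.mul_apply, tw_apply, Pi.one_apply, Grassmann.iterate_hat_one, mul_one]
    rw [e1, e2]
  constructor
  · intro h k
    exact (key k Fin.elim0).1 (h (fun _ => k) Fin.elim0)
  · intro h K J
    have hK : K = fun _ => K 0 := by funext s; rw [Fin.fin_one_eq_zero s]
    rw [hK]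
    exact (key (K 0) J).2 (h (K 0))

end Local

namespace Supermanifold

variable {p q : ℕ} (M : Supermanifold.{u, v} p q)

theorem isOpen_overlap (a b : M.ι) : IsOpen (M.overlap a b) :=
  (M.chart a).isOpen_inter_preimage_symm (M.chart b).open_source

variable {M} in
theorem contDiffAt_trans {a b : M.ι} {x : Fin p → ℝ} (hx : x ∈ M.overlap a b) (k : Idx p q) :
    ContDiffAt ℝ ∞ (M.trans a b k) x :=
  (M.trans_smooth a b k).contDiffAt ((M.isOpen_overlap a b).mem_nhds hx)

variable {M} in
theorem trans_inl_hasParity {a b : M.ι} {x : Fin p → ℝ} (hx : x ∈ M.overlap a b) (i : Fin p) :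
    (M.trans a b (.inl i) x).HasParity 0 :=
  M.trans_parity a b (.inl i) x hx

/-- A chart of `M × ℝ^{1|1}`. -/
def stabChart (a : M.ι) : OpenPartialHomeomorph (M.carrier × ℝ) (Fin (p + 1) → ℝ) where
  toFun z := pt z.2 (M.chart a z.1)
  invFun y := ((M.chart a).symm (Fin.tail y), y 0)
  source := Prod.fst ⁻¹' (M.chart a).source
  target := Fin.tail ⁻¹' (M.chart a).target
  map_source' z hz := (M.chart a).map_source hz
  map_target' y hy := (M.chart a).map_target hy
  left_inv' z hz := Prod.ext ((M.chart a).left_inv hz) rfl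
  right_inv' y hy := by
    change pt (y 0) (M.chart a ((M.chart a).symm (Fin.tail y))) = y
    rw [(M.chart a).right_inv hy, pt_tail]
  open_source := (M.chart a).open_source.preimage continuous_fst
  open_target := (M.chart a).open_target.preimage tailL.continuous
  continuousOn_toFun := by
    rw [continuousOn_pi]
    intro i
    refine Fin.cases continuous_snd.continuousOn (fun i => ?_) i
    exact (continuous_apply i).comp_continuousOn
      ((M.chart a).continuousOn.comp continuous_fst.continuousOn fun _ h => h)
  continuousOn_invFun :=
    ((M.chart a).continuousOn_symm.comp tailL.continuous.continuousOn fun _ h => h).prodMk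
      (continuous_apply 0).continuousOn

/-- The product `M × ℝ^{1|1}`. -/
def stab : Supermanifold.{u, v} (p + 1) (q + 1) where
  carrier := M.carrier × ℝ
  ι := M.ι
  chart := M.stabChart
  cover z := M.cover z.1
  trans a b := (M.trans a b).stab
  trans_body a b y hy := by
    obtain ⟨c, x, rfl⟩ := exists_eq_pt y
    rw [SuperMap.stab_body, M.trans_body a b x hy]
    rfl
  trans_parity a b k y hy := by
    obtain ⟨c, x, rfl⟩ := exists_eq_pt y
    induction k using Idx.cases_emb with
    | ht => exact Grassmann.hasParity_one.smul _
    | hθ => exact Grassmann.hasParity_gen _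
    | h k =>
      rw [SuperMap.stab_emb, Idx.par_emb]
      exact (M.trans_parity a b k x hy).lift
  trans_smooth a b k := by
    induction k using Idx.cases_emb with
    | ht => exact (contDiff_coord (.inl 0)).contDiffOn
    | hθ => exact (contDiff_coord (.inr 0)).contDiffOn
    | h k =>
      rw [SuperMap.stab_emb]
      exact contDiffOn_lift (M.trans_smooth a b k)
  trans_self a k y hy := by
    obtain ⟨c, x, rfl⟩ := exists_eq_pt y
    induction k using Idx.cases_emb with
    | ht => rfl
    | hθ => rfl
    | h k =>
      rw [SuperMap.stab_emb, lift_pt, M.trans_self a k x hy, ← lift_pt, lift_coord]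
  trans_comp a b d k y hy := by
    obtain ⟨c, x, rfl⟩ := exists_eq_pt y
    have hab : x ∈ M.overlap a b := ⟨hy.1, hy.2.1⟩
    have hbd : (M.trans a b).body x ∈ M.overlap b d := by
      refine ⟨M.body_mem_target hab, ?_⟩
      rw [M.trans_body a b x hab, Set.mem_preimage,
        (M.chart b).left_inv (show (M.chart a).symm x ∈ _ from hy.2.1)]
      exact hy.2.2
    induction k using Idx.cases_emb with
    | ht => exact (comp_coord_t_stab (trans_inl_hasParity hab)).symm
    | hθ => exact (comp_coord_theta_stab (trans_inl_hasParity hab)).symm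
    | h k =>
      rw [SuperMap.stab_emb, SuperMap.stab_emb, lift_pt,
        comp_lift_stab (trans_inl_hasParity hab) (contDiffAt_trans hbd k),
        M.trans_comp a b d k x hy]

/-- The homological vector field `Q + θ ∂_t`. -/
def HomologicalField.stab {M : Supermanifold.{u, v} p q} (Q : M.HomologicalField) :
    M.stab.HomologicalField where
  comp a := stabVector (Q.comp a)
  mem := by
    refine ⟨fun a => contDiffOn_stabVector (Q.mem.1 a), fun a b y hy => ?_⟩
    obtain ⟨c, x, rfl⟩ := exists_eq_pt y
    have hx : x ∈ M.overlap a b := hy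
    rw [tensorLaw_vector_iff]
    intro k
    change _ = SuperFun.comp _ (M.trans a b).stab _
    change (∑ i, _ * pd i ((M.trans a b).stab k)) (pt c x) = _
    rw [Finset.sum_apply, Idx.sum_emb]
    simp only [Pi.mul_apply, stabVector_t, stabVector_theta, stabVector_emb, Pi.zero_apply,
      zero_mul, add_zero]
    induction k using Idx.cases_emb with
    | ht =>
      rw [SuperMap.stab_t, stabVector_t, comp_coord_theta_stab (trans_inl_hasParity hx)]
      simp [pd_coord_t]
    | hθ =>
      rw [SuperMap.stab_theta, stabVector_theta, comp_zero]
      simp [pd_coord_theta]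
    | h k =>
      have h := tensorLaw_vector_iff.1 (Q.mem.2 a b x hx) k
      rw [SuperMap.stab_emb, stabVector_emb, comp_lift_stab (trans_inl_hasParity hx)
        (Q.mem.1.contDiffAt (M.body_mem_target hx) _ _), ← h, pd_t_lift (contDiffAt_trans hx k)]
      simp only [pd_emb_lift (contDiffAt_trans hx k), lift_pt, ← Grassmann.lift_mul,
        Finset.sum_apply, Pi.mul_apply, map_sum, mul_zero, zero_add]
  odd a i y hy := by
    obtain ⟨c, x, rfl⟩ := exists_eq_pt y
    induction i using Idx.cases_emb with
    | ht => exact Grassmann.hasParity_gen _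
    | hθ => exact Grassmann.hasParity_zero _
    | h i =>
      rw [stabVector_emb, Idx.par_emb]
      exact (Q.odd a i x hy).lift
  sq a k y hy := by
    obtain ⟨c, x, rfl⟩ := exists_eq_pt y
    have hx : x ∈ (M.chart a).target := hy
    rw [Finset.sum_apply, Idx.sum_emb]
    simp only [Pi.mul_apply, stabVector_t, stabVector_theta, stabVector_emb, Pi.zero_apply,
      zero_mul, add_zero]
    induction k using Idx.cases_emb with
    | ht =>
      rw [stabVector_t]
      simp [pd_coord_theta]
    | hθ =>
      rw [stabVector_theta]
      simp
    | h k =>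
      have h := Q.mem.1.contDiffAt hx (fun _ => k) Fin.elim0
      rw [stabVector_emb, pd_t_lift h]
      simp only [pd_emb_lift h, lift_pt, ← Grassmann.lift_mul, ← map_sum, mul_zero, zero_add]
      have hs := Q.sq a k x hx
      rw [Finset.sum_apply] at hs
      exact (congrArg Grassmann.lift hs).trans (map_zero _)

/-- The connection `(1 - c) ∇₀ + c ∇₁`. -/
def SymmetricConnection.interp {M : Supermanifold.{u, v} p q} (D₀ D₁ : M.SymmetricConnection)
    (c : ℝ) : M.SymmetricConnection where
  Γ a := _root_.interp c (D₀.Γ a) (D₁.Γ a)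
  smooth a := contDiffOn_interp (D₀.smooth a) (D₁.smooth a) c
  even a i j k x hx := ((D₀.even a i j k x hx).smul _).add ((D₁.even a i j k x hx).smul _)
  symm a i j k x hx := by
    change (1 - c) • D₀.Γ a i j k x + c • D₁.Γ a i j k x =
      (-1) ^ (i.par * j.par) * ((1 - c) • D₀.Γ a j i k x + c • D₁.Γ a j i k x)
    rw [D₀.symm a i j k x hx, D₁.symm a i j k x hx, mul_add, mul_smul_comm, mul_smul_comm]
  law a b x hx i j r := by
    have h0 := D₀.law a b x hx i j r
    have h1 := D₁.law a b x hx i j r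
    have hc (k l : Idx p q) : SuperFun.comp (_root_.interp c (D₀.Γ b) (D₁.Γ b) k l r)
        (M.trans a b) x = (1 - c) • SuperFun.comp (D₀.Γ b k l r) (M.trans a b) x +
          c • SuperFun.comp (D₁.Γ b k l r) (M.trans a b) x := by
      have hb := (M.chart b).open_target.mem_nhds (M.body_mem_target hx)
      have e0 := (D₀.smooth b k l r).contDiffAt hb
      have e1 := (D₁.smooth b k l r).contDiffAt hb
      rw [← SuperFun.comp_smul _ e0, ← SuperFun.comp_smul _ e1,
        ← SuperFun.comp_add (f := (1 - c) • D₀.Γ b k l r) (g := c • D₁.Γ b k l r)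
          (e0.const_smul (1 - c)) (e1.const_smul c)]
      rfl
    have hl (k : Idx p q) : _root_.interp c (D₀.Γ a) (D₁.Γ a) i j k x =
        (1 - c) • D₀.Γ a i j k x + c • D₁.Γ a i j k x := rfl
    simp only [Pi.add_apply, Finset.sum_apply, Pi.mul_apply] at h0 h1 ⊢
    simp only [hc, hl, add_mul, mul_add, smul_mul_assoc, mul_smul_comm, Finset.sum_add_distrib,
      ← Finset.smul_sum, h0, h1]
    rw [smul_add, smul_add, add_add_add_comm, ← add_smul]
    simp

/-- The connection on `M × ℝ^{1|1}` that is `(1 - t) ∇₀ + t ∇₁` along `M`, and flat in the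
directions of `t` and `θ`. -/
def SymmetricConnection.stab {M : Supermanifold.{u, v} p q} (D₀ D₁ : M.SymmetricConnection) :
    M.stab.SymmetricConnection where
  Γ a := stabChristoffel (D₀.Γ a) (D₁.Γ a)
  smooth a := contDiffOn_stabChristoffel (D₀.smooth a) (D₁.smooth a)
  even a i j k y hy := by
    obtain ⟨c, x, rfl⟩ := exists_eq_pt y
    by_cases h : i ∉ Set.range (Idx.emb : Idx p q → _) ∨ j ∉ Set.range (Idx.emb : Idx p q → _) ∨
        k ∉ Set.range (Idx.emb : Idx p q → _)
    · rw [stabChristoffel_eq_zero h]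
      exact Grassmann.hasParity_zero _
    · push Not at h
      obtain ⟨⟨i, rfl⟩, ⟨j, rfl⟩, k, rfl⟩ := h
      rw [stabChristoffel_emb, Idx.par_emb, Idx.par_emb, Idx.par_emb]
      exact ((D₀.interp D₁ c).even a i j k x hy).lift
  symm a i j k y hy := by
    obtain ⟨c, x, rfl⟩ := exists_eq_pt y
    by_cases h : i ∉ Set.range (Idx.emb : Idx p q → _) ∨ j ∉ Set.range (Idx.emb : Idx p q → _) ∨
        k ∉ Set.range (Idx.emb : Idx p q → _)
    · rw [stabChristoffel_eq_zero h, stabChristoffel_eq_zero (or_left_comm.1 h)]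
      simp
    · push Not at h
      obtain ⟨⟨i, rfl⟩, ⟨j, rfl⟩, k, rfl⟩ := h
      rw [stabChristoffel_emb, stabChristoffel_emb, Idx.par_emb, Idx.par_emb,
        neg_one_pow_mul_eq_zsmul, ← map_zsmul, ← neg_one_pow_mul_eq_zsmul]
      exact congrArg Grassmann.lift ((D₀.interp D₁ c).symm a i j k x hy)
  law a b y hy i j r := by
    obtain ⟨c, x, rfl⟩ := exists_eq_pt y
    have hx : x ∈ M.overlap a b := hy
    have hU := M.isOpen_overlap a b
    have hU' : IsOpen (Fin.tail ⁻¹' M.overlap a b : Set (Fin (p + 1) → ℝ)) :=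
      hU.preimage tailL.continuous
    have hy' : pt c x ∈ (Fin.tail ⁻¹' M.overlap a b : Set (Fin (p + 1) → ℝ)) := hx
    have hpd (k : Idx p q) (j : Idx (p + 1) (q + 1)) :=
      pd_lift hU (M.trans_smooth a b k) hy' j
    have hconst (P : Prop) [Decidable P] :
        pd i (fun _ : Fin (p + 1) → ℝ => if P then (1 : Grassmann (q + 1)) else 0) = 0 := by
      split_ifs
      · simpa using pd_const_one i (1 : ℝ)
      · exact pd_zero i
    have hpd2 (k : Idx p q) (i j : Idx (p + 1) (q + 1)) :
        pd i (pd j (SuperFun.lift (M.trans a b k))) (pt c x) =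
          pd i (Idx.extend 0 0 (fun j => SuperFun.lift (pd j (M.trans a b k))) j) (pt c x) :=
      pd_congr hU' hy' (fun z hz => pd_lift hU (M.trans_smooth a b k) hz j) i
    change (∑ k, _ * pd k ((M.trans a b).stab r)) (pt c x) =
      (pd i (pd j ((M.trans a b).stab r)) + ∑ k, ∑ l, tw i.par (pd j ((M.trans a b).stab l)) *
        pd i ((M.trans a b).stab k) * SuperFun.comp _ (M.trans a b).stab) (pt c x)
    simp only [Pi.add_apply, Finset.sum_apply, Pi.mul_apply, Idx.sum_emb]
    simp only [SuperMap.stab_emb, tw_apply]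
    have zl (Γ₀ Γ₁) (i j : Idx (p + 1) (q + 1)) :
        stabChristoffel Γ₀ Γ₁ i j (.inl 0) = (0 : SuperFun (p + 1) (q + 1)) ∧
        stabChristoffel Γ₀ Γ₁ i j (.inr 0) = (0 : SuperFun (p + 1) (q + 1)) ∧
        stabChristoffel Γ₀ Γ₁ i (.inl 0) j = (0 : SuperFun (p + 1) (q + 1)) ∧
        stabChristoffel Γ₀ Γ₁ i (.inr 0) j = (0 : SuperFun (p + 1) (q + 1)) ∧
        stabChristoffel Γ₀ Γ₁ (.inl 0) i j = (0 : SuperFun (p + 1) (q + 1)) ∧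
        stabChristoffel Γ₀ Γ₁ (.inr 0) i j = (0 : SuperFun (p + 1) (q + 1)) := by
      refine ⟨?_, ?_, ?_, ?_, ?_, ?_⟩ <;> apply stabChristoffel_eq_zero <;> simp
    simp only [(zl _ _ _ _).1, (zl _ _ _ _).2.1, (zl _ _ _ _).2.2.1, (zl _ _ _ _).2.2.2.1,
      (zl _ _ _ _).2.2.2.2.1, (zl _ _ _ _).2.2.2.2.2, Pi.zero_apply, zero_mul, zero_add,
      comp_zero, mul_zero, Finset.sum_const_zero]
    induction r using Idx.cases_emb with
    | ht =>
      simp only [SuperMap.stab_t, pd_coord_t, hconst]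
      simp [(zl _ _ _ _).1, comp_zero]
    | hθ =>
      simp only [SuperMap.stab_theta, pd_coord_theta, hconst]
      simp [(zl _ _ _ _).2.1, comp_zero]
    | h r =>
      simp only [SuperMap.stab_emb, hpd2, hpd]
      induction j using Idx.cases_emb with
      | ht => simp [(zl _ _ _ _).2.2.1]
      | hθ => simp [(zl _ _ _ _).2.2.2.1]
      | h j =>
        have hs := contDiffOn_pd hU j (M.trans_smooth a b r)
        simp only [Idx.extend_emb, pd_lift hU hs hy', lift_pt]
        induction i using Idx.cases_emb with
        | ht => simp [(zl _ _ _ _).2.2.2.2.1]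
        | hθ => simp [(zl _ _ _ _).2.2.2.2.2]
        | h i =>
          have hcomp (k l : Idx p q) :
              SuperFun.comp (stabChristoffel (D₀.Γ b) (D₁.Γ b) k.emb l.emb r.emb)
                (M.trans a b).stab (pt c x) =
              Grassmann.lift (SuperFun.comp ((D₀.interp D₁ c).Γ b k l r) (M.trans a b) x) := by
            have hb : pt c ((M.trans a b).body x) ∈ (Fin.tail ⁻¹' (M.chart b).target :
                Set (Fin (p + 1) → ℝ)) := M.body_mem_target hx
            have hs := (contDiffOn_stabChristoffel (D₀.smooth b) (D₁.smooth b)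
              k.emb l.emb r.emb).contDiffAt
                (((M.chart b).open_target.preimage tailL.continuous).mem_nhds hb)
            have e0 : s0 c (stabChristoffel (D₀.Γ b) (D₁.Γ b) k.emb l.emb r.emb) =
                (D₀.interp D₁ c).Γ b k l r := by
              funext z
              rw [s0, stabChristoffel_emb, Grassmann.r0_lift]
              rfl
            have e1 : s1 c (stabChristoffel (D₀.Γ b) (D₁.Γ b) k.emb l.emb r.emb) = 0 := by
              funext z
              rw [s1, stabChristoffel_emb, Grassmann.r1_lift]
              rfl
            refine Grassmann.ext_r ?_ ?_
            · rw [r0_comp_stab hs, e0, Grassmann.r0_lift]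
            · rw [r1_comp_stab (trans_inl_hasParity hx) hs, e1, Grassmann.r1_lift, comp_zero]
          have h := (D₀.interp D₁ c).law a b x hx i j r
          simp only [Pi.add_apply, Finset.sum_apply, Pi.mul_apply, tw_apply] at h
          simp only [hcomp, stabChristoffel_emb, Idx.par_emb, Idx.extend_emb, lift_pt,
            Grassmann.iterate_hat_lift, ← Grassmann.lift_mul, ← map_sum, ← map_add]
          exact congrArg Grassmann.lift h

end Supermanifold

/-! ### The `θ`-component of a tensor field on the product -/

section Slice

variable {p q n m : ℕ}

theorem frameProd_apply (b : Idx p q → Idx p q → SuperFun p q) (I K : Fin n → Idx p q)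
    (x : Fin p → ℝ) : frameProd b I K x =
      (List.ofFn fun s => Grassmann.hat^[parBefore K s] (b (I s) (K s) x)).prod := by
  rw [frameProd]
  change Pi.evalMonoidHom (fun _ : Fin p → ℝ => Grassmann q) x (List.prod _) = _
  rw [map_list_prod, List.map_ofFn]
  rfl

theorem frameProd_stab_emb {b : Idx p q → Idx p q → SuperFun p q}
    {b' : Idx (p + 1) (q + 1) → Idx (p + 1) (q + 1) → SuperFun (p + 1) (q + 1)} {c : ℝ}
    {x : Fin p → ℝ} (h : ∀ i k, b' i.emb k.emb (pt c x) = Grassmann.lift (b i k x))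
    (I K : Fin n → Idx p q) :
    frameProd b' (Idx.emb ∘ I) (Idx.emb ∘ K) (pt c x) = Grassmann.lift (frameProd b I K x) := by
  rw [frameProd_apply, frameProd_apply, ← Grassmann.prod_map_lift, List.map_ofFn]
  simp only [Function.comp_apply, h, Grassmann.iterate_hat_lift, parBefore_emb]
  rfl

/-- The Jacobian of `φ.stab` has no entries that mix old and extra coordinates. -/
theorem frameProd_stab_eq_zero
    {b' : Idx (p + 1) (q + 1) → Idx (p + 1) (q + 1) → SuperFun (p + 1) (q + 1)}
    {y : Fin (p + 1) → ℝ}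
    (h : ∀ (k : Idx p q), b' (.inl 0) k.emb y = 0 ∧ b' (.inr 0) k.emb y = 0)
    {I : Fin n → Idx (p + 1) (q + 1)} (hI : I ∉ Set.range fun I : Fin n → Idx p q => Idx.emb ∘ I)
    (K : Fin n → Idx p q) : frameProd b' I (Idx.emb ∘ K) y = 0 := by
  obtain ⟨s, hs⟩ := Idx.exists_notMem_range hI
  rw [frameProd_apply]
  refine List.prod_ofFn_eq_zero _ s ?_
  have : b' (I s) ((Idx.emb ∘ K) s) y = 0 := by
    rcases Idx.notMem_range_emb hs with h' | h' <;> rw [h']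
    · exact (h (K s)).1
    · exact (h (K s)).2
  rw [this, Grassmann.iterate_hat_zero]

/-- The components in the old directions of the coefficient of `θ` of a tensor field on
`M × ℝ^{1|1}`, along the slice `t = c`. -/
def slice (c : ℝ) (T : Arr (p + 1) (q + 1) n m) : Arr p q n m := fun I J =>
  s1 c (T (Idx.emb ∘ I) (Idx.emb ∘ J))

/-- As the transition maps do not involve `t` and `θ`, the coefficient of `θ` of the tensor law on the
product is the tensor law on the slice. -/
theorem TensorLaw.slice {φ : SuperMap p q p q} {T T' : Arr (p + 1) (q + 1) n m} {c : ℝ}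
    {x : Fin p → ℝ} (hφ : ∀ i, (φ (.inl i) x).HasParity 0) (hs : ∀ k, ContDiffAt ℝ ∞ (φ k) x)
    (hT' : ∀ K L, ContDiffAt ℝ ∞ (T' K L) (pt c (φ.body x)))
    (h : TensorLaw φ.stab T T' (pt c x)) : TensorLaw φ (_root_.slice c T) (_root_.slice c T') x := by
  intro K J
  have hKJ := congrArg Grassmann.r1 (h (Idx.emb ∘ K) (Idx.emb ∘ J))
  simp only [Finset.sum_apply, Pi.mul_apply] at hKJ ⊢
  have hb0 (k : Idx p q) : pd (.inl 0) (φ.stab k.emb) (pt c x) = 0 ∧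
      pd (.inr 0) (φ.stab k.emb) (pt c x) = 0 := by
    rw [SuperMap.stab_emb]
    exact ⟨pd_t_lift (hs k), pd_theta_lift _ _⟩
  have hb (i k : Idx p q) : pd i.emb (φ.stab k.emb) (pt c x) = Grassmann.lift (pd i (φ k) x) := by
    rw [SuperMap.stab_emb, pd_emb_lift (hs k)]
  have hc0 (j : Idx p q) :
      tw j.emb.par (pd j.emb (φ.stab (.inl 0))) (pt c x) = 0 ∧
      tw j.emb.par (pd j.emb (φ.stab (.inr 0))) (pt c x) = 0 := by
    simp [pd_coord_t, pd_coord_theta, tw_apply]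
  have hc (l j : Idx p q) : tw j.emb.par (pd j.emb (φ.stab l.emb)) (pt c x) =
      Grassmann.lift (tw j.par (pd j (φ l)) x) := by
    rw [tw_apply, hb, Idx.par_emb, Grassmann.iterate_hat_lift, tw_apply]
  rw [← Fintype.sum_of_injective _ (Idx.emb_comp_injective n)
      (fun I => T (Idx.emb ∘ I) (Idx.emb ∘ J) (pt c x) *
        Grassmann.lift (frameProd (fun i k => pd i (φ k)) I K x)),
    ← Fintype.sum_of_injective _ (Idx.emb_comp_injective m)
      (fun L => SuperFun.comp (T' (Idx.emb ∘ K) (Idx.emb ∘ L)) φ.stab (pt c x) *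
        Grassmann.lift (tw (parSum K) (frameProd (fun l j => tw j.par (pd j (φ l))) L J) x))]
    at hKJ
  · simp only [map_sum, Grassmann.r1_mul, Grassmann.r0_lift, Grassmann.r1_lift, mul_zero,
      add_zero, r1_comp_stab hφ (hT' _ _)] at hKJ
    exact hKJ
  · intro L hL
    rw [tw_apply, frameProd_stab_eq_zero hc0 hL, Grassmann.iterate_hat_zero, mul_zero]
  · intro L
    rw [tw_apply, tw_apply, frameProd_stab_emb hc, parSum_emb, Grassmann.iterate_hat_lift]
  · intro I hI
    rw [frameProd_stab_eq_zero hb0 hI, mul_zero]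
  · intro I
    rw [frameProd_stab_emb hb]

theorem lieDeriv_apply (Q : Arr p q 1 0) (T : Arr p q n m) (I : Fin n → Idx p q)
    (J : Fin m → Idx p q) (x : Fin p → ℝ) :
    lieDeriv Q T I J x =
      (∑ i, Q (fun _ => i) Fin.elim0 x * pd i (T I J) x) +
      (∑ s, ∑ i, (-1 : ℤ) ^ parBefore I s • (Grassmann.hat (T (Function.update I s i) J x) *
        Grassmann.hat^[parBefore I s]
          (-((-1 : ℤ) ^ i.par • pd i (Q (fun _ => I s) Fin.elim0) x)))) +
      (∑ s, ∑ j, (-1 : ℤ) ^ (parSum I + parBefore J s) •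
        (Grassmann.hat (T I (Function.update J s j) x) *
          Grassmann.hat^[parSum I + parBefore J s]
            (Grassmann.hat^[(J s).par] (pd (J s) (Q (fun _ => j) Fin.elim0) x)))) := by
  have h (k : ℕ) (f : SuperFun p q) : (-(-1) ^ k * f) x = -((-1 : ℤ) ^ k • f x) := by
    rw [neg_mul, Pi.neg_apply, sign_mul_apply]
  simp only [lieDeriv, Pi.add_apply, Finset.sum_apply, sign_mul_apply]
  congr 1
  congr 1
  refine Finset.sum_congr rfl fun s _ => Finset.sum_congr rfl fun i _ => ?_
  rw [← h]
  rfl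

/-- The coefficient of `θ` of the Lie derivative along `Q + θ ∂_t`. -/
theorem r1_lieDeriv_stab {Q : Arr p q 1 0} {T : Arr (p + 1) (q + 1) n m} {c : ℝ} {x : Fin p → ℝ}
    (hQ : ∀ i, ContDiffAt ℝ ∞ (Q (fun _ => i) Fin.elim0) x)
    (hodd : ∀ i, (Q (fun _ => i) Fin.elim0 x).HasParity (i.par + 1))
    (hT : ∀ I J, DifferentiableAt ℝ (T I J) (pt c x)) (I : Fin n → Idx p q)
    (J : Fin m → Idx p q) :
    Grassmann.r1 (lieDeriv (stabVector Q) T (Idx.emb ∘ I) (Idx.emb ∘ J) (pt c x)) =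
      Grassmann.r0 (pd (.inl 0) (T (Idx.emb ∘ I) (Idx.emb ∘ J)) (pt c x)) -
        lieDeriv Q (slice c T) I J x := by
  have hu {k : ℕ} (I : Fin k → Idx p q) (s : Fin k) (i : Idx p q) :
      Function.update (Idx.emb ∘ I) s i.emb = Idx.emb ∘ Function.update I s i :=
    (Function.comp_update Idx.emb I s i).symm
  have h1 (i : Idx p q) : Grassmann.hat (Q (fun _ => i) Fin.elim0 x) *
      ((-1 : ℝ) ^ i.par • pd i (s1 c (T (Idx.emb ∘ I) (Idx.emb ∘ J))) x) =
      -(Q (fun _ => i) Fin.elim0 x * pd i (s1 c (T (Idx.emb ∘ I) (Idx.emb ∘ J))) x) := by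
    rw [(hodd i).hat_eq, smul_mul_smul_comm, pow_succ, mul_neg_one, neg_mul, ← mul_pow]
    simp
  have h2 (k l : ℕ) (z : Grassmann q) :
      Grassmann.hat^[k] (-((-1 : ℤ) ^ l • Grassmann.lift z)) =
        Grassmann.lift (Grassmann.hat^[k] (-((-1 : ℤ) ^ l • z))) := by
    rw [← Grassmann.iterate_hat_lift, map_neg, map_zsmul]
  rw [lieDeriv_apply, lieDeriv_apply]
  simp only [Idx.sum_emb, stabVector_t, stabVector_theta, stabVector_emb, Function.comp_apply,
    pd_t_lift (hQ _), pd_theta_lift, pd_emb_lift (hQ _), pd_coord_theta, pd_zero, Pi.zero_apply,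
    Idx.emb_ne_theta, if_false, smul_zero, neg_zero, Grassmann.iterate_hat_zero, mul_zero,
    zero_mul, add_zero, zero_add, hu, parSum_emb, parBefore_emb, Idx.par_emb, lift_pt, map_add,
    map_sum, map_zsmul, Grassmann.r1_mul, Grassmann.r1_lift, Grassmann.r0_lift,
    h2, Grassmann.iterate_hat_lift,
    Grassmann.r1_hat, r1_pd_emb (hT _ _), h1, neg_mul, smul_neg, Finset.sum_neg_distrib]
  have h3 : Grassmann.r1 (coord (.inr 0) (pt c x)) = (1 : Grassmann q) := Grassmann.r1_gen_zero
  have h4 : Grassmann.r0 (coord (.inr 0) (pt c x)) = (0 : Grassmann q) := Grassmann.r0_gen_zero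
  rw [h3, h4]
  simp only [one_mul, Grassmann.hat_zero, zero_mul, add_zero]
  change _ = _ - (∑ i, _ * pd i (s1 c _) x + _ + _)
  rw [sub_eq_add_neg, neg_add, neg_add, ← add_assoc, ← add_assoc]
  rfl

end Slice

/-! ### Polynomial dependence on the parameter -/

section Polynomial

open Polynomial

/-- A function of a real parameter whose coefficients are polynomials of degree at most `N`. -/
def IsPolyFun {q : ℕ} (N : ℕ) (g : ℝ → Grassmann q) : Prop :=
  ∀ K, ∃ P : ℝ[X], P.natDegree ≤ N ∧ ∀ t, g t K = P.eval t

namespace IsPolyFun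

variable {q N M : ℕ} {f g : ℝ → Grassmann q}

theorem mono (hf : IsPolyFun N f) (h : N ≤ M) : IsPolyFun M f := fun K =>
  let ⟨P, hP, e⟩ := hf K
  ⟨P, hP.trans h, e⟩

theorem const (x : Grassmann q) : IsPolyFun N fun _ => x := fun K =>
  ⟨C (x K), by simp, by simp⟩

theorem add (hf : IsPolyFun N f) (hg : IsPolyFun N g) : IsPolyFun N fun t => f t + g t := fun K =>
  let ⟨P, hP, e⟩ := hf K
  let ⟨P', hP', e'⟩ := hg K
  ⟨P + P', natDegree_add_le_of_degree_le hP hP', fun t => by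
    change (f t + g t) K = _
    rw [Grassmann.add_apply, e, e', eval_add]⟩

theorem smul (r : ℝ) (hf : IsPolyFun N f) : IsPolyFun N fun t => r • f t := fun K =>
  let ⟨P, hP, e⟩ := hf K
  ⟨C r * P, (natDegree_C_mul_le r P).trans hP, fun t => by
    change (r • f t) K = _
    rw [Grassmann.smul_apply, e, eval_mul, eval_C]⟩

theorem zsmul (r : ℤ) (hf : IsPolyFun N f) : IsPolyFun N fun t => r • f t := by
  simpa only [Int.cast_smul_eq_zsmul] using hf.smul (r : ℝ)

theorem sum {ι : Type*} (s : Finset ι) {f : ι → ℝ → Grassmann q} (hf : ∀ i, IsPolyFun N (f i)) :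
    IsPolyFun N fun t => ∑ i ∈ s, f i t := by
  classical
  induction s using Finset.induction_on with
  | empty => simpa using const 0
  | insert a s ha ih => simpa only [Finset.sum_insert ha] using (hf a).add ih

theorem hat (hf : IsPolyFun N f) : IsPolyFun N fun t => Grassmann.hat (f t) := fun K =>
  let ⟨P, hP, e⟩ := hf K
  ⟨C ((-1) ^ K.card) * P, (natDegree_C_mul_le _ P).trans hP, fun t => by
    change (-1) ^ K.card * f t K = _
    rw [e, eval_mul, eval_C]⟩

theorem iterate_hat (k : ℕ) (hf : IsPolyFun N f) : IsPolyFun N fun t => Grassmann.hat^[k] (f t) := by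
  induction k generalizing f with
  | zero => exact hf
  | succ k ih => exact ih hf.hat

theorem mul (hf : IsPolyFun N f) (hg : IsPolyFun M g) : IsPolyFun (N + M) fun t => f t * g t := by
  intro K
  choose P hP e using hf
  choose P' hP' e' using hg
  refine ⟨∑ I ∈ K.powerset, C ((-1) ^ Grassmann.inv I (K \ I)) * (P I * P' (K \ I)), ?_, ?_⟩
  · refine natDegree_sum_le_of_forall_le _ _ fun I _ => ?_
    exact (natDegree_C_mul_le _ _).trans (natDegree_mul_le_of_le (hP _) (hP' _))
  · intro t
    change (f t * g t) K = _
    rw [Grassmann.mul_apply, eval_finsetSum]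
    refine Finset.sum_congr rfl fun I _ => ?_
    rw [e, e', eval_mul, eval_mul, eval_C]

end IsPolyFun

/-- A universal expression depends polynomially on `c` for the connections `(1 - c) ∇₀ + c ∇₁`. -/
theorem UnivExpr.exists_isPoly {p q n m : ℕ} (C : UnivExpr n m) :
    ∃ N, ∀ (Q : Arr p q 1 0) (Γ₀ Γ₁ : Idx p q → Idx p q → Idx p q → SuperFun p q)
      (U : Set (Fin p → ℝ)), IsOpen U → (∀ I J, ContDiffOn ℝ ∞ (Q I J) U) →
      (∀ i j k, ContDiffOn ℝ ∞ (Γ₀ i j k) U) → (∀ i j k, ContDiffOn ℝ ∞ (Γ₁ i j k) U) →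
      ∀ x ∈ U, ∀ I J, IsPolyFun N fun c => C.evalAt Q (interp c Γ₀ Γ₁) x I J := by
  induction C with
  | jet S =>
    refine ⟨1, fun Q Γ₀ Γ₁ U hU hQ hΓ₀ hΓ₁ x hx I J K => ?_⟩
    refine ⟨C (S.eval Q Γ₁ I J x K - S.eval Q Γ₀ I J x K) * X + C (S.eval Q Γ₀ I J x K),
      natDegree_linear_le, fun c => ?_⟩
    change S.eval Q (interp c Γ₀ Γ₁) I J x K = _
    rw [S.eval_interp hU hQ hΓ₀ hΓ₁ I J c hx]
    simp only [Grassmann.add_apply, Grassmann.smul_apply, eval_add, eval_mul, eval_C, eval_X]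
    ring
  | one => exact ⟨0, fun _ _ _ _ _ _ _ _ _ _ _ _ => IsPolyFun.const 1⟩
  | delta =>
    refine ⟨0, fun _ _ _ _ _ _ _ _ _ _ I J => ?_⟩
    simp only [UnivExpr.evalAt_delta]
    exact IsPolyFun.const _
  | add S T hS hT =>
    obtain ⟨N, hN⟩ := hS
    obtain ⟨N', hN'⟩ := hT
    refine ⟨max N N', fun Q Γ₀ Γ₁ U hU hQ hΓ₀ hΓ₁ x hx I J => ?_⟩
    exact ((hN Q Γ₀ Γ₁ U hU hQ hΓ₀ hΓ₁ x hx I J).mono (le_max_left _ _)).add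
      ((hN' Q Γ₀ Γ₁ U hU hQ hΓ₀ hΓ₁ x hx I J).mono (le_max_right _ _))
  | smul r T hT =>
    obtain ⟨N, hN⟩ := hT
    exact ⟨N, fun Q Γ₀ Γ₁ U hU hQ hΓ₀ hΓ₁ x hx I J =>
      (hN Q Γ₀ Γ₁ U hU hQ hΓ₀ hΓ₁ x hx I J).smul r⟩
  | mul S T hS hT =>
    obtain ⟨N, hN⟩ := hS
    obtain ⟨N', hN'⟩ := hT
    refine ⟨N + N', fun Q Γ₀ Γ₁ U hU hQ hΓ₀ hΓ₁ x hx I J => ?_⟩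
    simp only [UnivExpr.evalAt_mul]
    exact ((hN Q Γ₀ Γ₁ U hU hQ hΓ₀ hΓ₁ x hx _ _).mul
      ((hN' Q Γ₀ Γ₁ U hU hQ hΓ₀ hΓ₁ x hx _ _).iterate_hat _)).zsmul _
  | perm σ τ T hT =>
    obtain ⟨N, hN⟩ := hT
    exact ⟨N, fun Q Γ₀ Γ₁ U hU hQ hΓ₀ hΓ₁ x hx I J =>
      (hN Q Γ₀ Γ₁ U hU hQ hΓ₀ hΓ₁ x hx _ _).zsmul _⟩
  | contr T hT =>
    obtain ⟨N, hN⟩ := hT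
    refine ⟨N, fun Q Γ₀ Γ₁ U hU hQ hΓ₀ hΓ₁ x hx I J => ?_⟩
    simp only [UnivExpr.evalAt_contr]
    exact IsPolyFun.sum _ fun a => hN Q Γ₀ Γ₁ U hU hQ hΓ₀ hΓ₁ x hx _ _

/-- A quadrature formula that is exact for polynomials of degree at most `N`, stated for their
derivatives. The nodes are `0, …, N`, and the weights are the integrals of the Lagrange basis. -/
theorem exists_quadrature (N : ℕ) : ∃ (w τ : ℕ → ℝ), ∀ P : ℝ[X], P.natDegree ≤ N →
    P.eval 1 - P.eval 0 = ∑ i ∈ Finset.range (N + 1), w i * P.derivative.eval (τ i) := by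
  set τ : ℕ → ℝ := fun i => i with hτ
  have hinj : Set.InjOn τ (Finset.range (N + 1)) := fun i _ j _ h => Nat.cast_injective h
  refine ⟨fun i => ∫ t in (0 : ℝ)..1, (Lagrange.basis (Finset.range (N + 1)) τ i).eval t, τ,
    fun P hP => ?_⟩
  have h1 : ∫ t in (0 : ℝ)..1, P.derivative.eval t = P.eval 1 - P.eval 0 :=
    intervalIntegral.integral_eq_sub_of_hasDerivAt (fun t _ => P.hasDerivAt t)
      (P.derivative.continuous.intervalIntegrable 0 1)
  have h2 : P.derivative = Lagrange.interpolate (Finset.range (N + 1)) τ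
      fun i => P.derivative.eval (τ i) := by
    refine Lagrange.eq_interpolate hinj ?_
    rw [Finset.card_range]
    refine lt_of_le_of_lt degree_le_natDegree ?_
    have := natDegree_derivative_le P
    exact_mod_cast (by omega : P.derivative.natDegree < N + 1)
  rw [← h1]
  conv_lhs => rw [h2]
  simp only [Lagrange.interpolate_apply, eval_finsetSum, eval_mul, eval_C]
  rw [intervalIntegral.integral_finsetSum]
  · refine Finset.sum_congr rfl fun i _ => ?_
    rw [intervalIntegral.integral_const_mul, mul_comm]
  · intro i _
    exact ((Polynomial.continuous _).const_mul _).intervalIntegrable 0 1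

end Polynomial

/-! ### Exactness of the difference -/

namespace Supermanifold

variable {p q n m : ℕ} {M : Supermanifold.{u, v} p q} {Q : M.HomologicalField}

theorem slice_mem_tensorField {T : M.stab.ι → Arr (p + 1) (q + 1) n m}
    (hT : T ∈ M.stab.tensorField n m) (c : ℝ) :
    (fun a : M.ι => slice c (T a)) ∈ M.tensorField n m := by
  refine ⟨fun a I J => contDiffOn_s1 c (hT.1 a _ _), fun a b x hx => ?_⟩
  refine TensorLaw.slice (trans_inl_hasParity hx) (contDiffAt_trans hx) (fun K L => ?_)
    (hT.2 a b (pt c x) hx)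
  exact hT.1.contDiffAt (show pt c ((M.trans a b).body x) ∈ (M.stab.chart b).target from
    M.body_mem_target hx) K L

/-- The coefficient of `θ` of a universal cocycle on `M × ℝ^{1|1}` is a primitive of the derivative
of the cocycle on `M` along the line of connections. -/
theorem hasDerivAt_eval_interp {C : UnivExpr n m} (hC : UnivExpr.IsUniversalCocycle.{u, v} C)
    (D₀ D₁ : M.SymmetricConnection) (a : M.ι) {x : Fin p → ℝ} (hx : x ∈ (M.chart a).target)
    (I : Fin n → Idx p q) (J : Fin m → Idx p q) (c : ℝ) :
    HasDerivAt (fun t => C.evalAt (Q.comp a) (interp t (D₀.Γ a) (D₁.Γ a)) x I J)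
      (lieDeriv (Q.comp a) (slice c (C.onCharts M.stab Q.stab (D₀.stab D₁) a)) I J x) c := by
  obtain ⟨hT, hclosed⟩ := hC _ _ M.stab Q.stab (D₀.stab D₁)
  set T := C.onCharts M.stab Q.stab (D₀.stab D₁) a
  have hx' : pt c x ∈ (M.stab.chart a).target := hx
  have hd (I J) : DifferentiableAt ℝ (T I J) (pt c x) :=
    (hT.1.contDiffAt hx' I J).differentiableAt (by simp)
  have h0 := r1_lieDeriv_stab (Q := Q.comp a) (fun i => Q.mem.1.contDiffAt hx _ _)
    (fun i => Q.odd a i x hx) hd I J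
  have h1 : lieDeriv (stabVector (Q.comp a)) T (Idx.emb ∘ I) (Idx.emb ∘ J) (pt c x) = 0 :=
    hclosed a _ _ _ hx'
  -- Closedness on the product turns `h0` into the equality of the `t`-derivative and `δ Ψ`.
  rw [h1, map_zero, eq_comm, sub_eq_zero] at h0
  rw [← h0]
  have h2 := Grassmann.r0.hasFDerivAt.comp_hasDerivAt c
    ((hd (Idx.emb ∘ I) (Idx.emb ∘ J)).hasFDerivAt.comp_hasDerivAt c (hasDerivAt_pt c x))
  refine h2.congr_of_eventuallyEq (Filter.Eventually.of_forall fun t => ?_)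
  exact (C.r0_eval_stab_emb (M.chart a).open_target (Q.mem.1 a) (D₀.smooth a) (D₁.smooth a)
    I J t hx).symm

theorem lieDeriv_sum_smul {ι : Type*} (s : Finset ι) (w : ι → ℝ)
    {T : ι → M.ι → Arr p q n m} (hT : ∀ i, M.IsSmooth (T i)) (a : M.ι) {x : Fin p → ℝ}
    (hx : x ∈ (M.chart a).target) (I : Fin n → Idx p q) (J : Fin m → Idx p q) :
    lieDeriv (Q.comp a) ((∑ i ∈ s, w i • T i) a) I J x =
      ∑ i ∈ s, w i • lieDeriv (Q.comp a) (T i a) I J x := by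
  classical
  have hsum (s : Finset ι) : M.IsSmooth (∑ i ∈ s, w i • T i) := by
    intro a I J
    rw [Finset.sum_apply, Finset.sum_apply, Finset.sum_apply]
    refine (ContDiffOn.sum (f := fun i => w i • T i a I J) (s := s) fun i _ =>
      (hT i a I J).const_smul (w i)).congr fun x _ => ?_
    rw [Finset.sum_apply]
    rfl
  induction s using Finset.induction_on with
  | empty =>
    have := lieDeriv_smul (Q.comp a) 0 (T := (0 : Arr p q n m)) (x := x)
      (fun _ _ => contDiffAt_const) I J
    rw [zero_smul, zero_smul] at this
    exact this
  | insert i s hi ih =>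
    rw [Finset.sum_insert hi, Finset.sum_insert hi, ← ih, Pi.add_apply, Pi.smul_apply,
      ← lieDeriv_smul _ _ ((hT i).contDiffAt hx)]
    exact lieDeriv_add _ (S := w i • T i a)
      (fun I J => ((hT i).contDiffAt hx I J).const_smul (w i)) ((hsum s).contDiffAt hx) I J

/-- The difference is the integral of `δ Ψ_c` over `0 ≤ c ≤ 1`, and a quadrature formula writes it as
`δ` of a finite linear combination of the tensor fields `Ψ_c`. -/
theorem onCharts_sub_mem_coboundary {C : UnivExpr n m}
    (hC : UnivExpr.IsUniversalCocycle.{u, v} C) (D₀ D₁ : M.SymmetricConnection) :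
    C.onCharts M Q D₁ - C.onCharts M Q D₀ ∈ M.coboundary Q n m := by
  obtain ⟨N, hN⟩ := C.exists_isPoly (p := p) (q := q)
  obtain ⟨w, τ, hw⟩ := exists_quadrature N
  set Ψ : ℝ → M.ι → Arr p q n m := fun c a =>
    slice c (C.onCharts M.stab Q.stab (D₀.stab D₁) a)
  have hmem (c : ℝ) : Ψ c ∈ M.tensorField n m :=
    slice_mem_tensorField (hC _ _ M.stab Q.stab (D₀.stab D₁)).1 c
  refine ⟨sub_mem (hC _ _ M Q D₁).1 (hC _ _ M Q D₀).1,
    ∑ i ∈ Finset.range (N + 1), w i • Ψ (τ i),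
    sum_mem fun i _ => Submodule.smul_mem _ _ (hmem _), fun a I J x hx => ?_⟩
  rw [lieDeriv_sum_smul _ _ (fun i => (hmem (τ i)).1) a hx]
  have hpoly := hN (Q.comp a) (D₀.Γ a) (D₁.Γ a) _ (M.chart a).open_target (Q.mem.1 a)
    (D₀.smooth a) (D₁.smooth a) x hx I J
  have hder (c : ℝ) := hasDerivAt_eval_interp (Q := Q) hC D₀ D₁ a hx I J c
  have e1 : interp 1 (D₀.Γ a) (D₁.Γ a) = D₁.Γ a := by simp [interp]
  have e0 : interp 0 (D₀.Γ a) (D₁.Γ a) = D₀.Γ a := by simp [interp]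
  have hdiff : (C.onCharts M Q D₁ - C.onCharts M Q D₀) a I J x =
      C.evalAt (Q.comp a) (interp 1 (D₀.Γ a) (D₁.Γ a)) x I J -
        C.evalAt (Q.comp a) (interp 0 (D₀.Γ a) (D₁.Γ a)) x I J := by
    rw [e0, e1]
    rfl
  rw [hdiff]
  ext K
  obtain ⟨P, hP, hPe⟩ := hpoly K
  replace hPe (t : ℝ) :
      C.evalAt (Q.comp a) (interp t (D₀.Γ a) (D₁.Γ a)) x I J K = P.eval t := hPe t
  have hPd (c : ℝ) : P.derivative.eval c = lieDeriv (Q.comp a) (Ψ c a) I J x K := by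
    have hK : HasDerivAt (fun t => P.eval t) (lieDeriv (Q.comp a) (Ψ c a) I J x K) c := by
      have := hasDerivAt_pi.1 (hder c) K
      simpa only [hPe] using this
    exact (P.hasDerivAt c).unique hK
  have hsum : (∑ i ∈ Finset.range (N + 1), w i • lieDeriv (Q.comp a) (Ψ (τ i) a) I J x) K =
      ∑ i ∈ Finset.range (N + 1), w i * lieDeriv (Q.comp a) (Ψ (τ i) a) I J x K :=
    Finset.sum_apply _ _ _
  rw [Grassmann.sub_apply, hPe, hPe, hw P hP, hsum]
  simp only [hPd]

end Supermanifold

end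

theorem theorem1 {n m : ℕ} (C : UnivExpr n m) (hC : UnivExpr.IsUniversalCocycle.{u, v} C)
    {p q : ℕ} (M : Supermanifold.{u, v} p q) (Q : M.HomologicalField) :
    (∀ D₀ D₁ : M.SymmetricConnection, hC.charClass M Q D₀ = hC.charClass M Q D₁) ∧
      ∃ c : M.Cohomology Q n m, ∀ D : M.SymmetricConnection, hC.charClass M Q D = c := by
  have h (D₀ D₁ : M.SymmetricConnection) : hC.charClass M Q D₀ = hC.charClass M Q D₁ := by
    rw [UnivExpr.IsUniversalCocycle.charClass, UnivExpr.IsUniversalCocycle.charClass,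
      Submodule.Quotient.eq]
    exact Supermanifold.onCharts_sub_mem_coboundary hC D₁ D₀
  refine ⟨h, ?_⟩
  by_cases hD : Nonempty M.SymmetricConnection
  · obtain ⟨D⟩ := hD
    exact ⟨hC.charClass M Q D, fun D' => h D' D⟩
  -- If there are no symmetric connections, every class will do.
  · exact ⟨0, fun D => absurd ⟨D⟩ hD⟩
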